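/- **Setting.** Let $k$ be a field. Let $\widetilde P$ be the smooth toric fourfold over $k$ whose fan consists of the 120 Weyl chambers of the root lattice $A_4$ and their faces. Its torus is $T=\{(X_1:\dots:X_5)\in\mathbb P^4:\prod X_i\neq 0\}$, and it is covered by charts $\mathbb A^4_\varsigma$, $\varsigma\in S_5$, with coordinates $(x,y,z,w)=\left(\frac{X_{\varsigma(1)}}{X_{\varsigma(2)}},\frac{X_{\varsigma(2)}}{X_{\varsigma(3)}},\frac{X_{\varsigma(3)}}{X_{\varsigma(4)}},\frac{X_{\varsigma(4)}}{X_{\varsigma(5)}}\right)$. For $\boldsymbol a=(a_1:\dots:a_6)\in\mathbb P^5(k)$ with all $a_i\ne 0$, let $X_{\boldsymbol a}\subset\widetilde P$ be the closure of $$\Big\{(X_1+\dots+X_5)\Big(\frac{a_1}{X_1}+\dots+\frac{a_5}{X_5}\Big)=a_6\Big\}\subset T ,$$ that is, the hypersurface with equation $$(a_{\varsigma(1)}+a_{\varsigma(2)}x+a_{\varsigma(3)}xy+a_{\varsigma(4)}xyz+a_{\varsigma(5)}xyzw)(1+w+wz+wzy+wzyx)=a_6xyzw$$ in the chart $\mathbb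 A^4_\varsigma$. Let $\overline X_{\boldsymbol a}$ be the blow-up of $X_{\boldsymbol a}$ along the ten disjoint surfaces which are the closures of $\{a_{\varsigma(1)}+a_{\varsigma(2)}x=y=0\}\subset\mathbb A^4_\varsigma$ (one for each set $\{\varsigma(1),\varsigma(2)\}$); it is a small resolution of the 30 nodes of $X_{\boldsymbol a}$ outside $T$. The big resolution $\widetilde{\overline X}_{\boldsymbol a}$ of $\overline X_{\boldsymbol a}$ is obtained by blowing up the remaining singular points, which are the (geometric) singular points of $X_{\boldsymbol a}$ in $T$. Let $$\phi:T\to\mathbb P^5,\qquad \phi(b_1:\dots:b_5)=\big(b_1^2:\dots:b_5^2:(b_1+\dots+b_5)^2\big),$$ and let $\mathcal E_{a,b,c,t}\subset\mathbb P^2$ be the plane cubic $(x+y+z)(axy+byz+czx)=t\,xyz$. **Reduction.** Let $p$ be a prime and let $\boldsymbol a=(a_1:\dots:a_6)\in\mathbb P^5(\mathbb Q)$, written with integers $a_i$ that are not all divisible by $p$. The reduction mod $p$ of $\widetilde{\overline X}_{\boldsymbol a}$ is obtained from $X_{\boldsymbol a \bmod p}$ by blowing up the ten surfaces and the reductions of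 the singular points in $T$ of $X_{\boldsymbol a}$ over $\overline{\mathbb Q}$. We say that $\widetilde{\overline X}_{\boldsymbol a}$ has smooth reduction mod $p$ if all $a_i$ are nonzero mod $p$ (so that $X_{\boldsymbol a \bmod p}$ is irreducible), the singular points in $T$ over $\overline{\mathbb Q}$ reduce to nodes (ordinary double points), and this reduction is smooth over $\overline{\mathbb F}_p$. Let $\#\widetilde{\overline X}_{\boldsymbol a}(\mathbb F_p)$ be the number of $\mathbb F_p$-points of the reduction. **Lemma.** If $\widetilde{\overline X}_{\boldsymbol a}$ has smooth reduction mod $p$, then $$\begin{aligned}\#\widetilde{\overline X}_{\boldsymbol a}(\mathbb F_p)={}&48p^2+46p+14\\ &+\sum_{x,y,z\in\mathbb F_p^\times}\left(\left(\frac{\big((1+x+y+z)(\frac{a_2}{x}+\frac{a_3}{y}+\frac{a_4}{z}+a_5)-a_1-a_6\big)^2-4a_1a_6}{p}\right)+1\right)\\ &+\sum_{\substack{\boldsymbol b=(b_1:\dots:b_5)\in T(\mathbb F_p)\\ \phi(\boldsymbol b)=\boldsymbol a\bmod p}}p\left(p+1+\left(\frac{b_1b_2b_3b_4b_5(b_1+\dots+b_5)}{p}\right)\right)\\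 &+\rho(a_1,a_6)\big(\#\mathcal E_{a_2,a_3,a_5,a_4}(\mathbb F_p)-6\big),\end{aligned}$$ where $\rho(a_1,a_6)=p$ if $a_1\equiv a_6 \bmod p$ and $0$ otherwise, and $\left(\frac{\cdot}{p}\right)$ is the Legendre symbol. -/

import Mathlib

open scoped LinearAlgebra.Projectivization

noncomputable section

namespace A4

/-! ### Charts of the toric variety and the threefold

`P` is the smooth toric variety over a field `K` whose fan consists of the Weyl chambers of `A₄` and
their faces.  It is covered by the `120` affine spaces `𝔸⁴_ς`, `ς ∈ S₅`, with coordinates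
`(x, y, z, w) = (v 0, v 1, v 2, v 3)`, where `v k = X_{ς k} / X_{ς (k + 1)}` on the torus
`T = ℙ⁴ ∖ {X₁ X₂ X₃ X₄ X₅ = 0}`.  Indices are counted from `0`, so that the parameter
`(a₁ : ⋯ : a₆)` is `a 0, …, a 5`. -/

/-- Coordinates in the chart `ς` of the torus point with homogeneous coordinates `b`. -/
def chartCoords {K : Type*} [Field K] (ς : Equiv.Perm (Fin 5)) (b : Fin 5 → K) : Fin 4 → K :=
  fun k => b (ς k.castSucc) / b (ς k.succ)

/-- The monomial `X_i / X_{ς 4}` as a polynomial in the coordinates of the chart `ς`: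
for `i = ς 0, ς 1, ς 2, ς 3, ς 4` it is `xyzw, yzw, zw, w, 1`. -/
def homCoord (K : Type*) [Field K] (ς : Equiv.Perm (Fin 5)) (i : Fin 5) :
    MvPolynomial (Fin 4) K :=
  ∏ m ∈ Finset.univ.filter (fun m : Fin 4 => ς.symm i ≤ m.castSucc), MvPolynomial.X m

/-- The equation of the threefold `X_a` in the chart `ς`. -/
def localEq {K : Type*} [Field K] (a : Fin 6 → K) (ς : Equiv.Perm (Fin 5)) :
    MvPolynomial (Fin 4) K :=
  let x : MvPolynomial (Fin 4) K := MvPolynomial.X 0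
  let y : MvPolynomial (Fin 4) K := MvPolynomial.X 1
  let z : MvPolynomial (Fin 4) K := MvPolynomial.X 2
  let w : MvPolynomial (Fin 4) K := MvPolynomial.X 3
  let c : Fin 5 → MvPolynomial (Fin 4) K := fun k => MvPolynomial.C (a (ς k).castSucc)
  (c 0 + c 1 * x + c 2 * (x * y) + c 3 * (x * y * z) + c 4 * (x * y * z * w))
      * (1 + w + w * z + w * z * y + w * z * y * x)
    - MvPolynomial.C (a 5) * (x * y * z * w)

/-- `v` is a singular point of the affine hypersurface `F = 0`. -/
def IsSingularAt {K : Type*} [Field K] {n : ℕ} (F : MvPolynomial (Fin n) K) (v : Fin n → K) :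
    Prop :=
  MvPolynomial.eval v F = 0 ∧ ∀ i, MvPolynomial.eval v (MvPolynomial.pderiv i F) = 0

/-- `v` is a node of the hypersurface `F = 0` in affine `4`-space: a singular point at which the
Hessian (the polar form of the quadratic part of `F`) is nondegenerate. -/
def IsNodeAt {K : Type*} [Field K] (F : MvPolynomial (Fin 4) K) (v : Fin 4 → K) : Prop :=
  IsSingularAt F v ∧
    (Matrix.of fun i j : Fin 4 =>
      MvPolynomial.eval v (MvPolynomial.pderiv i (MvPolynomial.pderiv j F))).det ≠ 0

/-! ### Blowing up -/

/-- Let `A = K[v₁, …, vₙ] / (F)` and let `I ⊆ A` be the ideal generated by the family `f`.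
For a local `K`-algebra `L`, an `L`-valued point of the blow-up `Proj (⨁ Iᵈ)` of `Spec A` along `I`
is a pair `(P, s)` with `P : A → L` and `s` a family in `L` with an invertible member, up to
multiplication of `s` by units, at which all homogeneous relations between the `f i` over `A`
vanish.  (The relation `F` itself, of degree `0`, says that `P` lies on `F = 0`.)  We use `L = K` for
points and `L = K[ε]` for tangent vectors. -/
def IsBlowUpPoint {K : Type*} [Field K] {n : ℕ} {ι : Type*} (F : MvPolynomial (Fin n) K)
    (f : ι → MvPolynomial (Fin n) K) {L : Type*} [CommRing L] [Algebra K L]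
    (P : Fin n → L) (s : ι → L) : Prop :=
  (∃ i, IsUnit (s i)) ∧
    ∀ (d : ℕ) (G : MvPolynomial ι (MvPolynomial (Fin n) K)), G.IsHomogeneous d →
      MvPolynomial.eval f G ∈ Ideal.span {F} →
        MvPolynomial.eval₂ (MvPolynomial.aeval P : MvPolynomial (Fin n) K →ₐ[K] L).toRingHom s G = 0

/-- Generators `(a_{ς 0} + a_{ς 1} x, y)` of the ideal, in the chart `ς`, of the surface
`S : a_{ς 0} + a_{ς 1} x = y = 0`.  This surface depends only on the set `{ς 0, ς 1}`, and the other
nine of the ten surfaces do not meet the chart. -/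
def surfaceGens {K : Type*} [Field K] (a : Fin 6 → K) (ς : Equiv.Perm (Fin 5)) :
    Fin 2 → MvPolynomial (Fin 4) K :=
  ![MvPolynomial.C (a (ς 0).castSucc) + MvPolynomial.C (a (ς 1).castSucc) * MvPolynomial.X 0,
    MvPolynomial.X 1]

/-- Generators `X_i b_j - X_j b_i` of the ideal, in the chart `ς`, of the torus point `b`. -/
def pointGens {K : Type*} [Field K] (b : Fin 5 → K) (ς : Equiv.Perm (Fin 5)) :
    Fin 5 × Fin 5 → MvPolynomial (Fin 4) K :=
  fun ij => homCoord K ς ij.1 * MvPolynomial.C (b ij.2) - homCoord K ς ij.2 * MvPolynomial.C (b ij.1)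

/-- A `K`-point, seen in a chart, of the variety obtained from `X_a` by blowing up the ten surfaces
and then the torus points in `B`.  The centres are pairwise disjoint, so this is the fibre
product over `X_a` of the blow-ups in the single centres. -/
structure ChartPoint (K : Type*) [Field K] (a : Fin 6 → K) (B : Set (ℙ K (Fin 5 → K))) where
  chart : Equiv.Perm (Fin 5)
  pt : Fin 4 → K
  on_threefold : MvPolynomial.eval pt (localEq a chart) = 0
  dir : ℙ K (Fin 2 → K)
  dir_mem : IsBlowUpPoint (localEq a chart) (surfaceGens a chart) pt dir.rep
  exc : B → ℙ K (Fin 5 × Fin 5 → K)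
  exc_mem : ∀ b : B, IsBlowUpPoint (localEq a chart) (pointGens b.1.rep chart) pt (exc b).rep

/-- `(ratioPart ς v i j : ratioPart ς v j i)` is the value in `ℙ¹` of the rational function
`(X_i : X_j)` at the point of the chart `ς` with coordinates `v`. -/
def ratioPart {K : Type*} [Field K] (ς : Equiv.Perm (Fin 5)) (v : Fin 4 → K) (i j : Fin 5) : K :=
  if ς.symm i < ς.symm j then
    ∏ m ∈ Finset.univ.filter (fun m : Fin 4 => ς.symm i ≤ m.castSucc ∧ m.castSucc < ς.symm j), v m
  else 1

/-- The value of `X_i / X_j` at a point where this function is finite and nonzero. -/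
def ratioVal {K : Type*} [Field K] (ς : Equiv.Perm (Fin 5)) (v : Fin 4 → K) (i j : Fin 5) : K :=
  ratioPart ς v i j / ratioPart ς v j i

/-- Two points in charts are the same point of the glued variety: they lie over the same point of
the toric variety, they agree over the surface centre, where the two generators in the chart `ς` are
`(a_i X_j + a_j X_i) / X_{ς 1}` and `X_{ς 1} / X_{ς 2}` with `{i, j} = {ς 0, ς 1}`, and they agree
over the point centres, where the generators in different charts differ by a common monomial
factor. -/
def Glued {K : Type*} [Field K] {a : Fin 6 → K} {B : Set (ℙ K (Fin 5 → K))}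
    (P Q : ChartPoint K a B) : Prop :=
  (∀ i j, ratioPart P.chart P.pt i j * ratioPart Q.chart Q.pt j i
      = ratioPart Q.chart Q.pt i j * ratioPart P.chart P.pt j i) ∧
  (({P.chart 0, P.chart 1} : Set (Fin 5)) = {Q.chart 0, Q.chart 1} →
    P.dir.rep 0 * Q.dir.rep 1 * ratioVal P.chart P.pt (P.chart 1) (Q.chart 1) ^ 2
        * ratioVal P.chart P.pt (Q.chart 2) (P.chart 2)
      = Q.dir.rep 0 * P.dir.rep 1) ∧
  P.exc = Q.exc

/-- The set of `K`-points of the blow-up, in the set `B` of nodes in the torus, of the small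
resolution `X̄_a` of `X_a`.  (Over a node that is not defined over `K` there are no `K`-points, so
`B` only has to contain the `K`-rational ones.) -/
def BigResolution (K : Type*) [Field K] (a : Fin 6 → K) (B : Set (ℙ K (Fin 5 → K))) : Type _ :=
  Quot (Glued (K := K) (a := a) (B := B))

/-- The Zariski tangent vectors of the blow-up at a point, in terms of coordinates of the chart and
of homogeneous coordinates of each of the fibre points.  The rescalings of the latter are not divided
out. -/
def tangentVectors {K : Type*} [Field K] {a : Fin 6 → K} {B : Set (ℙ K (Fin 5 → K))}
    (P : ChartPoint K a B) :
    Set ((Fin 4 → K) × (Fin 2 → K) × (B → Fin 5 × Fin 5 → K)) :=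
  {t | IsBlowUpPoint (localEq a P.chart) (surfaceGens a P.chart)
        (fun k => (TrivSqZeroExt.inl (P.pt k) + TrivSqZeroExt.inr (t.1 k) : DualNumber K))
        (fun k => (TrivSqZeroExt.inl (P.dir.rep k) + TrivSqZeroExt.inr (t.2.1 k) : DualNumber K)) ∧
      ∀ b : B, IsBlowUpPoint (localEq a P.chart) (pointGens b.1.rep P.chart)
        (fun k => (TrivSqZeroExt.inl (P.pt k) + TrivSqZeroExt.inr (t.1 k) : DualNumber K))
        (fun k => (TrivSqZeroExt.inl ((P.exc b).rep k) + TrivSqZeroExt.inr (t.2.2 b k) :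
          DualNumber K))}

/-- The threefold is nonsingular at the point: the Zariski tangent space is `3`-dimensional.  The
homogeneous coordinates in the fibres over the centres (one surface, and the points in `B`)
contribute one dimension of rescalings each. -/
def IsNonsingularAt {K : Type*} [Field K] {a : Fin 6 → K} {B : Set (ℙ K (Fin 5 → K))}
    (P : ChartPoint K a B) : Prop :=
  Module.finrank K (Submodule.span K (tangentVectors P)) = 3 + (1 + Nat.card B)

/-! ### Reduction modulo `p` -/

/-- The ring of all algebraic integers. -/
abbrev AlgInt : Type := integralClosure ℤ (AlgebraicClosure ℚ)

/-- `v`, a vector over an algebraic closure of `𝔽_p`, represents the reduction at a place over `p` of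
a singular point in the torus of the threefold `X_a` over an algebraic closure of `ℚ`. -/
def IsReductionOfNode (p : ℕ) [Fact p.Prime] (a : Fin 6 → ℤ)
    (v : Fin 5 → AlgebraicClosure (ZMod p)) : Prop :=
  ∃ (red : AlgInt →+* AlgebraicClosure (ZMod p)) (β : Fin 5 → AlgInt),
    (∀ i, β i ≠ 0) ∧
    IsSingularAt (localEq (fun i => (a i : AlgebraicClosure ℚ)) 1)
      (chartCoords 1 fun i => (β i : AlgebraicClosure ℚ)) ∧
    ∃ c : AlgebraicClosure (ZMod p), c ≠ 0 ∧ ∀ i, v i = c * red (β i)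

/-- The reductions modulo `p` of the nodes in the torus that are defined over `K`, a field between
`𝔽_p` and its algebraic closure. -/
def reducedNodes (p : ℕ) [Fact p.Prime] (a : Fin 6 → ℤ) (K : Type) [Field K]
    [Algebra K (AlgebraicClosure (ZMod p))] : Set (ℙ K (Fin 5 → K)) :=
  {b | IsReductionOfNode p a fun i => algebraMap K (AlgebraicClosure (ZMod p)) (b.rep i)}

/-- The `K`-points of the reduction modulo `p` of the big resolution of `X̄_a`, for homogeneous
integral coordinates `a` that are not all divisible by `p`. -/
abbrev ReducedBigResolution (p : ℕ) [Fact p.Prime] (a : Fin 6 → ℤ) (K : Type) [Field K]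
    [Algebra K (AlgebraicClosure (ZMod p))] : Type :=
  BigResolution K (fun i => (a i : K)) (reducedNodes p a K)

/-- The big resolution of `X̄_a` has smooth reduction modulo `p`: the reduction of `X_a` is
irreducible, i.e. has nonzero parameters (otherwise it is not a member of the family), the nodes in
the torus reduce to nodes, and blowing up the ten surfaces and these nodes gives a variety that is
nonsingular at every point over an algebraic closure of `𝔽_p`. -/
def HasSmoothReduction (p : ℕ) [Fact p.Prime] (a : Fin 6 → ℤ) : Prop :=
  (∀ i, (a i : ZMod p) ≠ 0) ∧
  (∀ b ∈ reducedNodes p a (AlgebraicClosure (ZMod p)),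
    IsNodeAt (localEq (fun i => (a i : AlgebraicClosure (ZMod p))) 1) (chartCoords 1 b.rep)) ∧
  ∀ P : ChartPoint (AlgebraicClosure (ZMod p)) (fun i => (a i : AlgebraicClosure (ZMod p)))
      (reducedNodes p a (AlgebraicClosure (ZMod p))),
    IsNonsingularAt P

/-! ### The ingredients of the formula -/

/-- The map `(b₁, …, b₅) ↦ (b₁², …, b₅², (b₁ + ⋯ + b₅)²)`. -/
def phiVec {K : Type*} [Field K] (b : Fin 5 → K) : Fin 6 → K :=
  Fin.snoc (fun i => b i ^ 2) ((∑ i, b i) ^ 2)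

/-- The points `b` of the torus in `ℙ⁴` with `φ(b) = a` in `ℙ⁵`. -/
def phiFibre {K : Type*} [Field K] (a : Fin 6 → K) : Set (ℙ K (Fin 5 → K)) :=
  {b | (∀ i, b.rep i ≠ 0) ∧ ∃ c : K, c ≠ 0 ∧ ∀ i, phiVec b.rep i = c * a i}

/-- The plane cubic `(x + y + z)(a x y + b y z + c z x) = t x y z`. -/
def ellipticCurve {K : Type*} [Field K] (a b c t : K) : Set (ℙ K (Fin 3 → K)) :=
  {P | (P.rep 0 + P.rep 1 + P.rep 2)
      * (a * (P.rep 0 * P.rep 1) + b * (P.rep 1 * P.rep 2) + c * (P.rep 2 * P.rep 0))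
        = t * (P.rep 0 * P.rep 1 * P.rep 2)}

/-- The quantity whose Legendre symbol is summed over `x, y, z ∈ 𝔽_pˣ`. -/
def discr {K : Type*} [Field K] (a : Fin 6 → K) (x y z : K) : K :=
  ((1 + x + y + z) * (a 1 / x + a 2 / y + a 3 / z + a 4) - a 0 - a 5) ^ 2 - 4 * a 0 * a 5

end A4

end

/-!
The points of the resolution are counted in the fibres over `X_a`, whose points are sorted by torus
orbits: each one is considered in the unique chart in which it is in normal form. Outside the torus,
the numbers of points depend only on the shape of the equation of `X_a` on the orbit, and each of the
30 nodes there is replaced by a projective line. In the torus, with `t = X₁ / X₅`, the equation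
`(A + t) (a₁ / t + B) = a₆` is quadratic in `t` with discriminant `D = (A B - a₁ - a₆)² - 4 a₁ a₆`.
It has `χ(D) + 1` solutions `t ≠ 0`, less one for each of `A` and `B` that is zero. If `a₁ = a₆` and
`A = B = 0`, then `q` must be added, since every `t ≠ 0` is a solution; in the coordinates
`X₂ / X₅, X₃ / X₅, X₄ / X₅`, the curve `A = B = 0` is an open part of the plane cubic.

By the logarithmic derivatives of the equation, the singular points in the torus form the fibre of
`φ` over `a`. Blowing up such a point `b` replaces it by a quadric surface of discriminant
`b₁ ⋯ b₅ (b₁ + ⋯ + b₅)` up to squares, which adds `q (q + 1 + χ(b₁ ⋯ b₅ (b₁ + ⋯ + b₅)))` points.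
Since the resolution is nonsingular, all singular points are blown up, i.e. are reductions of
singular points in characteristic zero.
-/

namespace A4

open MvPolynomial

/-! ### Points of blow-ups -/

section BlowUp

lemma dvd_of_pow_mul_eq_pow_mul {D : Type*} [CommRing D] [IsDomain D] {t E x y : D}
    (ht : Prime t) (hE : ¬ t ∣ E) {d e : ℕ} (h : t ^ d * x = t ^ e * (E * y)) : E ∣ x := by
  rcases le_total d e with hde | hde
  · obtain ⟨k, rfl⟩ := Nat.exists_eq_add_of_le hde
    rw [pow_add, mul_assoc] at h
    rw [mul_left_cancel₀ (pow_ne_zero d ht.ne_zero) h]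
    exact dvd_mul_of_dvd_right (dvd_mul_right E y) _
  · obtain ⟨k, rfl⟩ := Nat.exists_eq_add_of_le hde
    rw [pow_add, mul_assoc] at h
    have hx : t ^ k * x = E * y := mul_left_cancel₀ (pow_ne_zero e ht.ne_zero) h
    obtain ⟨z, rfl⟩ := ht.pow_dvd_of_dvd_mul_left k hE (Dvd.intro _ hx)
    rw [mul_left_comm] at hx
    exact ⟨z, mul_left_cancel₀ (pow_ne_zero k ht.ne_zero) hx⟩

lemma eval₂_mul_of_isHomogeneous {ι R S : Type*} [CommSemiring R] [CommSemiring S]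
    {G : MvPolynomial ι R} {d : ℕ} (hG : G.IsHomogeneous d) (φ : R →+* S) (u : S) (s : ι → S) :
    eval₂ φ (fun i => u * s i) G = u ^ d * eval₂ φ s G := by
  rw [eval₂_eq, eval₂_eq, Finset.mul_sum]
  refine Finset.sum_congr rfl fun m hm => ?_
  have hd : ∑ i ∈ m.support, m i = d := by
    simpa [Finsupp.weight_apply, Finsupp.sum] using hG (mem_support_iff.mp hm)
  simp only [mul_pow, Finset.prod_mul_distrib]
  rw [Finset.prod_pow_eq_pow_sum, hd, mul_left_comm]

lemma map_eval_eq_eval₂ {ι R S : Type*} [CommSemiring R] [CommSemiring S] (φ : R →+* S)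
    (f : ι → R) (G : MvPolynomial ι R) : φ (eval f G) = eval₂ φ (fun i => φ (f i)) G :=
  eval₂_comp_left φ (RingHom.id R) f G

variable {K : Type*} [Field K] {n : ℕ} {ι : Type*}
  {F : MvPolynomial (Fin n) K} {f : ι → MvPolynomial (Fin n) K}
  {L : Type*} [CommRing L] [Algebra K L] {P : Fin n → L} {s : ι → L}

-- Pulled back along `Ψ`, a degree `d` relation `G(f) ∈ (F)` reads `t ^ d * G(g) ∈ (t ^ e * E)`,
-- so `G(g)` is divisible by the equation `E` of the strict transform.
lemma isBlowUpPoint_of_lift {D : Type*} [CommRing D] [IsDomain D]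
    (Ψ : MvPolynomial (Fin n) K →+* D) (ρ : D →+* L) (hρ : ∀ q, ρ (Ψ q) = aeval P q)
    {t E : D} {e : ℕ} {g : ι → D} (ht : Prime t) (hf : ∀ i, Ψ (f i) = t * g i)
    (hF : Ψ F = t ^ e * E) (hE : ¬ t ∣ E) (hE0 : ρ E = 0) (hu : ∃ i, IsUnit (ρ (g i))) :
    IsBlowUpPoint F f P fun i => ρ (g i) := by
  refine ⟨hu, fun d G hG hGF => ?_⟩
  obtain ⟨H, hH⟩ := Ideal.mem_span_singleton.mp hGF
  have hpull : t ^ d * eval₂ Ψ g G = t ^ e * (E * Ψ H) := by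
    rw [← eval₂_mul_of_isHomogeneous hG, ← funext hf, ← map_eval_eq_eval₂, hH, map_mul, hF,
      mul_assoc]
  obtain ⟨q, hq⟩ := dvd_of_pow_mul_eq_pow_mul ht hE hpull
  have hcomp : (aeval P : MvPolynomial (Fin n) K →ₐ[K] L).toRingHom = ρ.comp Ψ :=
    RingHom.ext fun q => (hρ q).symm
  rw [hcomp]
  exact (eval₂_comp_left ρ Ψ g G).symm.trans (by rw [hq, map_mul, hE0, zero_mul])

lemma isBlowUpPoint_of_chart {σ : Type*} {P : Fin n → K} {Φ : Fin n → MvPolynomial σ K}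
    {w : σ → K} (hw : ∀ k, eval w (Φ k) = P k) {t E : MvPolynomial σ K} {e : ℕ}
    {g : ι → MvPolynomial σ K} (ht : Prime t) (hf : ∀ i, aeval Φ (f i) = t * g i)
    (hF : aeval Φ F = t ^ e * E) (hE : ¬ t ∣ E) (hE0 : eval w E = 0)
    (hu : ∃ i, eval w (g i) ≠ 0) : IsBlowUpPoint F f P fun i => eval w (g i) := by
  refine isBlowUpPoint_of_lift (aeval Φ : _ →ₐ[K] MvPolynomial σ K).toRingHom (eval w)
    (fun q => ?_) ht hf hF hE hE0 (hu.imp fun i hi => hi.isUnit)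
  have hcomp : (aeval w).comp (aeval Φ) = (aeval P : MvPolynomial (Fin n) K →ₐ[K] K) :=
    algHom_ext fun k => by simpa using hw k
  exact DFunLike.congr_fun hcomp q

lemma isBlowUpPoint_of_eq_mul (hF : aeval P F = 0) (u : L)
    (hs : ∀ i, s i = u * aeval P (f i)) (hu : ∃ i, IsUnit (s i)) : IsBlowUpPoint F f P s := by
  refine ⟨hu, fun d G hG hGF => ?_⟩
  obtain ⟨H, hH⟩ := Ideal.mem_span_singleton.mp hGF
  have hG0 := map_eval_eq_eval₂ (aeval P : MvPolynomial (Fin n) K →ₐ[K] L).toRingHom f G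
  rw [hH, map_mul, show (aeval P).toRingHom F = 0 from hF, zero_mul] at hG0
  rw [funext hs, eval₂_mul_of_isHomogeneous hG]
  exact (congrArg (u ^ d * ·) hG0.symm).trans (mul_zero _)

lemma IsBlowUpPoint.mul_left (h : IsBlowUpPoint F f P s) {u : L} (hu : IsUnit u) :
    IsBlowUpPoint F f P (fun i => u * s i) := by
  refine ⟨h.1.imp fun i hi => hu.mul hi, fun d G hG hGF => ?_⟩
  rw [eval₂_mul_of_isHomogeneous hG, h.2 d G hG hGF, mul_zero]

lemma IsBlowUpPoint.sum_mul_pow_eq_zero {κ : Type*} [Fintype κ] (h : IsBlowUpPoint F f P s)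
    (d : ℕ) (e : κ → ι) {c : κ → MvPolynomial (Fin n) K}
    (hc : ∑ k, c k * f (e k) ^ d ∈ Ideal.span {F}) : ∑ k, aeval P (c k) * s (e k) ^ d = 0 := by
  have hhom : (∑ k, C (c k) * X (e k) ^ d :
      MvPolynomial ι (MvPolynomial (Fin n) K)).IsHomogeneous d :=
    IsHomogeneous.sum _ _ _ fun k _ => by
      simpa using (isHomogeneous_C ι (c k)).mul ((isHomogeneous_X _ (e k)).pow d)
  simpa [eval₂_sum] using h.2 d _ hhom (by simpa using hc)

lemma IsBlowUpPoint.mul_comm_eq (h : IsBlowUpPoint F f P s) (i j : ι) :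
    aeval P (f i) * s j = aeval P (f j) * s i := by
  have hrel := h.sum_mul_pow_eq_zero 1 ![j, i] (c := ![f i, -f j])
    (by simp [Fin.sum_univ_two, mul_comm])
  simp only [Fin.sum_univ_two, Matrix.cons_val_zero, Matrix.cons_val_one, map_neg, pow_one] at hrel
  linear_combination hrel

end BlowUp

/-! ### The equation of the threefold and the blow-up of the surface in a chart -/

section Surface

/-- The linear form `X₁ + ⋯ + X₅`, divided by the last homogeneous coordinate `X_{ς 4}` of the
chart, as a function of the chart coordinates. -/
def coordSum {L : Type*} [CommRing L] (v : Fin 4 → L) : L :=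
  1 + v 3 + v 3 * v 2 + v 3 * v 2 * v 1 + v 3 * v 2 * v 1 * v 0

/-- The polynomial `N` in the form `(c₀ + c₁ x) * coordSum + y * N` of the equation of the
threefold, which exhibits the surface `c₀ + c₁ x = y = 0` inside it. -/
def cofactor {L : Type*} [CommRing L] (c : Fin 6 → L) (v : Fin 4 → L) : L :=
  v 0 * ((c 2 + c 3 * v 2 + c 4 * (v 2 * v 3)) * coordSum v - c 5 * (v 2 * v 3))

/-- The parameters of the threefold in the order in which they enter its equation in the chart
`ς`: the first five are permuted by `ς` and the last one stays in place. -/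
def chartParam {K : Type*} (a : Fin 6 → K) (ς : Equiv.Perm (Fin 5)) : Fin 6 → K :=
  Fin.snoc (fun k => a (ς k).castSucc) (a 5)

lemma chartParam_castSucc {K : Type*} (a : Fin 6 → K) (ς : Equiv.Perm (Fin 5)) (k : Fin 5) :
    chartParam a ς k.castSucc = a (ς k).castSucc := by
  simp [chartParam]

lemma chartParam_five {K : Type*} (a : Fin 6 → K) (ς : Equiv.Perm (Fin 5)) :
    chartParam a ς 5 = a 5 :=
  Fin.snoc_last (α := fun _ => K) _ _

lemma chartParam_ne_zero {K : Type*} [Zero K] {a : Fin 6 → K} (ha : ∀ i, a i ≠ 0)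
    (ς : Equiv.Perm (Fin 5)) (k : Fin 6) : chartParam a ς k ≠ 0 := by
  refine Fin.lastCases ?_ (fun k => ?_) k
  · simpa only [Fin.reduceLast, chartParam_five] using ha 5
  · simpa only [chartParam_castSucc] using ha _

/-- The left-hand side of the equation of the threefold in a chart, as a function of the parameters
permuted by `chartParam` and of the chart coordinates.  In contrast to `localEq`, the values may lie
in any ring. -/
def eqVal {L : Type*} [CommRing L] (c : Fin 6 → L) (v : Fin 4 → L) : L :=
  (c 0 + c 1 * v 0 + c 2 * (v 0 * v 1) + c 3 * (v 0 * v 1 * v 2) + c 4 * (v 0 * v 1 * v 2 * v 3))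
      * coordSum v - c 5 * (v 0 * v 1 * v 2 * v 3)

lemma eqVal_eq_add_mul_cofactor {L : Type*} [CommRing L] (c : Fin 6 → L) (v : Fin 4 → L) :
    eqVal c v = (c 0 + c 1 * v 0) * coordSum v + v 1 * cofactor c v := by
  simp only [eqVal, cofactor]; ring

lemma map_coordSum {L M : Type*} [CommRing L] [CommRing M] (φ : L →+* M) (v : Fin 4 → L) :
    φ (coordSum v) = coordSum fun k => φ (v k) := by
  simp [coordSum]

lemma map_cofactor {L M : Type*} [CommRing L] [CommRing M] (φ : L →+* M) (c : Fin 6 → L)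
    (v : Fin 4 → L) : φ (cofactor c v) = cofactor (fun i => φ (c i)) fun k => φ (v k) := by
  simp [cofactor, map_coordSum]

variable {K : Type*} [Field K] {a : Fin 6 → K} {ς : Equiv.Perm (Fin 5)} {v : Fin 4 → K}

lemma map_localEq {L : Type*} [CommRing L] (φ : MvPolynomial (Fin 4) K →+* L) (a : Fin 6 → K)
    (ς : Equiv.Perm (Fin 5)) :
    φ (localEq a ς) = eqVal (fun i => φ (C (chartParam a ς i))) (fun k => φ (X k)) := by
  have h (k : Fin 5) := chartParam_castSucc a ς k
  have h0 := h 0; have h1 := h 1; have h2 := h 2; have h3 := h 3; have h4 := h 4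
  simp only [Fin.castSucc_zero, Fin.reduceCastSucc] at h0 h1 h2 h3 h4
  simp only [localEq, eqVal, coordSum, chartParam_five, h0, h1, h2, h3, h4, map_sub, map_mul,
    map_add, map_one]

lemma aeval_localEq {L : Type*} [CommRing L] [Algebra K L] (v : Fin 4 → L) (a : Fin 6 → K)
    (ς : Equiv.Perm (Fin 5)) :
    aeval v (localEq a ς) = eqVal (fun i => algebraMap K L (chartParam a ς i)) v := by
  simpa using map_localEq (aeval v : MvPolynomial (Fin 4) K →ₐ[K] L).toRingHom a ς

lemma eval_localEq (v : Fin 4 → K) (a : Fin 6 → K) (ς : Equiv.Perm (Fin 5)) :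
    eval v (localEq a ς) = eqVal (chartParam a ς) v := by
  simpa using map_localEq (eval v) a ς

lemma surfaceGens_eq (a : Fin 6 → K) (ς : Equiv.Perm (Fin 5)) :
    surfaceGens a ς = ![C (chartParam a ς 0) + C (chartParam a ς 1) * X 0, X 1] := by
  have h0 := chartParam_castSucc a ς 0
  have h1 := chartParam_castSucc a ς 1
  simp only [Fin.castSucc_zero, Fin.reduceCastSucc] at h0 h1
  rw [h0, h1]; rfl

/-- Explicit equations for a point of the blow-up of the threefold with permuted parameters `c`
along the surface `c₀ + c₁ x = y = 0`: the point over the chart point `v` with homogeneous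
coordinates `d`, which is proportional to `(c₀ + c₁ x : y)` and on the strict transform. -/
def IsDir (c : Fin 6 → K) (v : Fin 4 → K) (d : Fin 2 → K) : Prop :=
  d ≠ 0 ∧ d 0 * v 1 = d 1 * (c 0 + c 1 * v 0) ∧ d 0 * coordSum v + d 1 * cofactor c v = 0

lemma IsBlowUpPoint.isDir {d : Fin 2 → K}
    (h : IsBlowUpPoint (localEq a ς) (surfaceGens a ς) v d) : IsDir (chartParam a ς) v d := by
  refine ⟨?_, ?_, ?_⟩
  · rintro rfl
    obtain ⟨i, hi⟩ := h.1
    exact hi.ne_zero rfl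
  · have hprop := h.mul_comm_eq 0 1
    simp only [surfaceGens_eq, Matrix.cons_val_zero, Matrix.cons_val_one, map_add, map_mul,
      algHom_C, Algebra.algebraMap_self_apply, aeval_X] at hprop
    linear_combination -hprop
  · have hrel := h.sum_mul_pow_eq_zero 1 id
      (c := ![coordSum X, cofactor (fun i => C (chartParam a ς i)) X]) (by
        have hF : localEq a ς = eqVal (fun i => C (chartParam a ς i)) X :=
          map_localEq (RingHom.id _) a ς
        rw [hF, eqVal_eq_add_mul_cofactor, surfaceGens_eq]
        exact Ideal.subset_span (by simp [Fin.sum_univ_two, mul_comm]))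
    have hS : aeval v (coordSum (X : Fin 4 → MvPolynomial (Fin 4) K)) = coordSum v := by
      simpa using map_coordSum (eval v) X
    have hN : aeval v (cofactor (fun i => C (chartParam a ς i)) X)
        = cofactor (chartParam a ς) v := by
      simpa using map_cofactor (eval v) (fun i => C (chartParam a ς i)) X
    simp only [id_eq, pow_one, Fin.sum_univ_two, Matrix.cons_val_zero, Matrix.cons_val_one, hS,
      hN] at hrel
    linear_combination hrel

/-- The substitution `c₀ + c₁ x = A`, `y = B` with the last two coordinates unchanged.  With
`{A, B} = {t, t u}` it describes the two standard charts of the blow-up of `c₀ + c₁ x = y = 0`. -/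
noncomputable def surfaceChart (c : Fin 6 → K) (A B : MvPolynomial (Fin 4) K) :
    Fin 4 → MvPolynomial (Fin 4) K :=
  ![C (c 1)⁻¹ * (A - C (c 0)), B, X 2, X 3]

lemma surfaceChart_zero {c : Fin 6 → K} (hc : c 1 ≠ 0) (A B : MvPolynomial (Fin 4) K) :
    C (c 0) + C (c 1) * surfaceChart c A B 0 = A := by
  rw [surfaceChart, Matrix.cons_val_zero, ← mul_assoc, ← C_mul, mul_inv_cancel₀ hc, C_1]; ring

lemma eval_surfaceChart {c : Fin 6 → K} (hc : c 1 ≠ 0) {A B : MvPolynomial (Fin 4) K}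
    {w : Fin 4 → K} (hA : eval w A = c 0 + c 1 * v 0) (hB : eval w B = v 1) (h2 : w 2 = v 2)
    (h3 : w 3 = v 3) (k : Fin 4) : eval w (surfaceChart c A B k) = v k := by
  fin_cases k <;> simp [surfaceChart, hA, hB, h2, h3, hc]

lemma isBlowUpPoint_surface_of_chart {c : Fin 6 → K} (hcs : chartParam a ς = c) (hc : c 1 ≠ 0)
    {t : MvPolynomial (Fin 4) K} {g : Fin 2 → MvPolynomial (Fin 4) K} {w : Fin 4 → K}
    (ht : Prime t) (hA : eval w (t * g 0) = c 0 + c 1 * v 0) (hB : eval w (t * g 1) = v 1)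
    (h2 : w 2 = v 2) (h3 : w 3 = v 3)
    (hE : ¬ t ∣ g 0 * coordSum (surfaceChart c (t * g 0) (t * g 1)) +
      g 1 * cofactor (fun i => C (c i)) (surfaceChart c (t * g 0) (t * g 1)))
    (hd : IsDir c v fun i => eval w (g i)) :
    IsBlowUpPoint (localEq a ς) (surfaceGens a ς) v fun i => eval w (g i) := by
  have hzero := surfaceChart_zero hc (t * g 0) (t * g 1)
  have hw := eval_surfaceChart hc hA hB h2 h3
  refine isBlowUpPoint_of_chart (e := 1) hw ht (fun i => ?_) ?_ hE ?_ (Function.ne_iff.mp hd.1)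
  · rw [surfaceGens_eq, hcs]
    fin_cases i
    · simpa using hzero
    · simp [surfaceChart]
  · rw [aeval_localEq, eqVal_eq_add_mul_cofactor, hcs]
    simp only [algebraMap_eq, hzero]
    simp only [surfaceChart, Matrix.cons_val_one, Matrix.cons_val_zero, pow_one]
    ring
  · rw [map_add, map_mul, map_mul, map_coordSum, map_cofactor]
    simpa only [hw, eval_C] using hd.2.2

lemma isBlowUpPoint_surface_of_isDir {d : Fin 2 → K} (hc : chartParam a ς 1 ≠ 0)
    (h : IsDir (chartParam a ς) v d) : IsBlowUpPoint (localEq a ς) (surfaceGens a ς) v d := by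
  generalize hcs : chartParam a ς = c at *
  obtain ⟨hd, hprop, hstrict⟩ := h
  by_cases hd1 : d 1 = 0
  · have hd0 : d 0 ≠ 0 := fun h0 => hd (by ext i; fin_cases i <;> simp [h0, hd1])
    have hv1 : v 1 = 0 := by simpa [hd0, hd1] using hprop
    have hS : coordSum v = 0 := by simpa [hd0, hd1] using hstrict
    have hpt := isBlowUpPoint_surface_of_chart (v := v) hcs hc (t := X 0) (g := ![1, X 1])
      (w := ![c 0 + c 1 * v 0, 0, v 2, v 3]) X_prime (by simp) (by simp [hv1]) rfl rfl
      (fun h => by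
        simpa [coordSum, cofactor, surfaceChart] using map_dvd (eval (0 : Fin 4 → K)) h)
      ⟨fun h => by simpa using congrFun h 0, by simp [hv1], by simp [hS]⟩
    convert hpt.mul_left hd0.isUnit using 1
    ext i; fin_cases i <;> simp [hd1]
  · have hA : d 0 / d 1 * v 1 = c 0 + c 1 * v 0 := by field_simp; exact hprop
    have hN : d 0 / d 1 * coordSum v + cofactor c v = 0 := by
      field_simp; linear_combination hstrict
    have hpt := isBlowUpPoint_surface_of_chart (v := v) hcs hc (t := X 1) (g := ![X 0, 1])
      (w := ![d 0 / d 1, v 1, v 2, v 3]) X_prime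
      (by simpa [mul_comm] using hA) (by simp) rfl rfl
      (fun h => by
        simpa [coordSum, cofactor, surfaceChart] using
          map_dvd (eval (![1 + (c 1)⁻¹ * c 0 * c 2, 0, 0, 0] : Fin 4 → K)) h)
      ⟨fun h => by simpa using congrFun h 1, by simpa using hA, by simpa using hN⟩
    convert hpt.mul_left (Ne.isUnit hd1) using 1
    ext i; fin_cases i <;> simp; field_simp

end Surface

/-! ### Points of the toric variety -/

section Toric

/-- The product of the coordinates `v m` with `k ≤ m < l`, and `1` if `l ≤ k`.  For the coordinates
of a point in the chart `ς` and `k ≤ l` this is `X_{ς k} / X_{ς l}`. -/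
def segProd {M : Type*} [CommMonoid M] {n : ℕ} (v : Fin n → M) (k l : Fin (n + 1)) : M :=
  if k < l then
    ∏ m ∈ Finset.univ.filter (fun m : Fin n => k ≤ m.castSucc ∧ m.castSucc < l), v m
  else 1

section SegProd

variable {M : Type*} [CommMonoid M] {n : ℕ} (v : Fin n → M)

lemma segProd_of_le {k l : Fin (n + 1)} (h : l ≤ k) : segProd v k l = 1 :=
  if_neg h.not_gt

lemma segProd_castSucc_succ (m : Fin n) : segProd v m.castSucc m.succ = v m := by
  rw [segProd, if_pos (Fin.castSucc_lt_succ)]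
  convert Finset.prod_singleton v m
  ext n
  simp only [Finset.mem_filter, Finset.mem_univ, true_and, Finset.mem_singleton, Fin.ext_iff,
    Fin.le_def, Fin.lt_def, Fin.val_castSucc, Fin.val_succ]
  omega

lemma segProd_mul {k l m : Fin (n + 1)} (h1 : k ≤ l) (h2 : l ≤ m) :
    segProd v k l * segProd v l m = segProd v k m := by
  rcases h1.eq_or_lt with rfl | h1
  · simp [segProd_of_le]
  rcases h2.eq_or_lt with rfl | h2
  · simp [segProd_of_le]
  rw [segProd, segProd, segProd, if_pos h1, if_pos h2, if_pos (h1.trans h2),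
    ← Finset.prod_union]
  · congr 1
    ext n
    simp only [Finset.mem_union, Finset.mem_filter, Finset.mem_univ, true_and]
    constructor
    · rintro (⟨h, h'⟩ | ⟨h, h'⟩)
      · exact ⟨h, h'.trans h2⟩
      · exact ⟨h1.le.trans h, h'⟩
    · rintro ⟨h, h'⟩
      rcases lt_or_ge n.castSucc l with hl | hl
      · exact Or.inl ⟨h, hl⟩
      · exact Or.inr ⟨hl, h'⟩
  · rw [Finset.disjoint_filter]
    rintro n - ⟨-, h⟩ ⟨h', -⟩
    exact absurd h h'.not_gt

lemma segProd_cocycle (k l m : Fin (n + 1)) :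
    segProd v k l * segProd v l m * segProd v m k
      = segProd v l k * segProd v m l * segProd v k m := by
  have sorted {k l m : Fin (n + 1)} (h1 : k ≤ l) (h2 : l ≤ m) :
      segProd v k l * segProd v l m * segProd v m k
        = segProd v l k * segProd v m l * segProd v k m := by
    rw [segProd_mul v h1 h2, segProd_of_le v h1, segProd_of_le v h2,
      segProd_of_le v (h1.trans h2), one_mul, one_mul, mul_one]
  rcases le_total k l with h1 | h1 <;> rcases le_total l m with h2 | h2 <;>
    rcases le_total k m with h3 | h3
  · exact sorted h1 h2
  · exact sorted h1 h2
  · simpa only [mul_comm, mul_left_comm, mul_assoc] using (sorted h3 h2).symm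
  · simpa only [mul_comm, mul_left_comm, mul_assoc] using sorted h3 h1
  · simpa only [mul_comm, mul_left_comm, mul_assoc] using (sorted h1 h3).symm
  · simpa only [mul_comm, mul_left_comm, mul_assoc] using sorted h2 h3
  · simpa only [mul_comm, mul_left_comm, mul_assoc] using (sorted h2 h1).symm
  · simpa only [mul_comm, mul_left_comm, mul_assoc] using (sorted h2 h1).symm

lemma segProd_of_mul {g : Fin (n + 1) → Fin (n + 1) → M} (hself : ∀ k, g k k = 1)
    (hmul : ∀ k l m, k ≤ l → l ≤ m → g k l * g l m = g k m) {k l : Fin (n + 1)} (hkl : k ≤ l) :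
    segProd (fun m : Fin n => g m.castSucc m.succ) k l = g k l := by
  induction l using Fin.induction with
  | zero =>
    obtain rfl : k = 0 := Fin.le_zero_iff.mp hkl
    rw [segProd_of_le _ le_rfl, hself]
  | succ l ih =>
    rcases hkl.eq_or_lt with rfl | hlt
    · rw [segProd_of_le _ le_rfl, hself]
    · have hk : k ≤ l.castSucc := Fin.le_castSucc_iff.mpr hlt
      have hl : l.castSucc ≤ l.succ := Fin.castSucc_lt_succ.le
      rw [← segProd_mul _ hk hl, ih hk, segProd_castSucc_succ, hmul _ _ _ hk hl]

end SegProd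

variable {K : Type*} [Field K]

lemma ratioPart_eq (ς : Equiv.Perm (Fin 5)) (v : Fin 4 → K) (i j : Fin 5) :
    ratioPart ς v i j = segProd v (ς.symm i) (ς.symm j) := rfl

lemma ratioPart_apply (ς : Equiv.Perm (Fin 5)) (v : Fin 4 → K) (k l : Fin 5) :
    ratioPart ς v (ς k) (ς l) = segProd v k l := by
  simp [ratioPart_eq]

variable (ς : Equiv.Perm (Fin 5)) (v : Fin 4 → K)

lemma ratioPart_cocycle (i j k : Fin 5) :
    ratioPart ς v i j * ratioPart ς v j k * ratioPart ς v k i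
      = ratioPart ς v j i * ratioPart ς v k j * ratioPart ς v i k :=
  segProd_cocycle v _ _ _

lemma ratioPart_of_le {i j : Fin 5} (h : ς.symm j ≤ ς.symm i) : ratioPart ς v i j = 1 :=
  segProd_of_le v h

lemma ratioPart_self (i : Fin 5) : ratioPart ς v i i = 1 := ratioPart_of_le ς v le_rfl

lemma ratioPart_zero (i : Fin 5) : ratioPart ς v i (ς 0) = 1 := ratioPart_of_le ς v (by simp)

lemma ratioPart_four (i : Fin 5) : ratioPart ς v (ς 4) i = 1 :=
  ratioPart_of_le ς v (by rw [Equiv.symm_apply_apply]; exact Fin.le_last _)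

lemma ratioPart_eq_one_or (i j : Fin 5) : ratioPart ς v i j = 1 ∨ ratioPart ς v j i = 1 :=
  (le_total (ς.symm j) (ς.symm i)).imp (ratioPart_of_le ς v) (ratioPart_of_le ς v)

open Classical in
/-- The number of vanishing chart coordinates before the position of the index `i`.  The levels sort
the homogeneous coordinates by their order of vanishing at the point: `X_i / X_j` vanishes there if
and only if `i` has a smaller level than `j`. -/
noncomputable def level (i : Fin 5) : ℕ :=
  (Finset.univ.filter fun m : Fin 4 => m.castSucc < ς.symm i ∧ v m = 0).card

lemma level_mono {i j : Fin 5} (h : ς.symm i ≤ ς.symm j) : level ς v i ≤ level ς v j := by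
  classical
  exact Finset.card_le_card (Finset.monotone_filter_right _
    fun m _ hm => ⟨hm.1.trans_le h, hm.2⟩)

lemma ratioPart_eq_zero_iff (i j : Fin 5) :
    ratioPart ς v i j = 0 ↔ level ς v i < level ς v j := by
  classical
  constructor
  · intro h
    rw [ratioPart] at h
    split_ifs at h with hlt
    · obtain ⟨m, hm, hm0⟩ := Finset.prod_eq_zero_iff.mp h
      simp only [Finset.mem_filter, Finset.mem_univ, true_and] at hm
      refine Finset.card_lt_card (Finset.ssubset_iff_of_subset
        (Finset.monotone_filter_right _ fun m _ hm => ⟨hm.1.trans hlt, hm.2⟩) |>.mpr ⟨m, ?_, ?_⟩)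
      · simp [hm.2, hm0]
      · simp [hm.1]
    · exact absurd h one_ne_zero
  · intro h
    have hlt : ς.symm i < ς.symm j := by
      by_contra hc
      exact absurd h (level_mono ς v (not_lt.mp hc)).not_gt
    rw [ratioPart, if_pos hlt, Finset.prod_eq_zero_iff]
    by_contra hc
    refine h.ne (congrArg Finset.card ?_)
    ext m
    simp only [Finset.mem_filter, Finset.mem_univ, true_and]
    refine ⟨fun hm => ⟨hm.1.trans hlt, hm.2⟩, fun hm => ⟨?_, hm.2⟩⟩
    by_contra hm'
    exact hc ⟨m, by simpa using ⟨not_lt.mp hm', hm.1⟩, hm.2⟩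

/-- The point `v` of the chart `ς` and the point `v'` of the chart `ς'` are the same point of the
toric variety: all rational functions `X_i / X_j` have the same value in `ℙ¹` at both. -/
def SamePoint (ς : Equiv.Perm (Fin 5)) (v : Fin 4 → K) (ς' : Equiv.Perm (Fin 5))
    (v' : Fin 4 → K) : Prop :=
  ∀ i j, ratioPart ς v i j * ratioPart ς' v' j i = ratioPart ς' v' i j * ratioPart ς v j i

/-- The chart `ς` is the preferred one for its point `v`: indices of the same level are in
increasing order.  Every point of the toric variety has exactly one representative of this kind. -/
def Normal : Prop :=
  ∀ k l : Fin 5, k < l → level ς v (ς k) = level ς v (ς l) → ς k < ς l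

variable {ς v} {ς' ς'' : Equiv.Perm (Fin 5)} {v' v'' : Fin 4 → K}

namespace SamePoint

lemma symm (h : SamePoint ς v ς' v') : SamePoint ς' v' ς v := fun i j => (h i j).symm

lemma eq_zero_imp (h : SamePoint ς v ς' v') {i j : Fin 5} (h0 : ratioPart ς v i j = 0) :
    ratioPart ς' v' i j = 0 := by
  have h1 := h i j
  rw [h0, zero_mul] at h1
  rcases ratioPart_eq_one_or ς v i j with h2 | h2
  · exact absurd (h0.symm.trans h2) zero_ne_one
  · simpa [h2] using h1.symm

lemma eq_zero_iff (h : SamePoint ς v ς' v') {i j : Fin 5} :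
    ratioPart ς v i j = 0 ↔ ratioPart ς' v' i j = 0 :=
  ⟨h.eq_zero_imp, h.symm.eq_zero_imp⟩

lemma trans (h : SamePoint ς v ς' v') (h' : SamePoint ς' v' ς'' v'') :
    SamePoint ς v ς'' v'' := by
  intro i j
  have h1 := h i j
  have h2 := h' i j
  rcases ratioPart_eq_one_or ς' v' i j with h3 | h3 <;> rw [h3] at h1 h2
  · by_cases h4 : ratioPart ς' v' j i = 0
    · have h5 := (h.eq_zero_iff (i := j)).mpr h4
      have h6 := (h'.eq_zero_iff (i := j)).mp h4
      rw [h5, h6]; ring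
    · refine mul_left_cancel₀ h4 ?_
      linear_combination ratioPart ς'' v'' j i * h1 + ratioPart ς v j i * h2
  · by_cases h4 : ratioPart ς' v' i j = 0
    · have h5 := (h.eq_zero_iff (i := i)).mpr h4
      have h6 := (h'.eq_zero_iff (i := i)).mp h4
      rw [h5, h6]; ring
    · refine mul_left_cancel₀ h4 ?_
      linear_combination ratioPart ς' v' i j * ratioPart ς'' v'' j i * h1
        + ratioPart ς' v' i j * ratioPart ς v j i * h2

lemma level_lt_iff (h : SamePoint ς v ς' v') {i j : Fin 5} :
    level ς v i < level ς v j ↔ level ς' v' i < level ς' v' j := by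
  rw [← ratioPart_eq_zero_iff, ← ratioPart_eq_zero_iff, h.eq_zero_iff]

lemma level_eq_iff (h : SamePoint ς v ς' v') {i j : Fin 5} :
    level ς v i = level ς v j ↔ level ς' v' i = level ς' v' j := by
  have h1 := h.level_lt_iff (i := i) (j := j)
  have h2 := h.level_lt_iff (i := j) (j := i)
  omega

lemma normal_iff (h : SamePoint ς v ς' v') : Normal ς' v' ↔ ς' = Tuple.sort (level ς v) := by
  rw [Tuple.eq_sort_iff]
  constructor
  · intro hn
    refine ⟨fun k l hkl => ?_, fun k l hkl hl => hn k l hkl (h.level_eq_iff.mp hl)⟩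
    by_contra hc
    have := h.level_lt_iff.mp (not_le.mp hc)
    exact absurd (level_mono ς' v' (i := ς' k) (j := ς' l) (by simpa using hkl)) this.not_ge
  · exact fun hs k l hkl hl => hs.2 k l hkl (h.level_eq_iff.mpr hl)

lemma eq_of_chart_eq (h : SamePoint ς v ς v') : v = v' := by
  funext m
  have h1 := h (ς m.castSucc) (ς m.succ)
  simp only [ratioPart_apply, segProd_castSucc_succ,
    segProd_of_le _ (Fin.castSucc_lt_succ (i := m)).le, mul_one] at h1
  exact h1

lemma refl (ς : Equiv.Perm (Fin 5)) (v : Fin 4 → K) : SamePoint ς v ς v := fun _ _ => rfl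

lemma chart_eq_of_normal (h : SamePoint ς v ς' v') (hn : Normal ς v) (hn' : Normal ς' v') :
    ς = ς' :=
  ((refl ς v).normal_iff.mp hn).trans (h.normal_iff.mp hn').symm

end SamePoint

lemma samePoint_of_forall_le (h : ∀ k l, k ≤ l →
    ratioPart ς v (ς' k) (ς' l) = segProd v' k l * ratioPart ς v (ς' l) (ς' k)) :
    SamePoint ς v ς' v' := by
  intro i j
  obtain ⟨k, rfl⟩ := ς'.surjective i
  obtain ⟨l, rfl⟩ := ς'.surjective j
  rw [ratioPart_apply ς', ratioPart_apply ς']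
  rcases le_total k l with hkl | hkl
  · rw [h k l hkl, segProd_of_le v' hkl, mul_one]
  · rw [h l k hkl, segProd_of_le v' hkl, one_mul, mul_comm]

lemma exists_samePoint_of_ne_zero
    (hne : ∀ k l, k ≤ l → ratioPart ς v (ς' l) (ς' k) ≠ 0) : ∃ v', SamePoint ς v ς' v' := by
  set g : Fin 5 → Fin 5 → K := fun k l =>
    ratioPart ς v (ς' k) (ς' l) / ratioPart ς v (ς' l) (ς' k)
  refine ⟨fun m => g m.castSucc m.succ, samePoint_of_forall_le fun k l hkl => ?_⟩
  rw [segProd_of_mul (fun k => by simp [g, ratioPart_self]) (fun k l m hkl hlm => ?_) hkl]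
  · exact (div_mul_cancel₀ _ (hne k l hkl)).symm
  · have := hne k l hkl
    have := hne l m hlm
    have := hne k m (hkl.trans hlm)
    simp only [g]
    field_simp
    linear_combination ratioPart_cocycle ς v (ς' k) (ς' l) (ς' m)

lemma exists_normal (ς : Equiv.Perm (Fin 5)) (v : Fin 4 → K) :
    ∃ ς' v', Normal ς' v' ∧ SamePoint ς v ς' v' := by
  have hne (k l : Fin 5) (hkl : k ≤ l) : ratioPart ς v (Tuple.sort (level ς v) l)
      (Tuple.sort (level ς v) k) ≠ 0 := fun h0 =>
    absurd (Tuple.monotone_sort (level ς v) hkl) ((ratioPart_eq_zero_iff ς v _ _).mp h0).not_ge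
  obtain ⟨v', hsame⟩ := exists_samePoint_of_ne_zero hne
  exact ⟨_, v', hsame.normal_iff.mpr rfl, hsame⟩

/-! ### Change of charts -/

lemma SamePoint.ne_zero (h : SamePoint ς v ς' v') {i j : Fin 5}
    (h1 : ratioPart ς v j i = 1) (h2 : ratioPart ς' v' i j = 1) : ratioPart ς v i j ≠ 0 := by
  have := h i j
  rw [h1, h2, mul_one] at this
  exact left_ne_zero_of_mul (this ▸ one_ne_zero)

lemma SamePoint.mul_left (h : SamePoint ς v ς' v') {i k l : Fin 5}
    (h1 : ratioPart ς v i k = 1) (h2 : ratioPart ς v l k = 1) (h3 : ratioPart ς' v' i l = 1) :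
    ratioPart ς v k i = ratioPart ς v k l * ratioPart ς' v' l i := by
  have h4 := ratioPart_cocycle ς v k l i
  have h5 := h l i
  rw [h1, h2] at h4
  rw [h3] at h5
  have h6 : ratioPart ς v i l ≠ 0 := fun h0 => by
    rw [h.eq_zero_iff, h3] at h0
    exact one_ne_zero h0
  refine mul_left_cancel₀ h6 ?_
  linear_combination -h4 + ratioPart ς v k l * h5

lemma SamePoint.mul_right (h : SamePoint ς v ς' v') {i k l : Fin 5}
    (h1 : ratioPart ς v k i = 1) (h2 : ratioPart ς v k l = 1) (h3 : ratioPart ς' v' l i = 1) :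
    ratioPart ς v i k = ratioPart ς v l k * ratioPart ς' v' i l := by
  have h4 := ratioPart_cocycle ς v i l k
  have h5 := h i l
  rw [h1, h2] at h4
  rw [h3] at h5
  have h6 : ratioPart ς v l i ≠ 0 := fun h0 => by
    rw [h.eq_zero_iff, h3] at h0
    exact one_ne_zero h0
  refine mul_left_cancel₀ h6 ?_
  linear_combination -h4 + ratioPart ς v l k * h5

lemma aeval_homCoord {L : Type*} [CommRing L] [Algebra K L] (ς : Equiv.Perm (Fin 5))
    (v : Fin 4 → L) (i : Fin 5) : aeval v (homCoord K ς i)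
      = ∏ m ∈ Finset.univ.filter (fun m : Fin 4 => ς.symm i ≤ m.castSucc), v m := by
  simp [homCoord]

lemma eval_homCoord (ς : Equiv.Perm (Fin 5)) (v : Fin 4 → K) (i : Fin 5) :
    eval v (homCoord K ς i) = ratioPart ς v i (ς 4) := by
  obtain ⟨k, rfl⟩ := ς.surjective i
  rw [ratioPart_apply, homCoord, map_prod]
  simp only [Equiv.symm_apply_apply, eval_X]
  have h4 : k ≤ 4 := Fin.le_last k
  rcases h4.eq_or_lt with rfl | h
  · rw [segProd_of_le _ le_rfl]
    refine Finset.prod_eq_one fun m hm => ?_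
    simp only [Finset.mem_filter, Finset.mem_univ, true_and, Fin.le_def,
      Fin.val_castSucc] at hm
    change 4 ≤ _ at hm
    omega
  · rw [segProd, if_pos h]
    congr 1
    ext m
    simp only [Finset.mem_filter, Finset.mem_univ, true_and, iff_self_and]
    exact fun _ => Fin.castSucc_lt_last m

lemma coordSum_eq_sum (ς : Equiv.Perm (Fin 5)) (v : Fin 4 → K) :
    coordSum v = ∑ i, ratioPart ς v i (ς 4) := by
  rw [← Equiv.sum_comp ς]
  simp [ratioPart_apply, Fin.sum_univ_five, segProd, Finset.prod_filter, Fin.prod_univ_four,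
    coordSum]
  ring

lemma eqVal_chartParam (a : Fin 6 → K) (ς : Equiv.Perm (Fin 5)) (v : Fin 4 → K) :
    eqVal (chartParam a ς) v = (∑ i, a i.castSucc * ratioPart ς v (ς 0) i)
      * (∑ i, ratioPart ς v i (ς 4)) - a 5 * ratioPart ς v (ς 0) (ς 4) := by
  rw [eqVal, coordSum_eq_sum ς v, ← Equiv.sum_comp ς fun i => a i.castSucc * ratioPart ς v (ς 0) i]
  simp [← chartParam_castSucc, ratioPart_apply, Fin.sum_univ_five, segProd, Finset.prod_filter,
    Fin.prod_univ_four, chartParam_five]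

lemma SamePoint.ratioPart_last (h : SamePoint ς v ς' v') (i : Fin 5) :
    ratioPart ς v i (ς 4) = ratioPart ς v (ς' 4) (ς 4) * ratioPart ς' v' i (ς' 4) :=
  h.mul_right (ratioPart_four ς v i) (ratioPart_four ς v _) (ratioPart_four ς' v' i)

lemma SamePoint.ratioPart_first (h : SamePoint ς v ς' v') (i : Fin 5) :
    ratioPart ς v (ς 0) i = ratioPart ς v (ς 0) (ς' 0) * ratioPart ς' v' (ς' 0) i :=
  h.mul_left (ratioPart_zero ς v i) (ratioPart_zero ς v _) (ratioPart_zero ς' v' i)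

lemma SamePoint.last_ne_zero (h : SamePoint ς v ς' v') : ratioPart ς v (ς' 4) (ς 4) ≠ 0 :=
  h.ne_zero (ratioPart_four ς v _) (ratioPart_four ς' v' _)

lemma SamePoint.coordSum_eq (h : SamePoint ς v ς' v') :
    coordSum v = ratioPart ς v (ς' 4) (ς 4) * coordSum v' := by
  rw [coordSum_eq_sum ς, coordSum_eq_sum ς', Finset.mul_sum]
  exact Finset.sum_congr rfl fun i _ => h.ratioPart_last i

lemma ratioPart_last_eq_mul {i j : Fin 5} (hij : ratioPart ς v j i = 1) :
    ratioPart ς v i (ς 4) = ratioPart ς v i j * ratioPart ς v j (ς 4) := by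
  have := ratioPart_cocycle ς v i j (ς 4)
  rw [ratioPart_four, ratioPart_four, hij] at this
  linear_combination -this

lemma SamePoint.eqVal_eq (h : SamePoint ς v ς' v') (a : Fin 6 → K) :
    eqVal (chartParam a ς) v = ratioPart ς v (ς' 4) (ς 4) * ratioPart ς v (ς 0) (ς' 0)
      * eqVal (chartParam a ς') v' := by
  have h1 : ∑ i, a i.castSucc * ratioPart ς v (ς 0) i
      = ratioPart ς v (ς 0) (ς' 0) * ∑ i, a i.castSucc * ratioPart ς' v' (ς' 0) i := by
    rw [Finset.mul_sum]
    exact Finset.sum_congr rfl fun i _ => by rw [h.ratioPart_first]; ring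
  rw [eqVal_chartParam, eqVal_chartParam, h1, ← coordSum_eq_sum, ← coordSum_eq_sum, h.coordSum_eq,
    ratioPart_last_eq_mul (ratioPart_zero ς v (ς' 0)), h.ratioPart_last (ς' 0)]
  ring

end Toric

/-! ### Directions in the blow-up of the surfaces -/

section Dir

variable {K : Type*} [Field K] {c c' : Fin 6 → K} {v v' : Fin 4 → K} {d d' : Fin 2 → K}

lemma IsDir.smul (h : IsDir c v d) {u : K} (hu : u ≠ 0) : IsDir c v (u • d) := by
  refine ⟨smul_ne_zero hu h.1, ?_, ?_⟩ <;> simp only [Pi.smul_apply, smul_eq_mul]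
  · linear_combination u * h.2.1
  · linear_combination u * h.2.2

lemma IsDir.cross_eq (h : IsDir c v d) (h' : IsDir c v d')
    (hne : v 1 ≠ 0 ∨ c 0 + c 1 * v 0 ≠ 0 ∨ coordSum v ≠ 0 ∨ cofactor c v ≠ 0) :
    d 0 * d' 1 = d' 0 * d 1 := by
  obtain ⟨-, hprop, hstrict⟩ := h
  obtain ⟨-, hprop', hstrict'⟩ := h'
  rcases hne with hne | hne | hne | hne <;> refine mul_left_cancel₀ hne ?_
  · linear_combination d' 1 * hprop - d 1 * hprop'
  · linear_combination d' 0 * hprop - d 0 * hprop'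
  · linear_combination d' 1 * hstrict - d 1 * hstrict'
  · linear_combination -d' 0 * hstrict + d 0 * hstrict'

lemma exists_isDir (h : eqVal c v = 0) : ∃ d, IsDir c v d := by
  rw [eqVal_eq_add_mul_cofactor] at h
  by_cases hgens : c 0 + c 1 * v 0 = 0 ∧ v 1 = 0
  · by_cases hstrict : coordSum v = 0 ∧ cofactor c v = 0
    · exact ⟨![1, 0], by simp [funext_iff], by simp [hgens], by simp [hstrict]⟩
    · refine ⟨![cofactor c v, -coordSum v], fun h0 => hstrict ⟨?_, ?_⟩, by simp [hgens], ?_⟩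
      · simpa using congrFun h0 1
      · simpa using congrFun h0 0
      · simp only [Matrix.cons_val_zero, Matrix.cons_val_one]
        ring
  · refine ⟨![c 0 + c 1 * v 0, v 1], fun h0 => hgens ⟨?_, ?_⟩, ?_, by simpa using h⟩
    · simpa using congrFun h0 0
    · simpa using congrFun h0 1
    · simp only [Matrix.cons_val_zero, Matrix.cons_val_one]
      ring

lemma IsDir.of_proportional (h : IsDir c v d) {f r u : K} (hf : f ≠ 0) (hr : r ≠ 0) (hu : u ≠ 0)
    (hy : r * f * v' 1 = v 1) (hlin : c 0 + c 1 * v 0 = r * (c' 0 + c' 1 * v' 0))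
    (hsum : coordSum v = u * coordSum v') (hcof : f * cofactor c v = u * cofactor c' v') :
    IsDir c' v' ![d 0 * f, d 1] := by
  obtain ⟨hd, hprop, hstrict⟩ := h
  refine ⟨fun h0 => hd ?_, mul_left_cancel₀ hr ?_, mul_left_cancel₀ hu ?_⟩
  · ext i
    fin_cases i
    · simpa [hf] using congrFun h0 0
    · simpa using congrFun h0 1
  all_goals simp only [Matrix.cons_val_zero, Matrix.cons_val_one]
  · linear_combination hprop + d 0 * hy + d 1 * hlin
  · linear_combination f * hstrict - d 0 * f * hsum - d 1 * hcof

variable {ς ς' ς'' : Equiv.Perm (Fin 5)}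

lemma two_le_symm_of_pair_eq (hs : ({ς 0, ς 1} : Set (Fin 5)) = {ς' 0, ς' 1}) {m : Fin 5}
    (hm : 2 ≤ m) : 2 ≤ ς.symm (ς' m) := by
  by_contra hlt
  have h01 : ς.symm (ς' m) = 0 ∨ ς.symm (ς' m) = 1 := by
    generalize ς.symm (ς' m) = k at hlt
    revert hlt; revert k; decide
  have hmem : ς' m ∈ ({ς 0, ς 1} : Set (Fin 5)) := by
    rcases h01 with h | h <;> rw [← h] <;> simp
  rw [hs] at hmem
  rcases hmem with h | h <;> rw [ς'.injective h] at hm <;> exact absurd hm (by decide)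

lemma two_le_symm_iff_of_pair_eq (hs : ({ς 0, ς 1} : Set (Fin 5)) = {ς' 0, ς' 1}) (i : Fin 5) :
    2 ≤ ς.symm i ↔ 2 ≤ ς'.symm i := by
  constructor <;> intro h
  · simpa using two_le_symm_of_pair_eq hs.symm h
  · simpa using two_le_symm_of_pair_eq hs h

lemma symm_le_one_of_pair_eq (hs : ({ς 0, ς 1} : Set (Fin 5)) = {ς' 0, ς' 1}) :
    ς.symm (ς' 1) ≤ 1 := by
  have hmem : ς' 1 ∈ ({ς 0, ς 1} : Set (Fin 5)) := by rw [hs]; simp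
  rcases hmem with h | h <;> rw [h, Equiv.symm_apply_apply]
  exact Fin.zero_le _

lemma ratioPart_one_of_pair_eq (v : Fin 4 → K)
    (hs : ({ς 0, ς 1} : Set (Fin 5)) = {ς' 0, ς' 1}) : ratioPart ς v (ς 1) (ς' 1) = 1 :=
  ratioPart_of_le _ _ (by simpa using symm_le_one_of_pair_eq hs)

lemma ratioPart_two_of_pair_eq (v : Fin 4 → K)
    (hs : ({ς 0, ς 1} : Set (Fin 5)) = {ς' 0, ς' 1}) : ratioPart ς v (ς' 2) (ς 2) = 1 :=
  ratioPart_of_le _ _ (by simpa using two_le_symm_of_pair_eq hs le_rfl)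

/-- The factor, relative to the second coordinate, by which the first homogeneous coordinate of a
direction changes between charts `ς` and `ς'` that meet the same surface.  The two generators in the
chart `ς` are `(a_i X_j + a_j X_i) / X_{ς 1}` and `X_{ς 1} / X_{ς 2}`. -/
noncomputable def dirFactor (ς : Equiv.Perm (Fin 5)) (v : Fin 4 → K) (ς' : Equiv.Perm (Fin 5)) :
    K :=
  ratioVal ς v (ς 1) (ς' 1) ^ 2 * ratioVal ς v (ς' 2) (ς 2)

lemma dirFactor_eq (v : Fin 4 → K) (hs : ({ς 0, ς 1} : Set (Fin 5)) = {ς' 0, ς' 1}) :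
    dirFactor ς v ς' = (ratioPart ς v (ς' 1) (ς 1) ^ 2 * ratioPart ς v (ς 2) (ς' 2))⁻¹ := by
  rw [dirFactor, ratioVal, ratioVal, ratioPart_one_of_pair_eq v hs, ratioPart_two_of_pair_eq v hs,
    one_div, one_div, inv_pow, mul_inv]

lemma dirFactor_self (ς : Equiv.Perm (Fin 5)) (v : Fin 4 → K) : dirFactor ς v ς = 1 := by
  simp [dirFactor, ratioVal, ratioPart_self]

lemma cofactor_chartParam (a : Fin 6 → K) (ς : Equiv.Perm (Fin 5)) (v : Fin 4 → K) :
    cofactor (chartParam a ς) v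
      = v 0 * ((∑ i ∈ Finset.univ.filter (fun i => 2 ≤ ς.symm i),
          a i.castSucc * ratioPart ς v (ς 2) i) * coordSum v
        - a 5 * ratioPart ς v (ς 2) (ς 4)) := by
  rw [Finset.sum_filter, ← Equiv.sum_comp ς]
  simp [← chartParam_castSucc, cofactor, ratioPart_apply, Fin.sum_univ_five, segProd,
    Finset.prod_filter, Fin.prod_univ_four, chartParam_five]

namespace SamePoint

lemma ratioPart_one_ne_zero (h : SamePoint ς v ς' v')
    (hs : ({ς 0, ς 1} : Set (Fin 5)) = {ς' 0, ς' 1}) : ratioPart ς v (ς' 1) (ς 1) ≠ 0 :=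
  h.ne_zero (ratioPart_one_of_pair_eq v hs) (ratioPart_one_of_pair_eq v' hs.symm)

lemma ratioPart_two_ne_zero (h : SamePoint ς v ς' v')
    (hs : ({ς 0, ς 1} : Set (Fin 5)) = {ς' 0, ς' 1}) : ratioPart ς v (ς 2) (ς' 2) ≠ 0 :=
  h.ne_zero (ratioPart_two_of_pair_eq v hs) (ratioPart_two_of_pair_eq v' hs.symm)

lemma dirFactor_ne_zero (h : SamePoint ς v ς' v')
    (hs : ({ς 0, ς 1} : Set (Fin 5)) = {ς' 0, ς' 1}) : dirFactor ς v ς' ≠ 0 := by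
  rw [dirFactor_eq v hs]
  exact inv_ne_zero
    (mul_ne_zero (pow_ne_zero 2 (h.ratioPart_one_ne_zero hs)) (h.ratioPart_two_ne_zero hs))

lemma dirFactor_mul (h : SamePoint ς v ς' v')
    (hs : ({ς 0, ς 1} : Set (Fin 5)) = {ς' 0, ς' 1})
    (hs' : ({ς' 0, ς' 1} : Set (Fin 5)) = {ς'' 0, ς'' 1}) :
    dirFactor ς v ς'' = dirFactor ς v ς' * dirFactor ς' v' ς'' := by
  have hone := h.mul_right (i := ς'' 1) (ratioPart_one_of_pair_eq v (hs.trans hs'))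
    (ratioPart_one_of_pair_eq v hs) (ratioPart_one_of_pair_eq v' hs')
  have htwo := h.mul_left (i := ς'' 2) (ratioPart_two_of_pair_eq v (hs.trans hs'))
    (ratioPart_two_of_pair_eq v hs) (ratioPart_two_of_pair_eq v' hs')
  rw [dirFactor_eq v (hs.trans hs'), dirFactor_eq v hs, dirFactor_eq v' hs', hone, htwo, ← mul_inv]
  ring

lemma coord_one_eq (h : SamePoint ς v ς' v')
    (hs : ({ς 0, ς 1} : Set (Fin 5)) = {ς' 0, ς' 1}) :
    v' 1 = ratioPart ς v (ς' 1) (ς 1) * v 1 * ratioPart ς v (ς 2) (ς' 2) := by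
  have h1 : ς.symm (ς' 1) ≤ 1 := symm_le_one_of_pair_eq hs
  have h2 : 2 ≤ ς.symm (ς' 2) := two_le_symm_of_pair_eq hs le_rfl
  have h12 : (1 : Fin 5) ≤ 2 := by decide
  have hv : segProd v 1 2 = v 1 := segProd_castSucc_succ v 1
  have hv' : segProd v' 1 2 = v' 1 := segProd_castSucc_succ v' 1
  have hsame := h (ς' 1) (ς' 2)
  rw [ratioPart_apply ς', ratioPart_apply ς', segProd_of_le v' h12, hv',
    ratioPart_of_le ς v (h1.trans (h12.trans h2)), mul_one, mul_one, ratioPart_eq,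
    ← segProd_mul v (h1.trans h12) h2, ← segProd_mul v h1 h12, hv] at hsame
  simp only [ratioPart_eq, Equiv.symm_apply_apply]
  exact hsame.symm

lemma eq_or_swap_of_pair_eq (h : SamePoint ς v ς' v')
    (hs : ({ς 0, ς 1} : Set (Fin 5)) = {ς' 0, ς' 1}) :
    (ς 0 = ς' 0 ∧ ς 1 = ς' 1 ∧ v' 0 = v 0 ∧ ratioPart ς v (ς' 1) (ς 1) = 1) ∨
      (ς 0 = ς' 1 ∧ ς 1 = ς' 0 ∧ v 0 * v' 0 = 1 ∧ ratioPart ς v (ς' 1) (ς 1) = v 0) := by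
  have hv : segProd v 0 1 = v 0 := segProd_castSucc_succ v 0
  have hv' : segProd v' 0 1 = v' 0 := segProd_castSucc_succ v' 0
  have h10 (v : Fin 4 → K) : segProd v 1 0 = 1 := segProd_of_le v (by decide)
  have hsame := h (ς 0) (ς 1)
  rcases Set.pair_eq_pair_iff.mp hs with ⟨h0, h1⟩ | ⟨h0, h1⟩ <;>
    simp only [ratioPart_apply, hv, h10, mul_one] at hsame
  · rw [h0, h1, ratioPart_apply, ratioPart_apply, hv', h10, mul_one] at hsame
    exact Or.inl ⟨h0, h1, hsame.symm, by rw [h1, ratioPart_self]⟩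
  · rw [h0, h1, ratioPart_apply, ratioPart_apply, hv', h10] at hsame
    exact Or.inr ⟨h0, h1, hsame, by rw [← h0, ratioPart_apply, hv]⟩

lemma chartParam_add_eq (h : SamePoint ς v ς' v')
    (hs : ({ς 0, ς 1} : Set (Fin 5)) = {ς' 0, ς' 1}) (a : Fin 6 → K) :
    chartParam a ς 0 + chartParam a ς 1 * v 0 = ratioPart ς v (ς' 1) (ς 1)
      * (chartParam a ς' 0 + chartParam a ς' 1 * v' 0) := by
  have h0 (ς : Equiv.Perm (Fin 5)) : chartParam a ς 0 = a (ς 0).castSucc :=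
    chartParam_castSucc a ς 0
  have h1 (ς : Equiv.Perm (Fin 5)) : chartParam a ς 1 = a (ς 1).castSucc :=
    chartParam_castSucc a ς 1
  rcases h.eq_or_swap_of_pair_eq hs with ⟨hς0, hς1, hv, hr⟩ | ⟨hς0, hς1, hv, hr⟩ <;>
    rw [hr, h0, h0, h1, h1, hς0, hς1]
  · rw [hv, one_mul]
  · linear_combination -a (ς' 1).castSucc * hv

lemma mul_cofactor_eq (h : SamePoint ς v ς' v')
    (hs : ({ς 0, ς 1} : Set (Fin 5)) = {ς' 0, ς' 1}) (a : Fin 6 → K) :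
    v' 0 * cofactor (chartParam a ς) v = v 0 * ratioPart ς v (ς 2) (ς' 2)
      * ratioPart ς v (ς' 4) (ς 4) * cofactor (chartParam a ς') v' := by
  have htwo := ratioPart_two_of_pair_eq v hs
  have hsum : ∑ i ∈ Finset.univ.filter (fun i => 2 ≤ ς.symm i),
      a i.castSucc * ratioPart ς v (ς 2) i
      = ratioPart ς v (ς 2) (ς' 2) * ∑ i ∈ Finset.univ.filter (fun i => 2 ≤ ς'.symm i),
        a i.castSucc * ratioPart ς' v' (ς' 2) i := by
    rw [Finset.mul_sum]
    refine Finset.sum_congr (Finset.filter_congr fun i _ => two_le_symm_iff_of_pair_eq hs i)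
      fun i hi => ?_
    have hi' : 2 ≤ ς'.symm i := (Finset.mem_filter.mp hi).2
    rw [h.mul_left (i := i) (k := ς 2) (l := ς' 2)
      (ratioPart_of_le _ _ (by simpa using (two_le_symm_iff_of_pair_eq hs i).mpr hi')) htwo
      (ratioPart_of_le _ _ (by simpa using hi'))]
    ring
  rw [cofactor_chartParam, cofactor_chartParam, hsum, h.coordSum_eq, ratioPart_last_eq_mul htwo,
    h.ratioPart_last (ς' 2)]
  ring

lemma cofactor_eq (h : SamePoint ς v ς' v')
    (hs : ({ς 0, ς 1} : Set (Fin 5)) = {ς' 0, ς' 1}) (a : Fin 6 → K) :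
    cofactor (chartParam a ς) v
      = ratioPart ς v (ς' 1) (ς 1) ^ 2 * ratioPart ς v (ς 2) (ς' 2)
        * ratioPart ς v (ς' 4) (ς 4) * cofactor (chartParam a ς') v' := by
  have hcof := h.mul_cofactor_eq hs a
  rcases h.eq_or_swap_of_pair_eq hs with ⟨-, -, hv, hr⟩ | ⟨-, -, hv, hr⟩ <;> rw [hr]
  · rcases eq_or_ne (v 0) 0 with hv0 | hv0
    · simp [cofactor, hv, hv0]
    · rw [hv] at hcof
      exact mul_left_cancel₀ hv0 (by linear_combination hcof)
  · linear_combination v 0 * hcof - cofactor (chartParam a ς) v * hv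

lemma isDir (h : SamePoint ς v ς' v') (hs : ({ς 0, ς 1} : Set (Fin 5)) = {ς' 0, ς' 1})
    {a : Fin 6 → K} (hd : IsDir (chartParam a ς) v d) :
    IsDir (chartParam a ς') v' ![d 0 * dirFactor ς v ς', d 1] := by
  have hr := h.ratioPart_one_ne_zero hs
  have ht := h.ratioPart_two_ne_zero hs
  refine hd.of_proportional (h.dirFactor_ne_zero hs) hr h.last_ne_zero ?_
    (h.chartParam_add_eq hs a) h.coordSum_eq ?_
  · rw [dirFactor_eq v hs, h.coord_one_eq hs]
    field_simp
  · rw [dirFactor_eq v hs, h.cofactor_eq hs a]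
    field_simp

end SamePoint

lemma perm_zero_one_of_lt : ∀ σ : Equiv.Perm (Fin 5),
    (σ 0 < σ 2 ∧ σ 0 < σ 3 ∧ σ 0 < σ 4 ∧ σ 1 < σ 2 ∧ σ 1 < σ 3 ∧ σ 1 < σ 4) →
      (σ 0 = 0 ∧ σ 1 = 1) ∨ (σ 0 = 1 ∧ σ 1 = 0) := by
  decide +kernel

lemma SamePoint.pair_eq_of_eq_zero (h : SamePoint ς v ς' v') (hv : v 1 = 0) :
    ({ς 0, ς 1} : Set (Fin 5)) = {ς' 0, ς' 1} := by
  have h12 : (1 : Fin 5) ≤ 2 := by decide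
  have hv12 : segProd v 1 2 = v 1 := segProd_castSucc_succ v 1
  have hlt (k m : Fin 5) (hk : k ≤ 1) (hm : 2 ≤ m) : ς'.symm (ς k) < ς'.symm (ς m) := by
    by_contra hge
    have h0 : ratioPart ς v (ς k) (ς m) = 0 := by
      rw [ratioPart_apply, ← segProd_mul v (hk.trans h12) hm, ← segProd_mul v hk h12, hv12, hv,
        mul_zero, zero_mul]
    rw [h.eq_zero_iff, ratioPart_of_le _ _ (not_lt.mp hge)] at h0
    exact one_ne_zero h0
  have hpos := perm_zero_one_of_lt (ς.trans ς'.symm) ⟨hlt 0 2 (by decide) (by decide),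
    hlt 0 3 (by decide) (by decide), hlt 0 4 (by decide) (by decide),
    hlt 1 2 (by decide) (by decide), hlt 1 3 (by decide) (by decide),
    hlt 1 4 (by decide) (by decide)⟩
  simp only [Equiv.trans_apply, Equiv.symm_apply_eq] at hpos
  exact Set.pair_eq_pair_iff.mpr hpos

end Dir

/-! ### The exceptional quadrics over the nodes in the torus -/

section Wedge

/-- The `2 × 2` minors of the matrix with rows `τ` and `b`.  The generators of the ideal of the
torus point `b` are the minors with `τ` the vector of homogeneous coordinates. -/
def wedge {ι R : Type*} [CommRing R] (b τ : ι → R) : ι × ι → R :=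
  fun ij => τ ij.1 * b ij.2 - τ ij.2 * b ij.1

variable {ι K : Type*} [Fintype ι] [Field K]

/-- Over a node `b` of the threefold, the exceptional quadric is the zero set of this quadratic form
in the minors `wedge b τ` of tangent vectors `τ`. -/
def coneForm (b : ι → K) (s : ι × ι → K) : K :=
  ∑ ij, s ij ^ 2 / (b ij.1 * b ij.2)

/-- Explicit equations for a point `s` of the blow-up of the threefold in its node `b`, over the
torus point with homogeneous coordinates `x`: away from the centre `s` is proportional to the
generators of the ideal, and over the centre it lies on the exceptional quadric. -/
def IsExc (b x : ι → K) (s : ι × ι → K) : Prop :=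
  s ≠ 0 ∧ ((∃ u : K, s = u • wedge b x) ∨
    (wedge b x = 0 ∧ ∃ τ, s = wedge b τ ∧ coneForm b s = 0))

omit [Fintype ι] in
lemma wedge_smul (b x : ι → K) (u : K) : wedge b (u • x) = u • wedge b x := by
  ext ij; simp only [wedge, Pi.smul_apply, smul_eq_mul]; ring

lemma coneForm_smul (b : ι → K) (s : ι × ι → K) (u : K) :
    coneForm b (u • s) = u ^ 2 * coneForm b s := by
  simp only [coneForm, Pi.smul_apply, smul_eq_mul, mul_pow, mul_div_assoc, Finset.mul_sum]

lemma coneForm_wedge {b : ι → K} (hb : ∀ i, b i ≠ 0) (τ : ι → K) :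
    coneForm b (wedge b τ) = 2 * ((∑ i, b i) * (∑ i, τ i ^ 2 / b i) - (∑ i, τ i) ^ 2) := by
  have hterm (i j : ι) : (τ i * b j - τ j * b i) ^ 2 / (b i * b j)
      = τ i ^ 2 / b i * b j + b i * (τ j ^ 2 / b j) - 2 * (τ i * τ j) := by
    have := hb i; have := hb j
    field_simp
    ring
  simp only [coneForm, wedge, Fintype.sum_prod_type, hterm, Finset.sum_sub_distrib,
    Finset.sum_add_distrib, ← Finset.mul_sum, ← Finset.sum_mul]
  ring

variable {b x : ι → K} {s : ι × ι → K} {u : K}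

lemma IsExc.smul (h : IsExc b x s) (hu : u ≠ 0) : IsExc b x (u • s) := by
  refine ⟨smul_ne_zero hu h.1, h.2.imp ?_ ?_⟩
  · rintro ⟨w, rfl⟩
    exact ⟨u * w, by rw [mul_smul]⟩
  · rintro ⟨h0, τ, rfl, hcone⟩
    exact ⟨h0, u • τ, (wedge_smul b τ u).symm, by rw [coneForm_smul, hcone, mul_zero]⟩

lemma isExc_smul_iff (hu : u ≠ 0) : IsExc b (u • x) s ↔ IsExc b x s := by
  simp only [IsExc, wedge_smul, smul_eq_zero, hu, false_or]
  refine and_congr_right fun _ => or_congr_left ⟨?_, ?_⟩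
  · rintro ⟨w, rfl⟩; exact ⟨w * u, by rw [mul_smul]⟩
  · rintro ⟨w, rfl⟩; exact ⟨w * u⁻¹, by rw [smul_smul, inv_mul_cancel_right₀ hu]⟩

end Wedge

section TorusPoint

variable {K : Type*} [Field K]

/-- The coordinates in the chart `ς` of the torus point with homogeneous coordinates `B`, as in
`chartCoords`, but over a ring in which these are units. -/
def unitCoords {L : Type*} [CommRing L] (ς : Equiv.Perm (Fin 5)) (B : Fin 5 → Lˣ) : Fin 4 → L :=
  fun k => ↑(B (ς k.castSucc) / B (ς k.succ))

lemma map_unitCoords {L : Type*} [CommRing L] (φ : L →+* K) (ς : Equiv.Perm (Fin 5))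
    (B : Fin 5 → Lˣ) (k : Fin 4) : φ (unitCoords ς B k) = chartCoords ς (fun i => φ (B i)) k := by
  simp only [unitCoords, chartCoords, div_eq_mul_inv, Units.val_mul, map_mul, map_units_inv]

lemma aeval_homCoord_unitCoords {L : Type*} [CommRing L] [Algebra K L] (ς : Equiv.Perm (Fin 5))
    (B : Fin 5 → Lˣ) (i : Fin 5) :
    aeval (unitCoords ς B) (homCoord K ς i) = ↑(B i / B (ς 4)) := by
  obtain ⟨k, rfl⟩ := ς.surjective i
  rw [aeval_homCoord, Equiv.symm_apply_apply, Finset.prod_filter, Fin.prod_univ_four]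
  simp only [unitCoords]
  fin_cases k <;> simp [← Units.val_mul, Fin.le_def, Fin.ext_iff]

lemma homCoord_apply (ς : Equiv.Perm (Fin 5)) (k : Fin 5) :
    homCoord K ς (ς k) = ![X 0 * X 1 * X 2 * X 3, X 1 * X 2 * X 3, X 2 * X 3, X 3, 1] k := by
  rw [homCoord, Equiv.symm_apply_apply, Finset.prod_filter, Fin.prod_univ_four]
  fin_cases k <;> simp [Fin.le_def]

lemma eval_pointGens (b : Fin 5 → K) (ς : Equiv.Perm (Fin 5)) (v : Fin 4 → K) :
    (fun ij => eval v (pointGens b ς ij)) = wedge b fun i => ratioPart ς v i (ς 4) := by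
  ext ij
  simp [pointGens, wedge, eval_homCoord]

variable {b : Fin 5 → K} (hb : ∀ i, b i ≠ 0)

include hb

lemma eval_homCoord_chartCoords (ς : Equiv.Perm (Fin 5)) (i : Fin 5) :
    eval (chartCoords ς b) (homCoord K ς i) = b i / b (ς 4) := by
  have heval := aeval_homCoord_unitCoords (K := K) ς (fun i => Units.mk0 (b i) (hb i)) i
  have hcoords : unitCoords ς (fun i => Units.mk0 (b i) (hb i)) = chartCoords ς b :=
    funext fun k => map_unitCoords (RingHom.id K) ς (fun i => Units.mk0 (b i) (hb i)) k
  rw [hcoords] at heval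
  simpa using heval

lemma wedge_chartCoords (ς : Equiv.Perm (Fin 5)) :
    wedge b (fun i => ratioPart ς (chartCoords ς b) i (ς 4)) = 0 := by
  ext ij
  simp only [wedge, ← eval_homCoord, eval_homCoord_chartCoords hb ς, Pi.zero_apply]
  ring

lemma eq_chartCoords_of_wedge_eq_zero {ς : Equiv.Perm (Fin 5)} {v : Fin 4 → K}
    (h : wedge b (fun i => ratioPart ς v i (ς 4)) = 0) : v = chartCoords ς b := by
  have hx (i : Fin 5) : ratioPart ς v i (ς 4) = b i / b (ς 4) := by
    have hminor := congrFun h (i, ς 4)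
    simp only [wedge, ratioPart_self, Pi.zero_apply, one_mul] at hminor
    rw [eq_div_iff (hb _)]
    linear_combination hminor
  funext m
  have hmul := ratioPart_last_eq_mul (ς := ς) (v := v) (i := ς m.castSucc) (j := ς m.succ)
    (by rw [ratioPart_apply, segProd_of_le _ Fin.castSucc_lt_succ.le])
  rw [hx, hx, ratioPart_apply, segProd_castSucc_succ] at hmul
  have := hb (ς m.succ)
  have := hb (ς 4)
  rw [chartCoords, eq_div_iff (hb _)]
  field_simp at hmul
  linear_combination -hmul

end TorusPoint

section Node

variable {K : Type*} [Field K] {a : Fin 6 → K} {b : Fin 5 → K}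

/-- The torus point with homogeneous coordinates `b` maps to `(a₁ : ⋯ : a₆)` under `φ`. -/
def IsNodeParam (a : Fin 6 → K) (b : Fin 5 → K) : Prop :=
  (∀ i, b i ≠ 0) ∧ ∃ c : K, c ≠ 0 ∧ ∀ i, phiVec b i = c * a i

lemma phiVec_castSucc (b : Fin 5 → K) (i : Fin 5) : phiVec b i.castSucc = b i ^ 2 := by
  simp [phiVec]

lemma phiVec_five (b : Fin 5 → K) : phiVec b 5 = (∑ i, b i) ^ 2 :=
  Fin.snoc_last (α := fun _ => K) _ _

lemma IsNodeParam.sum_ne_zero (h : IsNodeParam a b) (ha : a 5 ≠ 0) : ∑ i, b i ≠ 0 := by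
  obtain ⟨-, c, hc, hca⟩ := h
  intro h0
  have h5 := hca 5
  rw [phiVec_five, h0, zero_pow two_ne_zero] at h5
  exact mul_ne_zero hc ha h5.symm

/-- The coefficients that express the equation of the threefold, times a monomial, as a quadratic
form in the generators `pointGens b ς` of the ideal of a node. -/
noncomputable def coneCoeff (K : Type*) [Field K] (ς : Equiv.Perm (Fin 5)) (ij : Fin 5 × Fin 5) :
    MvPolynomial (Fin 4) K :=
  if ij.1 = ij.2 then 0 else ∏ m ∈ ({ij.1, ij.2} : Finset (Fin 5))ᶜ, homCoord K ς m

-- Lagrange's identity for `∑ H i * ∑ β i ^ 2 / H i - (∑ β i) ^ 2`, cleared of denominators.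
lemma sum_prod_compl_mul_sq {ι R : Type*} [Fintype ι] [DecidableEq ι] [CommRing R] (H β : ι → R) :
    ∑ i, ∑ j, (if i = j then 0 else ∏ m ∈ ({i, j} : Finset ι)ᶜ, H m) * (H i * β j - H j * β i) ^ 2
      = 2 * ((∑ i, H i) * (∑ i, β i ^ 2 * ∏ m ∈ ({i} : Finset ι)ᶜ, H m)
          - (∑ i, β i) ^ 2 * ∏ i, H i) := by
  have hterm (i j : ι) :
      (if i = j then 0 else ∏ m ∈ ({i, j} : Finset ι)ᶜ, H m) * (H i * β j - H j * β i) ^ 2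
        = H i * (β j ^ 2 * ∏ m ∈ ({j} : Finset ι)ᶜ, H m)
          + (β i ^ 2 * ∏ m ∈ ({i} : Finset ι)ᶜ, H m) * H j - 2 * (β i * β j * ∏ i, H i) := by
    have hi := Fintype.prod_eq_mul_prod_compl i H
    split_ifs with hij
    · subst hij
      linear_combination 2 * β i ^ 2 * hi
    · have hcompl {k l : ι} (hkl : k ≠ l) : ∏ m ∈ ({k} : Finset ι)ᶜ, H m
          = H l * ∏ m ∈ ({k, l} : Finset ι)ᶜ, H m := by
        rw [← Finset.mul_prod_erase _ H (a := l) (by simpa using hkl.symm)]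
        congr 2
        ext m
        simp [and_comm]
      rw [hi, hcompl hij, hcompl (Ne.symm hij), Finset.pair_comm j i]
      ring
  simp only [hterm, Finset.sum_sub_distrib, Finset.sum_add_distrib, ← Finset.mul_sum,
    ← Finset.sum_mul]
  ring

lemma sum_coneCoeff_mul_pointGens_sq (b : Fin 5 → K) (ς : Equiv.Perm (Fin 5)) :
    ∑ ij, coneCoeff K ς ij * pointGens b ς ij ^ 2
      = 2 * ((∑ k, homCoord K ς (ς k)) * (∑ k, C (b (ς k)) ^ 2 *
          ∏ m ∈ ({k} : Finset (Fin 5))ᶜ, homCoord K ς (ς m))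
        - C (∑ i, b i) ^ 2 * ∏ k, homCoord K ς (ς k)) := by
  have hprod (k : Fin 5) : ∏ m ∈ ({k} : Finset (Fin 5))ᶜ, homCoord K ς (ς m)
      = ∏ m ∈ ({ς k} : Finset (Fin 5))ᶜ, homCoord K ς m := by
    refine (Finset.prod_map _ ς.toEmbedding (homCoord K ς)).symm.trans ?_
    congr 1
    ext m
    simp [Equiv.symm_apply_eq]
  simp only [hprod]
  rw [Equiv.sum_comp ς (homCoord K ς), Equiv.prod_comp ς (homCoord K ς),
    Equiv.sum_comp ς fun i => C (b i) ^ 2 * ∏ m ∈ ({i} : Finset (Fin 5))ᶜ, homCoord K ς m,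
    map_sum, ← sum_prod_compl_mul_sq, Fintype.sum_prod_type]
  rfl

lemma sum_coneCoeff {c : K} (hc : ∀ i, phiVec b i = c * a i) (ς : Equiv.Perm (Fin 5)) :
    ∑ ij, coneCoeff K ς ij * pointGens b ς ij ^ 2
      = localEq a ς * (C (2 * c) * (X 1 * X 2 ^ 2 * X 3 ^ 3)) := by
  have hb (k : Fin 5) : (C (b (ς k)) : MvPolynomial (Fin 4) K) ^ 2
      = C c * C (chartParam a ς k.castSucc) := by
    rw [chartParam_castSucc, ← C_pow, ← C_mul, ← hc, phiVec_castSucc]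
  have hsum : (C (∑ i, b i) : MvPolynomial (Fin 4) K) ^ 2 = C c * C (chartParam a ς 5) := by
    rw [← C_pow, ← C_mul, chartParam_five, ← hc, phiVec_five]
  have heq : localEq a ς = eqVal (fun i => C (chartParam a ς i)) X :=
    map_localEq (RingHom.id _) a ς
  have hcompl (i : Fin 5) : ({i} : Finset (Fin 5))ᶜ = Finset.univ.filter (· ≠ i) := by
    ext; simp
  have htwo : (C 2 : MvPolynomial (Fin 4) K) = 2 := map_ofNat C 2
  rw [sum_coneCoeff_mul_pointGens_sq, heq, hsum]
  simp only [htwo, hb, homCoord_apply, hcompl, Finset.prod_filter, Fin.sum_univ_five,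
    Fin.prod_univ_five, eqVal, coordSum, C_mul]
  simp [Fin.ext_iff]
  ring

lemma eval_coneCoeff (hb : ∀ i, b i ≠ 0) (ς : Equiv.Perm (Fin 5)) {s : Fin 5 × Fin 5 → K}
    (hs : ∀ i, s (i, i) = 0) :
    ∑ ij, eval (chartCoords ς b) (coneCoeff K ς ij) * s ij ^ 2
      = (∏ i, b i) / b (ς 4) ^ 3 * coneForm b s := by
  rw [coneForm, Finset.mul_sum]
  refine Finset.sum_congr rfl fun ⟨i, j⟩ _ => ?_
  rcases eq_or_ne i j with rfl | hij
  · simp [hs]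
  · have hprod : ∏ m, b m = b i * b j * ∏ m ∈ ({i, j} : Finset (Fin 5))ᶜ, b m := by
      rw [← Finset.prod_mul_prod_compl ({i, j} : Finset (Fin 5)), Finset.prod_pair hij]
    have hcard : (({i, j} : Finset (Fin 5))ᶜ).card = 3 := by
      rw [Finset.card_compl, Finset.card_pair hij]; rfl
    simp only [coneCoeff, if_neg hij, map_prod, eval_homCoord_chartCoords hb ς,
      Finset.prod_div_distrib, Finset.prod_const, hprod, hcard]
    have := hb i; have := hb j; have := hb (ς 4)
    field_simp

variable {ς : Equiv.Perm (Fin 5)} {v : Fin 4 → K} {s : Fin 5 × Fin 5 → K}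

lemma IsBlowUpPoint.eq_wedge {F : MvPolynomial (Fin 4) K} (hb : b 0 ≠ 0)
    (hs : IsBlowUpPoint F (pointGens b ς) v s) : s = wedge b fun i => s (i, 0) / b 0 := by
  ext ⟨i, j⟩
  -- The Plücker type relation between the minors of a matrix with row `b`.
  have hrel := hs.sum_mul_pow_eq_zero 1 ![(i, j), (i, 0), (j, 0)]
    (c := ![C (b 0), -C (b j), C (b i)]) (by
      convert Submodule.zero_mem _
      simp [Fin.sum_univ_three, pointGens]
      ring)
  simp only [Fin.sum_univ_three, Matrix.cons_val_zero, Matrix.cons_val_one, Matrix.cons_val,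
    map_neg, algHom_C, Algebra.algebraMap_self_apply, pow_one] at hrel
  simp only [wedge]
  field_simp
  linear_combination hrel

lemma IsBlowUpPoint.coneForm_eq_zero (h : IsNodeParam a b)
    (hs : IsBlowUpPoint (localEq a ς) (pointGens b ς) (chartCoords ς b) s) : coneForm b s = 0 := by
  obtain ⟨hb, c, -, hca⟩ := h
  have hdiag (i : Fin 5) : s (i, i) = 0 := by
    rw [hs.eq_wedge (hb 0), wedge, sub_self]
  have hquad := hs.sum_mul_pow_eq_zero 2 id (c := coneCoeff K ς) (by
    simp only [id_eq, sum_coneCoeff hca]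
    exact Ideal.mul_mem_right _ _ (Ideal.subset_span rfl))
  have heval := (eval_coneCoeff hb ς hdiag).symm.trans hquad
  refine (mul_eq_zero.mp heval).resolve_left (div_ne_zero ?_ (pow_ne_zero _ (hb _)))
  exact Finset.prod_ne_zero_iff.mpr fun i _ => hb i

lemma IsBlowUpPoint.isExc (h : IsNodeParam a b)
    (hs : IsBlowUpPoint (localEq a ς) (pointGens b ς) v s) :
    IsExc b (fun i => ratioPart ς v i (ς 4)) s := by
  refine ⟨?_, ?_⟩
  · rintro rfl
    obtain ⟨i, hi⟩ := hs.1
    exact hi.ne_zero rfl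
  by_cases h0 : wedge b (fun i => ratioPart ς v i (ς 4)) = 0
  · obtain rfl := eq_chartCoords_of_wedge_eq_zero h.1 h0
    exact Or.inr ⟨h0, _, hs.eq_wedge (h.1 0), hs.coneForm_eq_zero h⟩
  · left
    rw [← eval_pointGens] at h0 ⊢
    obtain ⟨k, hk⟩ := Function.ne_iff.mp h0
    simp only [Pi.zero_apply] at hk
    refine ⟨s k / eval v (pointGens b ς k), funext fun ij => ?_⟩
    have hprop : eval v (pointGens b ς k) * s ij = eval v (pointGens b ς ij) * s k :=
      hs.mul_comm_eq k ij
    simp only [Pi.smul_apply, smul_eq_mul]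
    field_simp
    linear_combination hprop

end Node

section Arc

variable {K : Type*} [Field K] {a : Fin 6 → K} {b : Fin 5 → K} (hb : ∀ i, b i ≠ 0)

/-- The homogeneous coordinates `b i + t X_i` of the germ at `b` of a line with generic direction
`(X_0, …, X_4)`, as units in the power series in `t`. -/
noncomputable def arcUnit (i : Fin 5) : (PowerSeries (MvPolynomial (Fin 5) K))ˣ :=
  IsUnit.unit (a := PowerSeries.C (C (b i)) + PowerSeries.X * PowerSeries.C (X i)) (by
    rw [PowerSeries.isUnit_iff_constantCoeff]
    simpa using hb i)

lemma coe_arcUnit (i : Fin 5) : (arcUnit hb i : PowerSeries (MvPolynomial (Fin 5) K))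
    = PowerSeries.C (C (b i)) + PowerSeries.X * PowerSeries.C (X i) := rfl

/-- Evaluation at `t = 0` and at the direction `τ`. -/
noncomputable def arcEval (τ : Fin 5 → K) : PowerSeries (MvPolynomial (Fin 5) K) →+* K :=
  (eval τ).comp PowerSeries.constantCoeff

lemma arcEval_arcUnit (τ : Fin 5 → K) (i : Fin 5) : arcEval τ (arcUnit hb i) = b i := by
  simp [arcEval, coe_arcUnit]

/-- Restriction of functions on the chart `ς` to the generic line through `b`. -/
noncomputable def arcHom (ς : Equiv.Perm (Fin 5)) :
    MvPolynomial (Fin 4) K →ₐ[K] PowerSeries (MvPolynomial (Fin 5) K) :=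
  aeval (unitCoords ς (arcUnit hb))

lemma arcEval_arcHom (τ : Fin 5 → K) (ς : Equiv.Perm (Fin 5)) (q : MvPolynomial (Fin 4) K) :
    arcEval τ (arcHom hb ς q) = eval (chartCoords ς b) q := by
  have hcomp : (arcEval τ).comp (arcHom hb ς).toRingHom = eval (chartCoords ς b) := by
    ext i
    · simp [arcEval, PowerSeries.algebraMap_apply]
    · simp [arcHom, map_unitCoords, arcEval_arcUnit]
  exact DFunLike.congr_fun hcomp q

/-- The generators of the ideal of `b`, restricted to the generic line through `b` and divided by
`t`. -/
noncomputable def arcGens (ς : Equiv.Perm (Fin 5)) (ij : Fin 5 × Fin 5) :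
    PowerSeries (MvPolynomial (Fin 5) K) :=
  PowerSeries.C (wedge (fun i => C (b i)) X ij) * ↑(arcUnit hb (ς 4))⁻¹

lemma arcHom_pointGens (ς : Equiv.Perm (Fin 5)) (ij : Fin 5 × Fin 5) :
    arcHom hb ς (pointGens b ς ij) = PowerSeries.X * arcGens hb ς ij := by
  simp only [pointGens, map_sub, map_mul, arcHom, aeval_homCoord_unitCoords, div_eq_mul_inv,
    Units.val_mul, coe_arcUnit, arcGens, wedge, algHom_C, PowerSeries.algebraMap_apply,
    algebraMap_eq]
  ring

lemma arcEval_arcGens (τ : Fin 5 → K) (ς : Equiv.Perm (Fin 5)) (ij : Fin 5 × Fin 5) :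
    arcEval τ (arcGens hb ς ij) = (b (ς 4))⁻¹ * wedge b τ ij := by
  rw [arcGens, map_mul, map_units_inv, arcEval_arcUnit, mul_comm]
  simp [arcEval, wedge]

lemma exists_arcHom_localEq_eq (h2 : (2 : K) ≠ 0) {c : K} (hc : c ≠ 0)
    (hca : ∀ i, phiVec b i = c * a i) (ς : Equiv.Perm (Fin 5)) :
    ∃ E, arcHom hb ς (localEq a ς) = PowerSeries.X ^ 2 * E ∧
      ∀ τ, ∃ k : K, k ≠ 0 ∧ arcEval τ E = k * coneForm b (wedge b τ) := by
  obtain ⟨W, hW⟩ : IsUnit (arcHom hb ς (C (2 * c) * (X 1 * X 2 ^ 2 * X 3 ^ 3))) := by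
    simp only [map_mul, map_pow, arcHom, aeval_X, unitCoords]
    refine IsUnit.mul ?_ (((Units.isUnit _).mul ((Units.isUnit _).pow 2)).mul
      ((Units.isUnit _).pow 3))
    rw [← map_mul, ← map_mul]
    exact (Ne.isUnit (mul_ne_zero h2 hc)).map ((arcHom hb ς).toRingHom.comp C)
  refine ⟨(∑ ij, arcHom hb ς (coneCoeff K ς ij) * arcGens hb ς ij ^ 2) * ↑W⁻¹, ?_, fun τ => ?_⟩
  · have hsum := congrArg (arcHom hb ς) (sum_coneCoeff hca ς)
    rw [map_mul (arcHom hb ς), ← hW, map_sum] at hsum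
    simp only [map_mul, map_pow, arcHom_pointGens] at hsum
    refine W.isUnit.mul_right_cancel ?_
    rw [← hsum, mul_assoc, Units.inv_mul_cancel_right, Finset.mul_sum]
    exact Finset.sum_congr rfl fun ij _ => by ring
  · have hprod : ∏ i, b i ≠ 0 := Finset.prod_ne_zero_iff.mpr fun i _ => hb i
    have hsum := eval_coneCoeff hb ς (s := (b (ς 4))⁻¹ • wedge b τ) fun i => by simp [wedge]
    rw [coneForm_smul] at hsum
    refine ⟨arcEval τ ↑W⁻¹ * ((∏ i, b i) / b (ς 4) ^ 3 * (b (ς 4))⁻¹ ^ 2),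
      mul_ne_zero (W⁻¹.isUnit.map (arcEval τ)).ne_zero (mul_ne_zero
        (div_ne_zero hprod (pow_ne_zero _ (hb _))) (pow_ne_zero _ (inv_ne_zero (hb _)))), ?_⟩
    simp only [map_mul, map_sum, map_pow, arcEval_arcHom, arcEval_arcGens]
    simp only [Pi.smul_apply, smul_eq_mul] at hsum
    rw [hsum]
    ring

include hb in
lemma exists_coneForm_wedge_ne_zero (h2 : (2 : K) ≠ 0) (hsum : ∑ i, b i ≠ 0) :
    ∃ τ, coneForm b (wedge b τ) ≠ 0 := by
  by_contra! hzero
  have heq (m : Fin 5) : b m = ∑ i, b i := by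
    have hm := hzero (Pi.single m 1)
    have hsq : ∑ i, (Pi.single m (1 : K) : Fin 5 → K) i ^ 2 / b i = (b m)⁻¹ := by
      rw [Finset.sum_eq_single m (fun i _ hi => by simp [hi]) (by simp)]
      simp
    rw [coneForm_wedge hb, hsq, Finset.sum_pi_single', if_pos (Finset.mem_univ m), mul_eq_zero,
      or_iff_right h2, one_pow, sub_eq_zero, mul_inv_eq_one₀ (hb m)] at hm
    exact hm.symm
  have hfive : ∑ i, b i = 5 * ∑ i, b i := by
    nth_rewrite 1 [Finset.sum_congr rfl fun m _ => heq m]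
    simp
  exact mul_ne_zero h2 (mul_ne_zero h2 hsum) (by linear_combination -hfive)

lemma isBlowUpPoint_chartCoords (h2 : (2 : K) ≠ 0) (h : IsNodeParam a b) (ha : a 5 ≠ 0)
    (ς : Equiv.Perm (Fin 5)) {τ : Fin 5 → K} (hτ : wedge b τ ≠ 0)
    (hcone : coneForm b (wedge b τ) = 0) :
    IsBlowUpPoint (localEq a ς) (pointGens b ς) (chartCoords ς b) (wedge b τ) := by
  have hsum := h.sum_ne_zero ha
  obtain ⟨hb, c, hc, hca⟩ := h
  obtain ⟨E, hF, hE⟩ := exists_arcHom_localEq_eq hb h2 hc hca ς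
  have hXE : ¬ PowerSeries.X ∣ E := fun hdvd => by
    obtain ⟨τ', hτ'⟩ := exists_coneForm_wedge_ne_zero hb h2 hsum
    obtain ⟨k, hk, hkE⟩ := hE τ'
    rw [arcEval, RingHom.comp_apply, PowerSeries.X_dvd_iff.mp hdvd, map_zero] at hkE
    exact mul_ne_zero hk hτ' hkE.symm
  have hpt : IsBlowUpPoint (localEq a ς) (pointGens b ς) (chartCoords ς b)
      fun ij => arcEval τ (arcGens hb ς ij) := by
    obtain ⟨k, hk⟩ := Function.ne_iff.mp hτ
    refine isBlowUpPoint_of_lift (arcHom hb ς).toRingHom (arcEval τ) (arcEval_arcHom hb τ ς)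
      PowerSeries.X_prime (arcHom_pointGens hb ς) hF hXE ?_ ⟨k, ?_⟩
    · obtain ⟨l, -, hlE⟩ := hE τ
      rw [hlE, hcone, mul_zero]
    · rw [arcEval_arcGens]
      exact (mul_ne_zero (inv_ne_zero (hb _)) hk).isUnit
  convert hpt.mul_left (hb (ς 4)).isUnit using 1
  ext ij
  rw [arcEval_arcGens, mul_inv_cancel_left₀ (hb _)]

lemma isBlowUpPoint_point_of_isExc (h2 : (2 : K) ≠ 0) (h : IsNodeParam a b) (ha : a 5 ≠ 0)
    {ς : Equiv.Perm (Fin 5)} {v : Fin 4 → K} {s : Fin 5 × Fin 5 → K}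
    (hF : eqVal (chartParam a ς) v = 0) (hs : IsExc b (fun i => ratioPart ς v i (ς 4)) s) :
    IsBlowUpPoint (localEq a ς) (pointGens b ς) v s := by
  obtain ⟨hs0, ⟨u, rfl⟩ | ⟨hw, τ, rfl, hcone⟩⟩ := hs
  · rw [← eval_pointGens] at hs0 ⊢
    obtain ⟨k, hk⟩ := Function.ne_iff.mp hs0
    exact isBlowUpPoint_of_eq_mul ((eval_localEq v a ς).trans hF) u (fun ij => rfl)
      ⟨k, Ne.isUnit hk⟩
  · obtain rfl := eq_chartCoords_of_wedge_eq_zero h.1 hw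
    exact isBlowUpPoint_chartCoords h2 h ha ς hs0 hcone

end Arc

/-! ### The glued variety in terms of normal chart points -/

section Glue

variable {K : Type*} [Field K]

lemma eq_of_rep_mul_rep_comm {ι : Type*} {P Q : ℙ K (ι → K)}
    (h : ∀ i j, P.rep i * Q.rep j = Q.rep i * P.rep j) : P = Q := by
  obtain ⟨j, hj⟩ := Function.ne_iff.mp Q.rep_nonzero
  rw [← P.mk_rep, ← Q.mk_rep, Projectivization.mk_eq_mk_iff']
  refine ⟨P.rep j / Q.rep j, funext fun i => ?_⟩
  simp only [Pi.zero_apply] at hj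
  simp only [Pi.smul_apply, smul_eq_mul]
  field_simp
  linear_combination -h i j

lemma eq_of_rep_cross_eq {P Q : ℙ K (Fin 2 → K)} (h : P.rep 0 * Q.rep 1 = Q.rep 0 * P.rep 1) :
    P = Q := by
  refine eq_of_rep_mul_rep_comm ?_
  simp only [Fin.forall_fin_two, Fin.isValue, mul_comm, true_and, and_true]
  exact ⟨by rw [h, mul_comm], by rw [mul_comm, ← h, mul_comm]⟩

lemma cross_eq_trans {x y z : Fin 2 → K} (hy : y ≠ 0) {r t : K} (ht : t ≠ 0)
    (hxy : x 0 * r * y 1 = y 0 * x 1) (hyz : y 0 * t * z 1 = z 0 * y 1) :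
    x 0 * (r * t) * z 1 = z 0 * x 1 := by
  by_cases hy1 : y 1 = 0
  · have hy0 : y 0 ≠ 0 := fun hy0 => hy (by ext i; fin_cases i; exacts [hy0, hy1])
    rw [hy1, mul_zero] at hxy hyz
    have hx1 := (mul_eq_zero.mp hxy.symm).resolve_left hy0
    have hz1 := (mul_eq_zero.mp hyz).resolve_left (mul_ne_zero hy0 ht)
    rw [hx1, hz1, mul_zero, mul_zero]
  · refine mul_left_cancel₀ hy1 ?_
    linear_combination t * z 1 * hxy + x 1 * hyz

variable {ς ς' : Equiv.Perm (Fin 5)} {v v' : Fin 4 → K}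

lemma isDir_rep_mk {c : Fin 6 → K} {d : Fin 2 → K} (h : IsDir c v d) :
    IsDir c v (Projectivization.mk K d h.1).rep := by
  obtain ⟨u, hu⟩ := Projectivization.exists_smul_eq_mk_rep K d h.1
  rw [← hu]
  exact h.smul u.ne_zero

lemma isExc_rep_mk {ι : Type*} [Fintype ι] {b x : ι → K} {s : ι × ι → K} (h : IsExc b x s) :
    IsExc b x (Projectivization.mk K s h.1).rep := by
  obtain ⟨u, hu⟩ := Projectivization.exists_smul_eq_mk_rep K s h.1
  rw [← hu]
  exact h.smul u.ne_zero

variable {a : Fin 6 → K} {B : Set (ℙ K (Fin 5 → K))}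

namespace ChartPoint

variable (P Q : ChartPoint K a B)

lemma eqVal_eq_zero : eqVal (chartParam a P.chart) P.pt = 0 := by
  rw [← eval_localEq]; exact P.on_threefold

lemma isDir : IsDir (chartParam a P.chart) P.pt P.dir.rep := P.dir_mem.isDir

lemma isExc (hB : ∀ b ∈ B, IsNodeParam a b.rep) (b : B) :
    IsExc b.1.rep (fun i => ratioPart P.chart P.pt i (P.chart 4)) (P.exc b).rep :=
  (P.exc_mem b).isExc (hB b.1 b.2)

/-- The point with the given components, which are only required to satisfy the explicit equations
`IsDir` and `IsExc` for the points of the blow-ups. -/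
def ofEquations (h2 : (2 : K) ≠ 0) (ha : ∀ i, a i ≠ 0) (hB : ∀ b ∈ B, IsNodeParam a b.rep)
    (ς : Equiv.Perm (Fin 5)) (v : Fin 4 → K) (hF : eqVal (chartParam a ς) v = 0)
    (d : ℙ K (Fin 2 → K)) (hd : IsDir (chartParam a ς) v d.rep)
    (e : B → ℙ K (Fin 5 × Fin 5 → K))
    (he : ∀ b : B, IsExc b.1.rep (fun i => ratioPart ς v i (ς 4)) (e b).rep) :
    ChartPoint K a B where
  chart := ς
  pt := v
  on_threefold := by rw [eval_localEq]; exact hF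
  dir := d
  dir_mem := isBlowUpPoint_surface_of_isDir (chartParam_ne_zero ha ς 1) hd
  exc := e
  exc_mem b := isBlowUpPoint_point_of_isExc h2 (hB b.1 b.2) (ha 5) hF (he b)

end ChartPoint

lemma glued_iff (P Q : ChartPoint K a B) : Glued P Q ↔
    SamePoint P.chart P.pt Q.chart Q.pt ∧
    (({P.chart 0, P.chart 1} : Set (Fin 5)) = {Q.chart 0, Q.chart 1} →
      P.dir.rep 0 * dirFactor P.chart P.pt Q.chart * Q.dir.rep 1 = Q.dir.rep 0 * P.dir.rep 1) ∧
    P.exc = Q.exc := by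
  have hfactor : P.dir.rep 0 * dirFactor P.chart P.pt Q.chart * Q.dir.rep 1
      = P.dir.rep 0 * Q.dir.rep 1 * ratioVal P.chart P.pt (P.chart 1) (Q.chart 1) ^ 2
        * ratioVal P.chart P.pt (Q.chart 2) (P.chart 2) := by
    rw [dirFactor]; ring
  rw [hfactor]; rfl

namespace Glued

variable {P Q R : ChartPoint K a B}

lemma symm (h : Glued P Q) : Glued Q P := by
  rw [glued_iff] at h ⊢
  obtain ⟨hsame, hdir, hexc⟩ := h
  refine ⟨hsame.symm, fun hs => ?_, hexc.symm⟩
  have hinv := hsame.dirFactor_mul hs.symm hs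
  rw [dirFactor_self] at hinv
  refine mul_left_cancel₀ (hsame.dirFactor_ne_zero hs.symm) ?_
  linear_combination -hdir hs.symm - Q.dir.rep 0 * P.dir.rep 1 * hinv

-- If the middle chart does not meet the surface, then all three points lie off the centre, where
-- the direction is determined by the point.
lemma trans (h : Glued P Q) (h' : Glued Q R) : Glued P R := by
  rw [glued_iff] at h h' ⊢
  obtain ⟨hPQ, hdir, hexc⟩ := h
  obtain ⟨hQR, hdir', hexc'⟩ := h'
  refine ⟨hPQ.trans hQR, fun hs => ?_, hexc.trans hexc'⟩
  by_cases hv : R.pt 1 = 0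
  · have hQ := hQR.symm.pair_eq_of_eq_zero hv
    rw [hPQ.dirFactor_mul (hs.trans hQ) hQ.symm]
    exact cross_eq_trans Q.dir.rep_nonzero (hQR.dirFactor_ne_zero hQ.symm) (hdir (hs.trans hQ))
      (hdir' hQ.symm)
  · simpa using ((hPQ.trans hQR).isDir hs P.isDir).cross_eq R.isDir (Or.inl hv)

end Glued

lemma glued_equivalence : Equivalence (Glued (K := K) (a := a) (B := B)) where
  refl P := (glued_iff P P).mpr
    ⟨SamePoint.refl _ _, fun _ => by rw [dirFactor_self, mul_one], rfl⟩
  symm := Glued.symm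
  trans := Glued.trans

lemma SamePoint.isExc_iff (h : SamePoint ς v ς' v') {b : Fin 5 → K} {s : Fin 5 × Fin 5 → K} :
    IsExc b (fun i => ratioPart ς v i (ς 4)) s
      ↔ IsExc b (fun i => ratioPart ς' v' i (ς' 4)) s := by
  have hsmul : (fun i => ratioPart ς v i (ς 4))
      = ratioPart ς v (ς' 4) (ς 4) • fun i => ratioPart ς' v' i (ς' 4) :=
    funext h.ratioPart_last
  rw [hsmul, isExc_smul_iff h.last_ne_zero]

lemma exists_glued_normal (h2 : (2 : K) ≠ 0) (ha : ∀ i, a i ≠ 0)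
    (hB : ∀ b ∈ B, IsNodeParam a b.rep) (P : ChartPoint K a B) :
    ∃ Q : ChartPoint K a B, Normal Q.chart Q.pt ∧ Glued P Q := by
  obtain ⟨ς, v, hn, hsame⟩ := exists_normal P.chart P.pt
  have hF : eqVal (chartParam a ς) v = 0 := by
    rw [hsame.symm.eqVal_eq a, P.eqVal_eq_zero, mul_zero]
  have he : ∀ b : B, IsExc b.1.rep (fun i => ratioPart ς v i (ς 4)) (P.exc b).rep :=
    fun b => hsame.isExc_iff.mp (P.isExc hB b)
  by_cases hs : ({P.chart 0, P.chart 1} : Set (Fin 5)) = {ς 0, ς 1}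
  · have hd := hsame.isDir hs P.isDir
    refine ⟨.ofEquations h2 ha hB ς v hF _ (isDir_rep_mk hd) P.exc he, hn, ?_⟩
    rw [glued_iff]
    refine ⟨hsame, fun _ => ?_, rfl⟩
    obtain ⟨u, hu⟩ := Projectivization.exists_smul_eq_mk_rep K _ hd.1
    simp only [ChartPoint.ofEquations, ← hu, Units.smul_def, Pi.smul_apply, smul_eq_mul]
    simp only [Matrix.cons_val_zero, Matrix.cons_val_one]
    ring
  · obtain ⟨d, hd⟩ := exists_isDir hF
    refine ⟨.ofEquations h2 ha hB ς v hF _ (isDir_rep_mk hd) P.exc he, hn, ?_⟩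
    rw [glued_iff]
    exact ⟨hsame, fun h => absurd h hs, rfl⟩

lemma eq_of_glued_normal {P Q : ChartPoint K a B} (hP : Normal P.chart P.pt)
    (hQ : Normal Q.chart Q.pt) (h : Glued P Q) : P = Q := by
  obtain ⟨hsame, hdir, hexc⟩ := (glued_iff P Q).mp h
  obtain ⟨ς, v, hF, d, hd, e, he⟩ := P
  obtain ⟨ς', v', hF', d', hd', e', he'⟩ := Q
  dsimp only at *
  obtain rfl := hsame.chart_eq_of_normal hP hQ
  obtain rfl := hsame.eq_of_chart_eq
  obtain rfl := hexc
  have hcross := hdir rfl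
  rw [dirFactor_self, mul_one] at hcross
  obtain rfl := eq_of_rep_cross_eq hcross
  rfl

/-- The points of the threefold, each one in the chart in which it is normal. -/
abbrev NormalPoint (a : Fin 6 → K) : Type _ :=
  {q : Equiv.Perm (Fin 5) × (Fin 4 → K) // eqVal (chartParam a q.1) q.2 = 0 ∧ Normal q.1 q.2}

/-- The fibre over a point of the threefold of the blow-up of the surface that meets the chart. -/
abbrev DirFibre (a : Fin 6 → K) (q : Equiv.Perm (Fin 5) × (Fin 4 → K)) : Type _ :=
  {d : ℙ K (Fin 2 → K) // IsDir (chartParam a q.1) q.2 d.rep}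

/-- The fibre over a point of the threefold of the blow-up of the torus point `b`. -/
abbrev ExcFibre (b : ℙ K (Fin 5 → K)) (q : Equiv.Perm (Fin 5) × (Fin 4 → K)) : Type _ :=
  {e : ℙ K (Fin 5 × Fin 5 → K) // IsExc b.rep (fun i => ratioPart q.1 q.2 i (q.1 4)) e.rep}

lemma card_bigResolution (h2 : (2 : K) ≠ 0) (ha : ∀ i, a i ≠ 0)
    (hB : ∀ b ∈ B, IsNodeParam a b.rep) :
    Nat.card (BigResolution K a B)
      = Nat.card (Σ q : NormalPoint a, DirFibre a q.1 × ∀ b : B, ExcFibre b.1 q.1) := by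
  refine (Nat.card_eq_of_bijective (fun x => Quot.mk _ (.ofEquations h2 ha hB x.1.1.1 x.1.1.2
    x.1.2.1 x.2.1.1 x.2.1.2 (fun b => (x.2.2 b).1) fun b => (x.2.2 b).2)) ⟨?_, ?_⟩).symm
  · rintro ⟨⟨⟨ς, v⟩, hF, hn⟩, ⟨d, hd⟩, e⟩ ⟨⟨⟨ς', v'⟩, hF', hn'⟩, ⟨d', hd'⟩, e'⟩ h
    have h := eq_of_glued_normal (by exact hn) (by exact hn')
      ((glued_equivalence.quot_mk_eq_iff _ _).mp h)
    simp only [ChartPoint.ofEquations, ChartPoint.mk.injEq] at h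
    obtain ⟨rfl, rfl, rfl, hexc⟩ := h
    obtain rfl : e = e' := funext fun b => Subtype.ext (congrFun hexc b)
    rfl
  · intro x
    obtain ⟨P, rfl⟩ := Quot.exists_rep x
    obtain ⟨Q, hn, hQ⟩ := exists_glued_normal h2 ha hB P
    refine ⟨⟨⟨(Q.chart, Q.pt), Q.eqVal_eq_zero, hn⟩, ⟨Q.dir, Q.isDir⟩,
      fun b => ⟨Q.exc b, Q.isExc hB b⟩⟩, ?_⟩
    exact Quot.sound hQ.symm

end Glue

/-! ### Counting points of quadrics over finite fields -/

section Quadric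

variable {F : Type*} [Field F] [Fintype F] [DecidableEq F]

lemma sum_ite_sq_eq (h2 : (2 : F) ≠ 0) (c : F) :
    ∑ u : F, (if u ^ 2 = c then 1 else 0 : ℤ) = quadraticChar F c + 1 := by
  have hchar : ringChar F ≠ 2 := fun h => h2 (by
    have := ringChar.Nat.cast_ringChar (R := F)
    rwa [h] at this)
  rw [← quadraticChar_card_sqrts hchar c, Finset.sum_boole]
  simp

lemma sum_sum_ite_mul_eq {c : F} (hc : c ≠ 0) :
    ∑ m : F, ∑ n : F, (if m * n = c then 1 else 0 : ℤ) = Fintype.card F - 1 := by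
  have count_n (m : F) :
      ∑ n : F, (if m * n = c then 1 else 0 : ℤ) = 1 - if m = 0 then 1 else 0 := by
    rcases eq_or_ne m 0 with rfl | hm
    · simp [hc.symm]
    · have solve_n (n : F) : m * n = c ↔ n = c / m := by rw [eq_div_iff hm, mul_comm]
      simp [solve_n, hm]
  simp [count_n]

lemma sum_quadraticChar_sq_sub (h2 : (2 : F) ≠ 0) {c : F} (hc : c ≠ 0) :
    ∑ y : F, quadraticChar F (y ^ 2 - c) = -1 := by
  have count_hyperbola : ∑ y : F, ∑ u : F, (if u ^ 2 = y ^ 2 - c then 1 else 0 : ℤ)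
      = Fintype.card F - 1 := by
    let asymptotes : F × F ≃ F × F :=
      { toFun := fun q => (q.1 - q.2, q.1 + q.2)
        invFun := fun q => ((q.1 + q.2) / 2, (q.2 - q.1) / 2)
        left_inv := fun q => by ext <;> dsimp only <;> field_simp <;> ring
        right_inv := fun q => by ext <;> dsimp only <;> field_simp <;> ring }
    rw [← sum_sum_ite_mul_eq hc, ← Fintype.sum_prod_type', ← Fintype.sum_prod_type']
    refine Fintype.sum_equiv asymptotes _ _ fun q => if_congr ?_ rfl rfl
    simp only [asymptotes, Equiv.coe_fn_mk]
    constructor <;> intro h <;> linear_combination -h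
  simp only [sum_ite_sq_eq h2, Finset.sum_add_distrib, Finset.sum_const, Finset.card_univ,
    nsmul_eq_mul, mul_one] at count_hyperbola
  linarith

lemma sum_sum_ite_binary (h2 : (2 : F) ≠ 0) {α β : F} (hα : α ≠ 0) (hβ : β ≠ 0) (c : F) :
    ∑ x : F, ∑ y : F, (if α * x ^ 2 + β * y ^ 2 = c then 1 else 0 : ℤ)
      = (Fintype.card F - quadraticChar F (-(α * β)))
        + Fintype.card F * quadraticChar F (-(α * β)) * if c = 0 then 1 else 0 := by
  have count_x (y : F) : ∑ x : F, (if α * x ^ 2 + β * y ^ 2 = c then 1 else 0 : ℤ)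
      = quadraticChar F (-(α * β)) * quadraticChar F (y ^ 2 - c / β) + 1 := by
    have solve_sq (x : F) : α * x ^ 2 + β * y ^ 2 = c ↔ x ^ 2 = (c - β * y ^ 2) / α := by
      rw [eq_div_iff hα, eq_sub_iff_add_eq, mul_comm]
    have mod_squares : -(α * β) * (y ^ 2 - c / β) = (c - β * y ^ 2) / α * α ^ 2 := by
      field_simp
      ring
    simp only [solve_sq]
    rw [sum_ite_sq_eq h2, ← map_mul, mod_squares, map_mul, quadraticChar_sq_one' hα, mul_one]
  have sum_char : ∑ y : F, quadraticChar F (y ^ 2 - c / β)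
      = Fintype.card F * (if c = 0 then 1 else 0) - 1 := by
    split_ifs with hc
    · have char_sq (y : F) : quadraticChar F (y ^ 2 - c / β) = 1 - if y = 0 then 1 else 0 := by
        rcases eq_or_ne y 0 with rfl | hy
        · simp [hc]
        · simp [hc, hy, quadraticChar_sq_one' hy]
      simp [char_sq, Finset.sum_sub_distrib]
    · rw [sum_quadraticChar_sq_sub h2 (div_ne_zero hc hβ), mul_zero, zero_sub]
  rw [Finset.sum_comm]
  simp only [count_x, Finset.sum_add_distrib, ← Finset.mul_sum, sum_char, Finset.sum_const,
    Finset.card_univ, nsmul_eq_mul]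
  ring

omit [Field F] [DecidableEq F] in
lemma sum_fin_succ {M : Type*} [AddCommMonoid M] {n : ℕ} (f : (Fin (n + 1) → F) → M) :
    ∑ v, f v = ∑ x : F, ∑ w : Fin n → F, f (Fin.cons x w) := by
  rw [← Fintype.sum_prod_type', ← (Fin.consEquiv fun _ => F).sum_comp]
  rfl

omit [Field F] [DecidableEq F] in
lemma sum_fin_five {M : Type*} [AddCommMonoid M] (f : (Fin 5 → F) → M) :
    ∑ v, f v = ∑ x : F, ∑ y : F, ∑ z : F, ∑ w : F, ∑ u : F, f ![x, y, z, w, u] := by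
  simp only [sum_fin_succ, Fintype.sum_unique]
  rfl

lemma sum_ite_senary (h2 : (2 : F) ≠ 0) {α : Fin 5 → F} (hα : ∀ i, α i ≠ 0) {β : F}
    (hβ : β ≠ 0) :
    ∑ v : Fin 5 → F, ∑ y : F, (if ∑ i, α i * v i ^ 2 + β * y ^ 2 = 0 then 1 else 0 : ℤ)
      = (Fintype.card F : ℤ) ^ 5
        + quadraticChar F (-((∏ i, α i) * β)) * (Fintype.card F ^ 3 - Fintype.card F ^ 2) := by
  have count_last_two (x y z w : F) : ∑ u : F, ∑ t : F,
      (if ∑ i, α i * (![x, y, z, w, u] : Fin 5 → F) i ^ 2 + β * t ^ 2 = 0 then 1 else 0 : ℤ)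
      = (Fintype.card F - quadraticChar F (-(α 4 * β)))
        + Fintype.card F * quadraticChar F (-(α 4 * β)) *
          if α 2 * z ^ 2 + α 3 * w ^ 2 = -(α 0 * x ^ 2 + α 1 * y ^ 2) then 1 else 0 := by
    have isolate (u t : F) : ∑ i, α i * (![x, y, z, w, u] : Fin 5 → F) i ^ 2 + β * t ^ 2 = 0
        ↔ α 4 * u ^ 2 + β * t ^ 2
          = -(α 0 * x ^ 2 + α 1 * y ^ 2 + (α 2 * z ^ 2 + α 3 * w ^ 2)) := by
      rw [Fin.sum_univ_five, eq_neg_iff_add_eq_zero]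
      exact Eq.congr_left (by simp only [Matrix.cons_val]; ring)
    simp only [isolate, sum_sum_ite_binary h2 (hα 4) hβ, neg_eq_zero]
    simp only [add_comm (α 0 * x ^ 2 + α 1 * y ^ 2), ← eq_neg_iff_add_eq_zero]
  have disc_eq : -((∏ i, α i) * β) = -(α 0 * α 1) * -(α 2 * α 3) * -(α 4 * β) := by
    rw [Fin.prod_univ_five]
    ring
  rw [sum_fin_five, disc_eq, map_mul, map_mul]
  simp only [count_last_two, Finset.sum_add_distrib, ← Finset.mul_sum,
    sum_sum_ite_binary h2 (hα 2) (hα 3), neg_eq_zero, sum_sum_ite_binary h2 (hα 0) (hα 1),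
    Finset.sum_const, Finset.card_univ, nsmul_eq_mul, if_true]
  ring

lemma sum_ite_sum_eq_zero (n : ℕ) :
    ∑ τ : Fin (n + 1) → F, (if ∑ i, τ i = 0 then 1 else 0 : ℤ) = (Fintype.card F : ℤ) ^ n := by
  rw [sum_fin_succ, Finset.sum_comm]
  simp [Fin.sum_univ_succ, add_eq_zero_iff_eq_neg]

lemma sum_eq_sum_add_mul {ι M : Type*} [Fintype ι] [DecidableEq ι] [AddCommMonoid M] {b : ι → F}
    (hS : ∑ i, b i ≠ 0) (f : (ι → F) → M) :
    ∑ v, f v = ∑ τ : ι → F, if ∑ i, τ i = 0 then ∑ x : F, f fun i => τ i + x * b i else 0 := by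
  have sum_shift (τ : ι → F) (x : F) : ∑ i, (τ i + x * b i) = ∑ i, τ i + x * ∑ i, b i := by
    rw [Finset.sum_add_distrib, ← Finset.mul_sum]
  rw [← Finset.sum_filter, Finset.sum_subtype (p := fun τ : ι → F => ∑ i, τ i = 0)
    (Finset.univ.filter _) (fun τ => Finset.mem_filter_univ τ), ← Fintype.sum_prod_type']
  let split : {τ : ι → F // ∑ i, τ i = 0} × F ≃ (ι → F) :=
    { toFun := fun q i => q.1.1 i + q.2 * b i
      invFun := fun v => (⟨fun i => v i + -((∑ i, v i) / ∑ i, b i) * b i, by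
        rw [sum_shift]
        field_simp
        ring⟩, (∑ i, v i) / ∑ i, b i)
      left_inv := fun q => by
        have coeff_eq : (∑ i, (q.1.1 i + q.2 * b i)) / ∑ i, b i = q.2 := by
          rw [sum_shift, q.1.2, zero_add, mul_div_cancel_right₀ _ hS]
        refine Prod.ext (Subtype.ext (funext fun i => ?_)) coeff_eq
        simp only [coeff_eq]
        ring
      right_inv := fun v => by
        ext i
        dsimp only
        ring }
  exact (Fintype.sum_equiv split _ _ fun q => rfl).symm

omit [Fintype F] [DecidableEq F] in
lemma sum_inv_mul_add_sq {ι : Type*} [Fintype ι] {b τ : ι → F} (hb : ∀ i, b i ≠ 0)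
    (hτ : ∑ i, τ i = 0) (x : F) :
    ∑ i, (b i)⁻¹ * (τ i + x * b i) ^ 2 = ∑ i, τ i ^ 2 / b i + (∑ i, b i) * x ^ 2 := by
  have expand (i : ι) : (b i)⁻¹ * (τ i + x * b i) ^ 2
      = τ i ^ 2 / b i + 2 * x * τ i + b i * x ^ 2 := by
    have := hb i
    field_simp
    ring
  simp only [expand, Finset.sum_add_distrib, ← Finset.mul_sum, ← Finset.sum_mul, hτ, mul_zero,
    add_zero]

lemma sum_sum_ite_inv_mul_add_sq (h2 : (2 : F) ≠ 0) {b : Fin 5 → F} (hb : ∀ i, b i ≠ 0)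
    (hS : ∑ i, b i ≠ 0) {τ : Fin 5 → F} (hτ : ∑ i, τ i = 0) :
    ∑ x : F, ∑ y : F,
        (if ∑ i, (b i)⁻¹ * (τ i + x * b i) ^ 2 + (-∑ i, b i) * y ^ 2 = 0 then 1 else 0 : ℤ)
      = Fintype.card F - 1 + Fintype.card F * if ∑ i, τ i ^ 2 / b i = 0 then 1 else 0 := by
  have isolate (x y : F) : ∑ i, τ i ^ 2 / b i + (∑ i, b i) * x ^ 2 + (-∑ i, b i) * y ^ 2 = 0
      ↔ (∑ i, b i) * x ^ 2 + (-∑ i, b i) * y ^ 2 = -∑ i, τ i ^ 2 / b i := by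
    rw [eq_neg_iff_add_eq_zero, add_assoc, add_comm]
  simp only [sum_inv_mul_add_sq hb hτ, isolate,
    sum_sum_ite_binary h2 hS (neg_ne_zero.mpr hS), mul_neg, neg_neg,
    ← sq, quadraticChar_sq_one' hS, neg_eq_zero, mul_one]

-- The vector `b` has length `∑ b` for the form `∑ vᵢ² / bᵢ`, and `∑ τ = 0` is its orthogonal
-- complement. Adding the form `-(∑ b) y²` makes a hyperbolic plane out of the line through `b`, so
-- that the cone is counted by a quadric in six variables.
lemma sum_ite_cone (h2 : (2 : F) ≠ 0) {b : Fin 5 → F} (hb : ∀ i, b i ≠ 0)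
    (hS : ∑ i, b i ≠ 0) :
    ∑ τ : Fin 5 → F, (if ∑ i, τ i = 0 ∧ ∑ i, τ i ^ 2 / b i = 0 then 1 else 0 : ℤ)
      = (Fintype.card F : ℤ) ^ 3 + quadraticChar F ((∏ i, b i) * ∑ i, b i)
        * (Fintype.card F ^ 2 - Fintype.card F) := by
  have char_disc : quadraticChar F (-((∏ i, (b i)⁻¹) * -∑ i, b i))
      = quadraticChar F ((∏ i, b i) * ∑ i, b i) := by
    have hP : ∏ i, b i ≠ 0 := Finset.prod_ne_zero_iff.mpr fun i _ => hb i
    rw [show (∏ i, b i) * ∑ i, b i = -((∏ i, (b i)⁻¹) * -∑ i, b i) * (∏ i, b i) ^ 2 by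
      rw [Finset.prod_inv_distrib]; field_simp, map_mul _ _ (_ ^ 2), quadraticChar_sq_one' hP,
      mul_one]
  have senary := sum_ite_senary h2 (fun i => inv_ne_zero (hb i)) (neg_ne_zero.mpr hS)
  rw [char_disc, sum_eq_sum_add_mul hS] at senary
  have split_count (τ : Fin 5 → F) : (if ∑ i, τ i = 0 then ∑ x : F, ∑ y : F,
        (if ∑ i, (b i)⁻¹ * (τ i + x * b i) ^ 2 + (-∑ i, b i) * y ^ 2 = 0 then 1 else 0 : ℤ) else 0)
      = (Fintype.card F - 1) * (if ∑ i, τ i = 0 then 1 else 0)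
        + Fintype.card F * if ∑ i, τ i = 0 ∧ ∑ i, τ i ^ 2 / b i = 0 then 1 else 0 := by
    by_cases hτ : ∑ i, τ i = 0
    · rw [if_pos hτ, sum_sum_ite_inv_mul_add_sq h2 hb hS hτ]
      simp [hτ]
    · simp [hτ]
  simp only [split_count, Finset.sum_add_distrib, ← Finset.mul_sum, sum_ite_sum_eq_zero] at senary
  refine mul_left_cancel₀ (Nat.cast_ne_zero.mpr (Fintype.card_ne_zero (α := F))) ?_
  linear_combination senary

end Quadric

/-! ### Counting points of projective cones -/

section Cone

variable {F : Type*} [Field F]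

lemma card_cone {V : Type*} [AddCommGroup V] [Module F V] (C : V → Prop)
    (hC : ∀ (u : Fˣ) v, C v → C (u • v)) :
    Nat.card {v : V // v ≠ 0 ∧ C v}
      = Nat.card {P : ℙ F V // C P.rep} * (Nat.card F - 1) := by
  rw [← Nat.card_units, ← Nat.card_prod]
  refine (Nat.card_eq_of_bijective (fun x => ⟨x.2 • x.1.1.rep,
    (smul_ne_zero_iff_ne x.2).mpr x.1.1.rep_nonzero, hC _ _ x.1.2⟩) ⟨?_, ?_⟩).symm
  · rintro ⟨⟨P, hP⟩, u⟩ ⟨⟨Q, hQ⟩, w⟩ h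
    have smul_eq : u • P.rep = w • Q.rep := congrArg Subtype.val h
    obtain rfl : P = Q := by
      rw [← P.mk_rep, ← Q.mk_rep, Projectivization.mk_eq_mk_iff]
      exact ⟨u⁻¹ * w, by rw [mul_smul, ← smul_eq, inv_smul_smul]⟩
    obtain rfl : u = w := Units.ext (smul_left_injective F P.rep_nonzero smul_eq)
    rfl
  · rintro ⟨v, hv, hCv⟩
    obtain ⟨u, hu⟩ := Projectivization.exists_smul_eq_mk_rep F v hv
    refine ⟨⟨⟨Projectivization.mk F v hv, hu ▸ hC u v hCv⟩, u⁻¹⟩, Subtype.ext ?_⟩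
    simp only [← hu, inv_smul_smul]

end Cone

/-! ### The fibres of the resolution over the points of the threefold -/

section Fibres

variable {F : Type*} [Field F]

/-- The nodes of the threefold outside the torus. -/
def IsBoundaryNode (a : Fin 6 → F) (q : Equiv.Perm (Fin 5) × (Fin 4 → F)) : Prop :=
  chartParam a q.1 0 + chartParam a q.1 1 * q.2 0 = 0 ∧ q.2 1 = 0 ∧ q.2 2 = 0 ∧ q.2 3 = -1

lemma isBoundaryNode_iff {a : Fin 6 → F} (ha : ∀ i, a i ≠ 0)
    (q : Equiv.Perm (Fin 5) × (Fin 4 → F)) :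
    IsBoundaryNode a q ↔ q.2 1 = 0 ∧ chartParam a q.1 0 + chartParam a q.1 1 * q.2 0 = 0 ∧
      coordSum q.2 = 0 ∧ cofactor (chartParam a q.1) q.2 = 0 := by
  constructor
  · rintro ⟨h0, h1, h2, h3⟩
    have hc : coordSum q.2 = 0 := by simp [coordSum, h1, h2, h3]
    exact ⟨h1, h0, hc, by simp [cofactor, hc, h2]⟩
  · rintro ⟨h1, h0, h2, h3⟩
    have hx : q.2 0 ≠ 0 := fun hx => by
      rw [hx, mul_zero, add_zero] at h0
      exact chartParam_ne_zero ha q.1 0 h0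
    have hzw : q.2 2 * q.2 3 = 0 := by
      rw [cofactor, h2, mul_zero, zero_sub, mul_neg, neg_eq_zero] at h3
      exact (mul_eq_zero.mp ((mul_eq_zero.mp h3).resolve_left hx)).resolve_left
        (chartParam_ne_zero ha q.1 5)
    rw [coordSum, h1, mul_comm (q.2 3) (q.2 2), hzw] at h2
    have hw : q.2 3 = -1 := by linear_combination h2
    exact ⟨h0, h1, by rwa [hw, mul_neg_one, neg_eq_zero] at hzw, hw⟩

section Exc

variable {ι : Type*} [Fintype ι] {b : ι → F}

omit [Fintype ι] in
lemma wedge_zero (b : ι → F) : wedge b 0 = 0 := by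
  ext ij
  simp [wedge]

lemma eq_of_wedge_eq (hS : ∑ i, b i ≠ 0) {τ τ' : ι → F} (hτ : ∑ i, τ i = 0)
    (hτ' : ∑ i, τ' i = 0) (h : wedge b τ = wedge b τ') : τ = τ' := by
  funext i
  have minor (j : ι) : (τ j - τ' j) * b i = (τ i - τ' i) * b j := by
    have hij := congrFun h (j, i)
    simp only [wedge] at hij
    linear_combination hij
  have mul_sum_eq_zero : (τ i - τ' i) * ∑ j, b j = 0 := by
    rw [Finset.mul_sum, ← Finset.sum_congr rfl fun j _ => minor j, ← Finset.sum_mul,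
      Finset.sum_sub_distrib, hτ, hτ', sub_zero, zero_mul]
  exact sub_eq_zero.mp ((mul_eq_zero.mp mul_sum_eq_zero).resolve_right hS)

lemma exists_wedge_eq_of_sum_ne_zero (hS : ∑ i, b i ≠ 0) (τ : ι → F) :
    ∃ τ', wedge b τ' = wedge b τ ∧ ∑ i, τ' i = 0 := by
  refine ⟨fun i => τ i - (∑ j, τ j) / (∑ j, b j) * b i, ?_, ?_⟩
  · ext ij
    simp only [wedge]
    ring
  · rw [Finset.sum_sub_distrib, ← Finset.mul_sum, div_mul_cancel₀ _ hS, sub_self]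

lemma coneForm_wedge_eq_zero_iff (h2 : (2 : F) ≠ 0) (hb : ∀ i, b i ≠ 0) (hS : ∑ i, b i ≠ 0)
    {τ : ι → F} (hτ : ∑ i, τ i = 0) : coneForm b (wedge b τ) = 0 ↔ ∑ i, τ i ^ 2 / b i = 0 := by
  rw [coneForm_wedge hb, hτ, zero_pow two_ne_zero, sub_zero]
  simp [h2, hS]

lemma card_isExc_of_wedge_eq_zero (h2 : (2 : F) ≠ 0) (hb : ∀ i, b i ≠ 0) (hS : ∑ i, b i ≠ 0)
    {x : ι → F} (h : wedge b x = 0) :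
    Nat.card {s : ι × ι → F // s ≠ 0 ∧ IsExc b x s}
      = Nat.card {τ : ι → F // (∑ i, τ i = 0 ∧ ∑ i, τ i ^ 2 / b i = 0) ∧ τ ≠ 0} := by
  have wedge_ne_zero {τ : ι → F} (hτ : ∑ i, τ i = 0) (h0 : τ ≠ 0) : wedge b τ ≠ 0 := fun hw =>
    h0 (eq_of_wedge_eq hS hτ (by simp) (hw.trans (wedge_zero b).symm))
  refine (Nat.card_eq_of_bijective (fun τ => ⟨wedge b τ.1, wedge_ne_zero τ.2.1.1 τ.2.2,
    wedge_ne_zero τ.2.1.1 τ.2.2, Or.inr ⟨h, τ.1, rfl,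
      (coneForm_wedge_eq_zero_iff h2 hb hS τ.2.1.1).mpr τ.2.1.2⟩⟩) ⟨?_, ?_⟩).symm
  · exact fun τ τ' hτ =>
      Subtype.ext (eq_of_wedge_eq hS τ.2.1.1 τ'.2.1.1 (congrArg Subtype.val hτ))
  · rintro ⟨s, hs0, -, ⟨u, rfl⟩ | ⟨-, τ, rfl, hcone⟩⟩
    · exact absurd (by rw [h, smul_zero]) hs0
    · obtain ⟨τ', hw, hsum⟩ := exists_wedge_eq_of_sum_ne_zero hS τ
      refine ⟨⟨τ', ⟨hsum, (coneForm_wedge_eq_zero_iff h2 hb hS hsum).mp (hw ▸ hcone)⟩, ?_⟩,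
        Subtype.ext hw⟩
      rintro rfl
      exact hs0 (hw ▸ wedge_zero b)

end Exc

lemma card_excFibre_of_ne (b : ℙ F (Fin 5 → F)) (q : Equiv.Perm (Fin 5) × (Fin 4 → F))
    (h : wedge b.rep (fun i => ratioPart q.1 q.2 i (q.1 4)) ≠ 0) :
    Nat.card (ExcFibre b q) = 1 := by
  have isExc_wedge : IsExc b.rep (fun i => ratioPart q.1 q.2 i (q.1 4)) (wedge b.rep _) :=
    ⟨h, Or.inl ⟨1, by rw [one_smul]⟩⟩
  have : Unique (ExcFibre b q) :=
    { default := ⟨_, isExc_rep_mk isExc_wedge⟩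
      uniq := fun e => Subtype.ext (by
        obtain ⟨e, he0, ⟨u, hu⟩ | ⟨h0, -⟩⟩ := e
        · exact e.mk_rep.symm.trans
            ((Projectivization.mk_eq_mk_iff' _ _ _ e.rep_nonzero h).mpr ⟨u, hu.symm⟩)
        · exact absurd h0 h) }
  exact Nat.card_unique

section NodePoint

lemma eqVal_chartCoords {a : Fin 6 → F} {b : Fin 5 → F} (hb : IsNodeParam a b)
    (ς : Equiv.Perm (Fin 5)) : eqVal (chartParam a ς) (chartCoords ς b) = 0 := by
  obtain ⟨hb0, c, hc, hca⟩ := hb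
  have param_eq (k : Fin 5) : chartParam a ς k.castSucc = b (ς k) ^ 2 / c := by
    rw [chartParam_castSucc, ← phiVec_castSucc, hca, mul_div_cancel_left₀ _ hc]
  have last_param_eq : chartParam a ς 5 = (∑ k, b (ς k)) ^ 2 / c := by
    rw [chartParam_five, Equiv.sum_comp ς b, ← phiVec_five, hca, mul_div_cancel_left₀ _ hc]
  have h0 := param_eq 0; have h1 := param_eq 1; have h2 := param_eq 2
  have h3 := param_eq 3; have h4 := param_eq 4
  simp only [Fin.castSucc_zero, Fin.castSucc_one, Fin.reduceCastSucc] at h0 h1 h2 h3 h4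
  have := hb0 (ς 0); have := hb0 (ς 1); have := hb0 (ς 2); have := hb0 (ς 3); have := hb0 (ς 4)
  simp only [eqVal, coordSum, h0, h1, h2, h3, h4, last_param_eq, Fin.sum_univ_five, chartCoords,
    Fin.castSucc_zero, Fin.castSucc_one, Fin.reduceCastSucc, Fin.succ_zero_eq_one,
    Fin.succ_one_eq_two, Fin.reduceSucc]
  field_simp
  ring

lemma wedge_eq_zero_iff {b : Fin 5 → F} (hb : ∀ i, b i ≠ 0)
    {q : Equiv.Perm (Fin 5) × (Fin 4 → F)} (hq : Normal q.1 q.2) :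
    wedge b (fun i => ratioPart q.1 q.2 i (q.1 4)) = 0 ↔ q = (1, chartCoords 1 b) := by
  constructor
  · intro h
    obtain ⟨ς, v⟩ := q
    obtain rfl : v = chartCoords ς b := eq_chartCoords_of_wedge_eq_zero hb h
    have level_eq_zero (i : Fin 5) : level ς (chartCoords ς b) i = 0 := by
      simp [level, chartCoords, hb]
    obtain rfl : ς = 1 := (Equiv.Perm.monotone_iff ς).mp <| StrictMono.monotone fun k l hkl =>
      hq k l hkl (by rw [level_eq_zero, level_eq_zero])
    rfl
  · rintro rfl
    exact wedge_chartCoords hb 1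

lemma normal_one (v : Fin 4 → F) : Normal 1 v := fun _ _ hkl _ => hkl

lemma eq_of_chartCoords_eq {b b' : ℙ F (Fin 5 → F)} (hb : ∀ i, b.rep i ≠ 0)
    (hb' : ∀ i, b'.rep i ≠ 0) (h : chartCoords 1 b.rep = chartCoords 1 b'.rep) : b = b' := by
  have ratio_eq (i : Fin 5) : b.rep i / b.rep 4 = b'.rep i / b'.rep 4 :=
    (eval_homCoord_chartCoords hb 1 i).symm.trans (h ▸ eval_homCoord_chartCoords hb' 1 i)
  rw [← b.mk_rep, ← b'.mk_rep, Projectivization.mk_eq_mk_iff']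
  refine ⟨b.rep 4 / b'.rep 4, funext fun i => ?_⟩
  rw [Pi.smul_apply, smul_eq_mul, div_mul_eq_mul_div, mul_div_assoc, ← ratio_eq,
    mul_div_cancel₀ _ (hb 4)]

/-- The node of the threefold at the torus point `b`, as a point of the chart `1`. -/
def nodePoint {a : Fin 6 → F} {b : Fin 5 → F} (hb : IsNodeParam a b) : NormalPoint a :=
  ⟨(1, chartCoords 1 b), eqVal_chartCoords hb 1, normal_one _⟩

end NodePoint

lemma prod_one_add_ite {ι R : Type*} [Fintype ι] [CommSemiring R] {P : ι → Prop}
    [DecidablePred P] (hP : ∀ i j, P i → P j → i = j) (e : ι → R) :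
    ∏ i, (1 + if P i then e i else 0) = 1 + ∑ i, if P i then e i else 0 := by
  by_cases h : ∃ i, P i
  · obtain ⟨i, hi⟩ := h
    have not_of_ne {j : ι} (hj : j ≠ i) : ¬ P j := fun hPj => hj (hP j i hPj hi)
    rw [Fintype.prod_eq_single i fun j hj => by rw [if_neg (not_of_ne hj), add_zero],
      Fintype.sum_eq_single i fun j hj => if_neg (not_of_ne hj)]
  · push Not at h
    simp [h]

variable [Fintype F]

open Classical in
lemma card_dirFibre {a : Fin 6 → F} (ha : ∀ i, a i ≠ 0) (q : NormalPoint a) :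
    (Nat.card (DirFibre a q.1) : ℤ)
      = 1 + Fintype.card F * if IsBoundaryNode a q.1 then 1 else 0 := by
  obtain ⟨q, hF, -⟩ := q
  have hnode := isBoundaryNode_iff ha q
  split_ifs with h
  · obtain ⟨h1, h2, h3, h4⟩ := hnode.mp h
    have isDir_all (d : ℙ F (Fin 2 → F)) : IsDir (chartParam a q.1) q.2 d.rep :=
      ⟨d.rep_nonzero, by rw [h1, h2]; ring, by rw [h3, h4]; ring⟩
    rw [Nat.card_congr (Equiv.subtypeUnivEquiv isDir_all),
      Projectivization.card_of_finrank_two F _ (by simp), Nat.card_eq_fintype_card]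
    push_cast
    ring
  · obtain ⟨d, hd⟩ := exists_isDir hF
    have : Unique (DirFibre a q) :=
      { default := ⟨_, isDir_rep_mk hd⟩
        uniq := fun d' => Subtype.ext (eq_of_rep_cross_eq (d'.2.cross_eq (isDir_rep_mk hd) (by
          by_contra! hc
          exact h (hnode.mpr ⟨hc.1, hc.2.1, hc.2.2.1, hc.2.2.2⟩)))) }
    rw [Nat.card_unique, mul_zero, add_zero, Nat.cast_one]

variable [DecidableEq F]

/-- The number of points that the blow-up of the node `b` of the threefold adds to the one point
`b`: the exceptional quadric has `q² + (1 + χ) q + 1` points, where `χ = ±1` tells whether its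
rulings are defined over the field with `q` elements. -/
def nodeExcess (b : Fin 5 → F) : ℤ :=
  Fintype.card F * (Fintype.card F + 1 + quadraticChar F ((∏ i, b i) * ∑ i, b i))

lemma card_excFibre_of_eq (h2 : (2 : F) ≠ 0) {b : ℙ F (Fin 5 → F)} (hb : ∀ i, b.rep i ≠ 0)
    (hS : ∑ i, b.rep i ≠ 0) (q : Equiv.Perm (Fin 5) × (Fin 4 → F))
    (h : wedge b.rep (fun i => ratioPart q.1 q.2 i (q.1 4)) = 0) :
    (Nat.card (ExcFibre b q) : ℤ) = 1 + nodeExcess b.rep := by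
  have card_cone_eq := card_cone (IsExc b.rep fun i => ratioPart q.1 q.2 i (q.1 4))
    fun u s hs => hs.smul u.ne_zero
  rw [card_isExc_of_wedge_eq_zero h2 hb hS h] at card_cone_eq
  have card_tangent :
      (Nat.card {τ : Fin 5 → F // (∑ i, τ i = 0 ∧ ∑ i, τ i ^ 2 / b.rep i = 0) ∧ τ ≠ 0} : ℤ)
      = (Fintype.card F : ℤ) ^ 3 + quadraticChar F ((∏ i, b.rep i) * ∑ i, b.rep i)
        * (Fintype.card F ^ 2 - Fintype.card F) - 1 := by
    rw [← sum_ite_cone h2 hb hS, Finset.sum_boole, Nat.card_eq_fintype_card, Fintype.card_subtype,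
      ← Finset.filter_filter, Finset.filter_ne', Finset.card_erase_of_mem (by simp),
      Nat.cast_sub (Finset.card_pos.mpr ⟨0, by simp⟩), Nat.cast_one]
  have one_lt_card : 1 < Fintype.card F := Fintype.one_lt_card
  have card_cone_int := congrArg (Nat.cast : ℕ → ℤ) card_cone_eq
  rw [card_tangent, Nat.card_eq_fintype_card (α := F), Nat.cast_mul, Nat.cast_sub one_lt_card.le,
    Nat.cast_one] at card_cone_int
  refine mul_right_cancel₀ (sub_ne_zero.mpr (Nat.cast_ne_one.mpr one_lt_card.ne')) ?_
  rw [nodeExcess]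
  linear_combination -card_cone_int

open Classical in
lemma card_excFibre (h2 : (2 : F) ≠ 0) {a : Fin 6 → F} (ha : a 5 ≠ 0) {b : ℙ F (Fin 5 → F)}
    (hb : IsNodeParam a b.rep) (q : NormalPoint a) :
    (Nat.card (ExcFibre b q.1) : ℤ) = 1 + if q = nodePoint hb then nodeExcess b.rep else 0 := by
  have wedge_iff := wedge_eq_zero_iff hb.1 q.2.2
  simp only [Subtype.ext_iff, nodePoint]
  split_ifs with h
  · exact card_excFibre_of_eq h2 hb.1 (hb.sum_ne_zero ha) q.1 (wedge_iff.mpr h)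
  · rw [card_excFibre_of_ne b q.1 (mt wedge_iff.mp h), add_zero, Nat.cast_one]

open Classical in
lemma card_dirFibre_mul_prod_card_excFibre (h2 : (2 : F) ≠ 0) {a : Fin 6 → F}
    (ha : ∀ i, a i ≠ 0) {B : Set (ℙ F (Fin 5 → F))} [Fintype B]
    (hB : ∀ b ∈ B, IsNodeParam a b.rep) (q : NormalPoint a) :
    (Nat.card (DirFibre a q.1) : ℤ) * ∏ b : B, (Nat.card (ExcFibre b.1 q.1) : ℤ)
      = 1 + Fintype.card F * (if IsBoundaryNode a q.1 then 1 else 0)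
        + ∑ b : B, if q = nodePoint (hB b.1 b.2) then nodeExcess b.1.rep else 0 := by
  have node_unique (b b' : B) (h : q = nodePoint (hB b.1 b.2))
      (h' : q = nodePoint (hB b'.1 b'.2)) : b = b' :=
    Subtype.ext (eq_of_chartCoords_eq (hB b.1 b.2).1 (hB b'.1 b'.2).1
      (congrArg (fun q : NormalPoint a => q.1.2) (h.symm.trans h')))
  simp only [card_dirFibre ha, fun b : B => card_excFibre h2 (ha 5) (hB b.1 b.2) q]
  rw [prod_one_add_ite node_unique]
  split_ifs with hq
  · have not_node (b : B) : q ≠ nodePoint (hB b.1 b.2) := by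
      rintro rfl
      exact div_ne_zero ((hB b.1 b.2).1 _) ((hB b.1 b.2).1 _) hq.2.1
    simp [not_node]
  · ring

open Classical in
lemma card_bigResolution_eq (h2 : (2 : F) ≠ 0) {a : Fin 6 → F} (ha : ∀ i, a i ≠ 0)
    {B : Set (ℙ F (Fin 5 → F))} (hB : ∀ b ∈ B, IsNodeParam a b.rep) :
    (Nat.card (BigResolution F a B) : ℤ) = Nat.card (NormalPoint a)
      + Fintype.card F * Nat.card {q : NormalPoint a // IsBoundaryNode a q.1}
      + ∑ᶠ b ∈ B, nodeExcess b.rep := by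
  have finite_proj (ι : Type) [Finite ι] : Finite (ℙ F (ι → F)) :=
    (Projectivization.finite_iff_of_finite F _).mpr inferInstance
  have := finite_proj (Fin 5); have := finite_proj (Fin 2); have := finite_proj (Fin 5 × Fin 5)
  have : Fintype (NormalPoint a) := Fintype.ofFinite _
  have : Fintype B := Fintype.ofFinite _
  rw [card_bigResolution h2 ha hB, Nat.card_sigma]
  simp only [Nat.card_prod, Nat.card_pi, Nat.cast_sum, Nat.cast_mul, Nat.cast_prod,
    card_dirFibre_mul_prod_card_excFibre h2 ha hB, Finset.sum_add_distrib, ← Finset.mul_sum]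
  rw [Finset.sum_comm, Finset.sum_congr rfl fun b _ => Fintype.sum_ite_eq' _ _,
    finsum_mem_eq_finite_toFinset_sum _ (Set.toFinite B),
    Finset.sum_subtype (p := fun b => b ∈ B) _ (fun b => (Set.toFinite B).mem_toFinset),
    Finset.sum_const, Finset.card_univ, nsmul_eq_mul, mul_one, Finset.sum_boole,
    ← Fintype.card_subtype, Nat.card_eq_fintype_card, Nat.card_eq_fintype_card]

end Fibres

/-! ### Counting the points of the threefold -/

/-- The level of position `k` when `Z` marks the vanishing chart coordinates. -/
def levelOf (Z : Fin 4 → Bool) (k : Fin 5) : ℕ :=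
  (Finset.univ.filter fun m : Fin 4 => m.castSucc < k ∧ Z m = true).card

/-- The combinatorial form of normality: the chart `ς` is the chosen one among those that contain
a given point with vanishing coordinates `Z`. -/
def IsAscending (Z : Fin 4 → Bool) (ς : Equiv.Perm (Fin 5)) : Prop :=
  ∀ k l : Fin 5, k < l → levelOf Z k = levelOf Z l → ς k < ς l

instance (Z : Fin 4 → Bool) : DecidablePred (IsAscending Z) := fun ς => by
  unfold IsAscending; infer_instance

/-- The number of torus orbits of the toric fourfold with the pattern `Z` of vanishing chart
coordinates, one for each flag of subsets of `{1, …, 5}` of the corresponding sizes. -/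
def ascCount (Z : Fin 4 → Bool) : ℕ := (Finset.univ.filter (IsAscending Z)).card

set_option maxRecDepth 100000 in
lemma ascCount_values :
    ascCount ![true, false, false, false] = 5 ∧ ascCount ![false, true, false, false] = 10 ∧
    ascCount ![false, false, true, false] = 10 ∧ ascCount ![false, false, false, true] = 5 ∧
    ascCount ![true, true, false, false] = 20 ∧ ascCount ![true, false, true, false] = 30 ∧
    ascCount ![false, true, true, false] = 30 ∧ ascCount ![false, true, false, true] = 30 ∧
    ascCount ![false, false, true, true] = 20 ∧ ascCount ![true, true, true, false] = 60 ∧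
    ascCount ![false, true, true, true] = 60 := by
  decide +kernel

lemma isAscending_false_iff (ς : Equiv.Perm (Fin 5)) :
    IsAscending ![false, false, false, false] ς ↔ ς = 1 := by
  constructor
  · intro h
    refine (Equiv.Perm.monotone_iff ς).mp <| StrictMono.monotone fun k l hkl => ?_
    have levelOf_eq_zero : ∀ k, levelOf ![false, false, false, false] k = 0 := by decide
    exact h k l hkl (by rw [levelOf_eq_zero, levelOf_eq_zero])
  · rintro rfl k l hkl -
    exact hkl

lemma chartParam_one {F : Type*} (a : Fin 6 → F) : chartParam a 1 = a := by
  funext k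
  refine Fin.lastCases ?_ (fun i => ?_) k
  · exact chartParam_five a 1
  · exact chartParam_castSucc a 1 i

lemma sum_fin_four {α M : Type*} [Fintype α] [AddCommMonoid M] (f : (Fin 4 → α) → M) :
    ∑ v, f v = ∑ x : α, ∑ y : α, ∑ z : α, ∑ w : α, f ![x, y, z, w] := by
  simp only [sum_fin_succ, Fintype.sum_unique]
  rfl

lemma sum_comm_three {α M : Type*} [Fintype α] [AddCommMonoid M] (f : α → α → α → M) :
    ∑ x, ∑ y, ∑ z, f x y z = ∑ z, ∑ y, ∑ x, f x y z := by
  rw [Finset.sum_comm, Finset.sum_congr rfl fun _ _ => Finset.sum_comm, Finset.sum_comm]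

section ZeroPattern

variable {F : Type*} [Field F] [DecidableEq F]

/-- The coordinates of `v` that vanish. -/
def zeroPattern (v : Fin 4 → F) : Fin 4 → Bool := fun m => decide (v m = 0)

lemma zeroPattern_eq_iff (x y z w : F) (Z : Fin 4 → Bool) :
    zeroPattern ![x, y, z, w] = Z ↔
      decide (x = 0) = Z 0 ∧ decide (y = 0) = Z 1 ∧ decide (z = 0) = Z 2 ∧
        decide (w = 0) = Z 3 := by
  constructor
  · rintro rfl
    exact ⟨rfl, rfl, rfl, rfl⟩
  · rintro ⟨h0, h1, h2, h3⟩
    funext m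
    fin_cases m <;> assumption

lemma normal_iff_isAscending (ς : Equiv.Perm (Fin 5)) (v : Fin 4 → F) :
    Normal ς v ↔ IsAscending (zeroPattern v) ς := by
  have level_eq (k : Fin 5) : level ς v (ς k) = levelOf (zeroPattern v) k := by
    simp only [level, levelOf, zeroPattern, Equiv.symm_apply_apply, decide_eq_true_eq]
  simp only [Normal, IsAscending, level_eq]

lemma sum_sum_ite_mul_eq_zero {α β : Type*} [Fintype α] [Fintype β] (s : α → F) (t : β → F) :
    ∑ x, ∑ y, (if s x * t y = 0 then 1 else 0 : ℤ)
      = (∑ x, if s x = 0 then 1 else 0) * Fintype.card β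
        + Fintype.card α * (∑ y, if t y = 0 then 1 else 0)
        - (∑ x, if s x = 0 then 1 else 0) * ∑ y, if t y = 0 then 1 else 0 := by
  have ite_mul_eq_zero (p q : F) : (if p * q = 0 then 1 else 0 : ℤ)
      = (if p = 0 then 1 else 0) + (if q = 0 then 1 else 0)
        - (if p = 0 then 1 else 0) * (if q = 0 then 1 else 0) := by
    by_cases hp : p = 0 <;> by_cases hq : q = 0 <;> simp [hp, hq]
  simp only [ite_mul_eq_zero, Finset.sum_sub_distrib, Finset.sum_add_distrib, Finset.sum_const,
    Finset.card_univ, nsmul_eq_mul, ← Finset.mul_sum, ← Finset.sum_mul]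
  ring

end ZeroPattern

section SumUnits

variable {F : Type*} [Field F] [Fintype F] [DecidableEq F]

lemma sum_eq_zero_add_sum_units {M : Type*} [AddCommMonoid M] (f : F → M) :
    ∑ x, f x = f 0 + ∑ u : Fˣ, f u := by
  rw [Fintype.sum_eq_add_sum_compl 0, ← (unitsEquivNeZero (G₀ := F)).symm.sum_comp,
    Finset.sum_subtype (p := fun x : F => x ≠ 0) _ (by simp)]
  rfl

lemma card_units_eq : ((Fintype.card Fˣ : ℕ) : ℤ) = Fintype.card F - 1 := by
  rw [Fintype.card_units, Nat.cast_sub Fintype.card_pos, Nat.cast_one]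

lemma sum_units_const (t : ℤ) : ∑ _u : Fˣ, t = (Fintype.card F - 1) * t := by
  rw [Finset.sum_const, Finset.card_univ, nsmul_eq_mul, card_units_eq]

lemma sum_units_ite_linear (s : F) {t : F} (ht : t ≠ 0) :
    ∑ z : Fˣ, (if s + t * z = 0 then 1 else 0 : ℤ) = 1 - if s = 0 then 1 else 0 := by
  have root_iff (z : F) : s + t * z = 0 ↔ z = -s / t := by
    rw [eq_div_iff ht]
    constructor <;> intro h <;> linear_combination h
  have sum_eq_one : ∑ z : F, (if s + t * z = 0 then 1 else 0 : ℤ) = 1 := by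
    simp only [root_iff, Finset.sum_ite_eq', Finset.mem_univ, if_true]
  rw [sum_eq_zero_add_sum_units, mul_zero, add_zero] at sum_eq_one
  exact eq_sub_of_add_eq' sum_eq_one

lemma sum_units_ite_one {s t : F} (hs : s ≠ 0) (ht : t ≠ 0) :
    ∑ z : Fˣ, (if s + t * z = 0 then 1 else 0 : ℤ) = 1 := by
  rw [sum_units_ite_linear s ht, if_neg hs, sub_zero]

lemma sum_units_ite_two {s t r : F} (hs : s ≠ 0) (ht : t ≠ 0) (hr : r ≠ 0) :
    ∑ x : Fˣ, ∑ y : Fˣ, (if s + t * x + r * (x * y) = 0 then 1 else 0 : ℤ)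
      = Fintype.card F - 2 := by
  simp only [← mul_assoc r, sum_units_ite_linear _ (mul_ne_zero hr (Units.ne_zero _)),
    Finset.sum_sub_distrib, sum_units_ite_one hs ht, sum_units_const]
  ring

lemma sum_units_ite_three {s t r u : F} (hs : s ≠ 0) (ht : t ≠ 0) (hr : r ≠ 0) (hu : u ≠ 0) :
    ∑ x : Fˣ, ∑ y : Fˣ, ∑ z : Fˣ,
      (if s + t * x + r * (x * y) + u * (x * y * z) = 0 then 1 else 0 : ℤ)
      = (Fintype.card F - 1) ^ 2 - (Fintype.card F - 2) := by
  simp only [← mul_assoc u, sum_units_ite_linear _ (mul_ne_zero (mul_ne_zero hu (Units.ne_zero _))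
    (Units.ne_zero _)), Finset.sum_sub_distrib, sum_units_ite_two hs ht hr, sum_units_const]
  ring

end SumUnits

section Strata

variable {F : Type*} [Field F] [Fintype F] [DecidableEq F]

/-- The number of points of the threefold, in a chart where its equation has the coefficients `c`,
on the torus orbit given by the pattern `Z` of vanishing coordinates. -/
def stratumCount (c : Fin 6 → F) (Z : Fin 4 → Bool) : ℕ :=
  (Finset.univ.filter fun v => zeroPattern v = Z ∧ eqVal c v = 0).card

/-- The sum over the `x` that vanish, or over those that do not. -/
def sumPattern (isZero : Bool) (f : F → ℤ) : ℤ := if isZero then f 0 else ∑ u : Fˣ, f u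

lemma sum_ite_decide_eq (isZero : Bool) (f : F → ℤ) :
    ∑ x, (if decide (x = 0) = isZero then f x else 0) = sumPattern isZero f := by
  cases isZero <;> simp [sum_eq_zero_add_sum_units, sumPattern]

lemma stratumCount_eq_sumPattern (c : Fin 6 → F) (Z : Fin 4 → Bool) :
    (stratumCount c Z : ℤ) = sumPattern (Z 0) fun x => sumPattern (Z 1) fun y =>
      sumPattern (Z 2) fun z => sumPattern (Z 3) fun w =>
        if eqVal c ![x, y, z, w] = 0 then 1 else 0 := by
  rw [stratumCount, ← Finset.sum_boole, sum_fin_four]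
  simp only [zeroPattern_eq_iff, and_assoc, ite_and, Finset.sum_ite_irrel, Finset.sum_const_zero,
    sum_ite_decide_eq]

lemma sum_ite_comp_zeroPattern (c : Fin 6 → F) (g : (Fin 4 → Bool) → ℤ) :
    ∑ v, (if eqVal c v = 0 then g (zeroPattern v) else 0) = ∑ Z, g Z * stratumCount c Z := by
  rw [← Finset.sum_fiberwise Finset.univ zeroPattern]
  refine Finset.sum_congr rfl fun Z _ => ?_
  rw [stratumCount, ← Finset.filter_filter, ← Finset.sum_boole, Finset.mul_sum]
  refine Finset.sum_congr rfl fun v hv => ?_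
  rw [(Finset.mem_filter.mp hv).2, mul_ite, mul_one, mul_zero]

variable {c : Fin 6 → F} (hc : ∀ k, c k ≠ 0)

lemma stratumCount_torus (c : Fin 6 → F) : (stratumCount c ![false, false, false, false] : ℤ) =
    ∑ x : Fˣ, ∑ y : Fˣ, ∑ z : Fˣ, ∑ w : Fˣ, if eqVal c ![(x : F), y, z, w] = 0 then 1 else 0 := by
  rw [stratumCount_eq_sumPattern]
  rfl

include hc

lemma stratumCount_eq_zero {Z : Fin 4 → Bool} (h0 : Z 0 = true) (h3 : Z 3 = true) :
    stratumCount c Z = 0 := by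
  refine Finset.card_eq_zero.mpr (Finset.filter_eq_empty_iff.mpr fun v _ => ?_)
  rintro ⟨rfl, hv⟩
  have hx : v 0 = 0 := of_decide_eq_true h0
  have hw : v 3 = 0 := of_decide_eq_true h3
  simp [eqVal, coordSum, hx, hw, hc 0] at hv

lemma stratumCount_x :
    (stratumCount c ![true, false, false, false] : ℤ)
      = (Fintype.card F - 1) ^ 2 - (Fintype.card F - 2) := by
  have h := sum_units_ite_three (one_ne_zero (α := F)) (one_ne_zero (α := F))
    (one_ne_zero (α := F)) (one_ne_zero (α := F))
  rw [sum_comm_three] at h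
  simpa [stratumCount_eq_sumPattern, sumPattern, eqVal, coordSum, hc 0] using h

lemma stratumCount_w :
    (stratumCount c ![false, false, false, true] : ℤ)
      = (Fintype.card F - 1) ^ 2 - (Fintype.card F - 2) := by
  simpa [stratumCount_eq_sumPattern, sumPattern, eqVal, coordSum]
    using sum_units_ite_three (hc 0) (hc 1) (hc 2) (hc 3)

lemma stratumCount_y :
    (stratumCount c ![false, true, false, false] : ℤ)
      = (Fintype.card F - 1) ^ 2 + (Fintype.card F - 2) ^ 2 := by
  have factors := sum_sum_ite_mul_eq_zero (fun x : Fˣ => c 0 + c 1 * x)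
    fun wz : Fˣ × Fˣ => 1 + 1 * (wz.1 : F) + 1 * (wz.1 * wz.2)
  simp only [Fintype.sum_prod_type, sum_units_ite_one (hc 0) (hc 1), Fintype.card_prod,
    Nat.cast_mul, card_units_eq,
    sum_units_ite_two (one_ne_zero (α := F)) one_ne_zero one_ne_zero] at factors
  rw [Finset.sum_congr rfl fun _ _ => Finset.sum_comm] at factors
  refine Eq.trans ?_ (factors.trans (by ring))
  simp [stratumCount_eq_sumPattern, sumPattern, eqVal, coordSum]

lemma stratumCount_z :
    (stratumCount c ![false, false, true, false] : ℤ)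
      = (Fintype.card F - 1) ^ 2 + (Fintype.card F - 2) ^ 2 := by
  have factors := sum_sum_ite_mul_eq_zero
    (fun xy : Fˣ × Fˣ => c 0 + c 1 * xy.1 + c 2 * (xy.1 * xy.2)) fun w : Fˣ => 1 + 1 * (w : F)
  simp only [Fintype.sum_prod_type, sum_units_ite_one (one_ne_zero (α := F)) one_ne_zero,
    Fintype.card_prod, Nat.cast_mul, card_units_eq, sum_units_ite_two (hc 0) (hc 1) (hc 2)]
    at factors
  refine Eq.trans ?_ (factors.trans (by ring))
  simp [stratumCount_eq_sumPattern, sumPattern, eqVal, coordSum]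

lemma stratumCount_xy :
    (stratumCount c ![true, true, false, false] : ℤ) = Fintype.card F - 2 := by
  have h := sum_units_ite_two (one_ne_zero (α := F)) (one_ne_zero (α := F)) (one_ne_zero (α := F))
  rw [Finset.sum_comm] at h
  simpa [stratumCount_eq_sumPattern, sumPattern, eqVal, coordSum, hc 0] using h

lemma stratumCount_zw :
    (stratumCount c ![false, false, true, true] : ℤ) = Fintype.card F - 2 := by
  simpa [stratumCount_eq_sumPattern, sumPattern, eqVal, coordSum]
    using sum_units_ite_two (hc 0) (hc 1) (hc 2)

lemma stratumCount_xyz : (stratumCount c ![true, true, true, false] : ℤ) = 1 := by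
  simpa [stratumCount_eq_sumPattern, sumPattern, eqVal, coordSum, hc 0]
    using sum_units_ite_one (one_ne_zero (α := F)) (one_ne_zero (α := F))

lemma stratumCount_yzw : (stratumCount c ![false, true, true, true] : ℤ) = 1 := by
  simpa [stratumCount_eq_sumPattern, sumPattern, eqVal, coordSum]
    using sum_units_ite_one (hc 0) (hc 1)

lemma stratumCount_yz :
    (stratumCount c ![false, true, true, false] : ℤ) = 2 * Fintype.card F - 3 := by
  have factors := sum_sum_ite_mul_eq_zero (fun x : Fˣ => c 0 + c 1 * x)
    fun w : Fˣ => 1 + 1 * (w : F)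
  simp only [sum_units_ite_one (one_ne_zero (α := F)) one_ne_zero, card_units_eq,
    sum_units_ite_one (hc 0) (hc 1)] at factors
  refine Eq.trans ?_ (factors.trans (by ring))
  simp [stratumCount_eq_sumPattern, sumPattern, eqVal, coordSum]

lemma stratumCount_xz :
    (stratumCount c ![true, false, true, false] : ℤ) = Fintype.card F - 1 := by
  have h : ∑ _y : Fˣ, ∑ w : Fˣ, (if (1 : F) + 1 * w = 0 then 1 else 0 : ℤ)
      = Fintype.card F - 1 := by
    rw [sum_units_const, sum_units_ite_one one_ne_zero one_ne_zero, mul_one]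
  simpa [stratumCount_eq_sumPattern, sumPattern, eqVal, coordSum, hc 0] using h

lemma stratumCount_yw :
    (stratumCount c ![false, true, false, true] : ℤ) = Fintype.card F - 1 := by
  have h : ∑ _z : Fˣ, ∑ x : Fˣ, (if c 0 + c 1 * x = 0 then 1 else 0 : ℤ)
      = Fintype.card F - 1 := by
    rw [sum_units_const, sum_units_ite_one (hc 0) (hc 1), mul_one]
  rw [Finset.sum_comm] at h
  simpa [stratumCount_eq_sumPattern, sumPattern, eqVal, coordSum] using h

end Strata

section Points

variable {F : Type*} [Field F] [Fintype F] [DecidableEq F]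

lemma card_normalPoint_eq_sum (a : Fin 6 → F) :
    (Nat.card (NormalPoint a) : ℤ) = ∑ ς : Equiv.Perm (Fin 5), ∑ Z : Fin 4 → Bool,
      (if IsAscending Z ς then 1 else 0) * (stratumCount (chartParam a ς) Z : ℤ) := by
  classical
  rw [Nat.card_eq_fintype_card, Fintype.card_subtype, ← Finset.sum_boole, Fintype.sum_prod_type]
  simp only [normal_iff_isAscending, ite_and, ← sum_ite_comp_zeroPattern]

lemma card_normalPoint {a : Fin 6 → F} (ha : ∀ i, a i ≠ 0) :
    (Nat.card (NormalPoint a) : ℤ) = (∑ x : Fˣ, ∑ y : Fˣ, ∑ z : Fˣ, ∑ w : Fˣ,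
          if eqVal a ![(x : F), y, z, w] = 0 then 1 else 0)
      + (50 * (Fintype.card F : ℤ) ^ 2 + 10 * Fintype.card F + 20) := by
  have sum_isAscending_mul (Z : Fin 4 → Bool) (n : ℤ) :
      ∑ ς : Equiv.Perm (Fin 5), (if IsAscending Z ς then 1 else 0) * n = ascCount Z * n := by
    rw [← Finset.sum_mul, Finset.sum_boole, ascCount]
  have sum_torus (n : Equiv.Perm (Fin 5) → ℤ) : ∑ ς : Equiv.Perm (Fin 5),
      (if IsAscending ![false, false, false, false] ς then 1 else 0) * n ς = n 1 := by
    simp [isAscending_false_iff]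
  rw [card_normalPoint_eq_sum, Finset.sum_comm, sum_fin_four]
  simp only [Fintype.sum_bool, sum_torus, stratumCount_torus, chartParam_one]
  have hc (ς : Equiv.Perm (Fin 5)) := chartParam_ne_zero ha ς
  simp only [stratumCount_x (hc _), stratumCount_y (hc _), stratumCount_z (hc _),
    stratumCount_w (hc _), stratumCount_xy (hc _), stratumCount_xz (hc _), stratumCount_yz (hc _),
    stratumCount_yw (hc _), stratumCount_zw (hc _), stratumCount_xyz (hc _),
    stratumCount_yzw (hc _), stratumCount_eq_zero (hc _) (Z := ![true, _, _, true]) rfl rfl,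
    sum_isAscending_mul, ascCount_values, Nat.cast_zero, mul_zero, Finset.sum_const_zero]
  push_cast
  ring

end Points

section BoundaryNodes

variable {F : Type*} [Field F]

/-- The coordinates, in the chart `ς`, of the only node outside the torus on the orbit
`{x ≠ 0, y = z = 0, w ≠ 0}`. -/
def boundaryNodeCoords (a : Fin 6 → F) (ς : Equiv.Perm (Fin 5)) : Fin 4 → F :=
  ![-chartParam a ς 0 / chartParam a ς 1, 0, 0, -1]

variable {a : Fin 6 → F} (ha : ∀ i, a i ≠ 0)

include ha

lemma zeroPattern_boundaryNodeCoords [DecidableEq F] (ς : Equiv.Perm (Fin 5)) :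
    zeroPattern (boundaryNodeCoords a ς) = ![false, true, true, false] := by
  simp [boundaryNodeCoords, zeroPattern_eq_iff, chartParam_ne_zero ha ς]

lemma isBoundaryNode_iff_eq (q : Equiv.Perm (Fin 5) × (Fin 4 → F)) :
    IsBoundaryNode a q ↔ q.2 = boundaryNodeCoords a q.1 := by
  have hx (x : F) : chartParam a q.1 0 + chartParam a q.1 1 * x = 0 ↔
      x = -chartParam a q.1 0 / chartParam a q.1 1 := by
    rw [eq_div_iff (chartParam_ne_zero ha q.1 1)]
    constructor <;> intro h <;> linear_combination h
  simp only [IsBoundaryNode, hx, funext_iff, Fin.forall_fin_succ, boundaryNodeCoords]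
  simp

lemma IsBoundaryNode.eqVal_eq_zero {q : Equiv.Perm (Fin 5) × (Fin 4 → F)}
    (hq : IsBoundaryNode a q) : eqVal (chartParam a q.1) q.2 = 0 := by
  obtain ⟨hy, hx, -, -⟩ := (isBoundaryNode_iff ha q).mp hq
  rw [eqVal_eq_add_mul_cofactor, hy, hx, zero_mul, zero_mul, add_zero]

lemma card_isBoundaryNode :
    Nat.card {q : NormalPoint a // IsBoundaryNode a q.1} = 30 := by
  classical
  have ascCount_eq : ascCount ![false, true, true, false] = 30 := by simp only [ascCount_values]
  rw [← ascCount_eq, ascCount, ← Fintype.card_subtype, ← Nat.card_eq_fintype_card]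
  have isAscending_iff (ς : Equiv.Perm (Fin 5)) :
      IsAscending ![false, true, true, false] ς ↔ Normal ς (boundaryNodeCoords a ς) := by
    rw [normal_iff_isAscending, zeroPattern_boundaryNodeCoords ha]
  simp only [isAscending_iff]
  refine Nat.card_eq_of_bijective (fun q => ⟨q.1.1.1, ?_⟩) ⟨?_, ?_⟩
  · exact (isBoundaryNode_iff_eq ha _).mp q.2 ▸ q.1.2.2
  · rintro ⟨⟨⟨ς, v⟩, _⟩, hq⟩ ⟨⟨⟨ς', v'⟩, _⟩, hq'⟩ hς
    obtain rfl : ς = ς' := congrArg Subtype.val hς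
    obtain rfl : v = v' :=
      ((isBoundaryNode_iff_eq ha _).mp hq).trans ((isBoundaryNode_iff_eq ha _).mp hq').symm
    rfl
  · rintro ⟨ς, hς⟩
    have hq : IsBoundaryNode a (ς, boundaryNodeCoords a ς) := (isBoundaryNode_iff_eq ha _).mpr rfl
    exact ⟨⟨⟨(ς, boundaryNodeCoords a ς), hq.eqVal_eq_zero ha, hς⟩, hq⟩, rfl⟩

end BoundaryNodes

/-! ### The points of the threefold in the torus -/

section Quadratic

variable {F : Type*} [Field F] [Fintype F] [DecidableEq F]

lemma sum_ite_quadratic (h2 : (2 : F) ≠ 0) {α : F} (hα : α ≠ 0) (β γ : F) :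
    ∑ t : F, (if α * t ^ 2 + β * t + γ = 0 then 1 else 0 : ℤ)
      = quadraticChar F (β ^ 2 - 4 * α * γ) + 1 := by
  have h2α : 2 * α ≠ 0 := mul_ne_zero h2 hα
  have complete_square (t : F) :
      α * t ^ 2 + β * t + γ = 0 ↔ (2 * α * t + β) ^ 2 = β ^ 2 - 4 * α * γ := by
    rw [← mul_eq_zero_iff_left (mul_ne_zero h2 h2α), ← sub_eq_zero (a := _ ^ 2)]
    ring_nf
  simp only [complete_square, ← sum_ite_sq_eq h2]
  exact Equiv.sum_comp ((Equiv.mulLeft₀ (2 * α) h2α).trans (Equiv.addRight β))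
    fun u => if u ^ 2 = β ^ 2 - 4 * α * γ then (1 : ℤ) else 0

lemma sum_ite_quadratic_or_linear (h2 : (2 : F) ≠ 0) {c d : F} (hc : c ≠ 0) (A B : F) :
    ∑ t : F, (if B * t ^ 2 + (A * B + c - d) * t + c * A = 0 then 1 else 0 : ℤ)
      = (quadraticChar F ((A * B - c - d) ^ 2 - 4 * c * d) + 1) - (if B = 0 then 1 else 0)
        + if c = d then (Fintype.card F : ℤ) * ((if A = 0 then 1 else 0) * if B = 0 then 1 else 0)
          else 0 := by
  rcases eq_or_ne B 0 with rfl | hB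
  · have discr_eq : (A * 0 - c - d) ^ 2 - 4 * c * d = (c - d) ^ 2 := by ring
    rw [discr_eq]
    rcases eq_or_ne c d with rfl | hcd
    · by_cases hA : A = 0 <;> simp [hA, hc]
    · have hcd' : c - d ≠ 0 := sub_ne_zero.mpr hcd
      have root_iff (t : F) :
          0 * t ^ 2 + (A * 0 + c - d) * t + c * A = 0 ↔ t = -(c * A) / (c - d) := by
        rw [eq_div_iff hcd']
        constructor <;> intro h <;> linear_combination h
      simp only [root_iff, quadraticChar_sq_one' hcd']
      simp [hcd]
  · rw [sum_ite_quadratic h2 hB]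
    simp only [hB, if_false, mul_zero, ite_self, add_zero, sub_zero]
    congr 2
    ring

lemma sum_units_ite_torus (h2 : (2 : F) ≠ 0) {c d : F} (hc : c ≠ 0) (A B : F) :
    ∑ t : Fˣ, (if (A + t) * (c / t + B) = d then 1 else 0 : ℤ)
      = (quadraticChar F ((A * B - c - d) ^ 2 - 4 * c * d) + 1)
        - (if A = 0 then 1 else 0) - (if B = 0 then 1 else 0)
        + if c = d then (Fintype.card F : ℤ) * ((if A = 0 then 1 else 0) * if B = 0 then 1 else 0)
          else 0 := by
  have clear_denominator (t : Fˣ) :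
      (A + t) * (c / t + B) = d ↔ B * (t : F) ^ 2 + (A * B + c - d) * t + c * A = 0 := by
    have := t.ne_zero
    field_simp
    constructor <;> intro h <;> linear_combination h
  have zero_iff : B * (0 : F) ^ 2 + (A * B + c - d) * 0 + c * A = 0 ↔ A = 0 := by simp [hc]
  have count := sum_ite_quadratic_or_linear h2 hc (d := d) A B
  simp only [sum_eq_zero_add_sum_units, zero_iff, ← clear_denominator] at count
  linarith

end Quadratic

section Cubic

variable {F : Type*} [Field F] {a b c t : F}

/-- The equation of the plane cubic `ellipticCurve a b c t`, as a function on affine `3`-space. -/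
def cubicForm (a b c t x y z : F) : F :=
  (x + y + z) * (a * (x * y) + b * (y * z) + c * (z * x)) - t * (x * y * z)

lemma cubicForm_mul (a b c t s x y z : F) :
    cubicForm a b c t (s * x) (s * y) (s * z) = s ^ 3 * cubicForm a b c t x y z := by
  simp only [cubicForm]
  ring

variable [Fintype F] [DecidableEq F]

lemma card_ellipticCurve_mul (a b c t : F) :
    (Nat.card (ellipticCurve a b c t) : ℤ) * (Fintype.card F - 1)
      = ∑ x : F, ∑ y : F, ∑ z : F, (if cubicForm a b c t x y z = 0 then 1 else 0) - 1 := by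
  have affine_cone := card_cone (F := F) (fun v : Fin 3 → F =>
      cubicForm a b c t (v 0) (v 1) (v 2) = 0) fun u v hv => by
    simp only [Pi.smul_apply, Units.smul_def, smul_eq_mul, cubicForm_mul, hv, mul_zero]
  have curve_eq : ellipticCurve a b c t
      = {P | cubicForm a b c t (P.rep 0) (P.rep 1) (P.rep 2) = 0} := by
    simp only [ellipticCurve, cubicForm, sub_eq_zero]
  have sum_eq : ∑ x : F, ∑ y : F, ∑ z : F, (if cubicForm a b c t x y z = 0 then 1 else 0 : ℤ)
      = ∑ v : Fin 3 → F, if cubicForm a b c t (v 0) (v 1) (v 2) = 0 then 1 else 0 := by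
    simp only [sum_fin_succ, Fintype.sum_unique]
    rfl
  have zero_mem : (0 : Fin 3 → F) ∈ Finset.univ.filter fun v : Fin 3 → F =>
      cubicForm a b c t (v 0) (v 1) (v 2) = 0 :=
    Finset.mem_filter.mpr ⟨Finset.mem_univ _, by simp [cubicForm]⟩
  have card_punctured : (Nat.card {v : Fin 3 → F // v ≠ 0 ∧
      cubicForm a b c t (v 0) (v 1) (v 2) = 0} : ℤ)
      = ∑ x : F, ∑ y : F, ∑ z : F, (if cubicForm a b c t x y z = 0 then 1 else 0) - 1 := by
    rw [sum_eq, Finset.sum_boole, Nat.card_eq_fintype_card, Fintype.card_subtype]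
    simp only [and_comm (a := _ ≠ _)]
    rw [← Finset.filter_filter, Finset.filter_ne', Finset.card_erase_of_mem zero_mem,
      Nat.cast_sub (Finset.card_pos.mpr ⟨0, zero_mem⟩), Nat.cast_one]
  rw [← card_punctured, affine_cone, curve_eq, Nat.cast_mul, Nat.card_eq_fintype_card (α := F),
    Nat.cast_sub Fintype.card_pos, Nat.cast_one]
  rfl

lemma sum_cubicForm (ha : a ≠ 0) (hb : b ≠ 0) (hc : c ≠ 0) :
    ∑ x : F, ∑ y : F, ∑ z : F, (if cubicForm a b c t x y z = 0 then 1 else 0 : ℤ)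
      = ∑ x : Fˣ, ∑ y : Fˣ, ∑ z : Fˣ, (if cubicForm a b c t x y z = 0 then 1 else 0)
        + 6 * (Fintype.card F - 1) + 1 := by
  have x_zero (y z : Fˣ) : cubicForm a b c t 0 y z = 0 ↔ (y + 1 * z : F) = 0 := by
    simp [cubicForm, hb]
  have y_zero (x z : Fˣ) : cubicForm a b c t x 0 z = 0 ↔ (x + 1 * z : F) = 0 := by
    simp [cubicForm, hc]
  have z_zero (x y : Fˣ) : cubicForm a b c t x y 0 = 0 ↔ (x + 1 * y : F) = 0 := by
    simp [cubicForm, ha]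
  have x_axis (x : F) : cubicForm a b c t x 0 0 = 0 := by simp [cubicForm]
  have y_axis (y : F) : cubicForm a b c t 0 y 0 = 0 := by simp [cubicForm]
  have z_axis (z : F) : cubicForm a b c t 0 0 z = 0 := by simp [cubicForm]
  have line (y : Fˣ) : ∑ z : Fˣ, (if (y + 1 * z : F) = 0 then 1 else 0 : ℤ) = 1 :=
    sum_units_ite_one y.ne_zero one_ne_zero
  simp only [sum_eq_zero_add_sum_units, Finset.sum_add_distrib, x_zero, y_zero, z_zero, x_axis,
    y_axis, z_axis, if_true, line, sum_units_const]
  ring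

lemma sum_units_cubicForm :
    ∑ x : Fˣ, ∑ y : Fˣ, ∑ z : Fˣ, (if cubicForm a b c t x y z = 0 then 1 else 0 : ℤ)
      = (Fintype.card F - 1)
        * ∑ x : Fˣ, ∑ y : Fˣ, if cubicForm a b c t y 1 x = 0 then 1 else 0 := by
  rw [← sum_units_const, Finset.sum_comm]
  refine Finset.sum_congr rfl fun s _ => ?_
  rw [Finset.sum_comm, ← Equiv.sum_comp (Equiv.mulLeft s)]
  refine Finset.sum_congr rfl fun x _ => ?_
  rw [← Equiv.sum_comp (Equiv.mulLeft s)]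
  refine Finset.sum_congr rfl fun y _ => if_congr ?_ rfl rfl
  have scaled := cubicForm_mul a b c t s y 1 x
  rw [mul_one] at scaled
  simp only [Equiv.coe_mulLeft, Units.val_mul, scaled, mul_eq_zero, pow_eq_zero_iff three_ne_zero,
    Units.ne_zero, false_or]

lemma sum_units_ite_mul_ite (ht : t ≠ 0) (x y : Fˣ) :
    (∑ z : Fˣ, (if (1 + x + y + z : F) = 0 then 1 else 0)
      * if (a / x + b / y + t / z + c : F) = 0 then 1 else 0 : ℤ)
      = if cubicForm a b c t y 1 x = 0 then 1 else 0 := by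
  have hx := x.ne_zero
  have hy := y.ne_zero
  rcases eq_or_ne (1 + x + y : F) 0 with h0 | h0
  · have no_solution (z : Fˣ) : (1 + x + y + z : F) ≠ 0 := by
      rw [h0, zero_add]
      exact z.ne_zero
    have cubicForm_eq : cubicForm a b c t (y : F) 1 x = -(t * (y * x)) := by
      rw [cubicForm]
      linear_combination (a * y + b * x + c * (x * y)) * h0
    simp [no_solution, cubicForm_eq, ht]
  · set z₀ : Fˣ := Units.mk0 (-(1 + x + y : F)) (neg_ne_zero.mpr h0)
    have hz : (z₀ : F) = -(1 + x + y) := rfl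
    have solution_iff (z : Fˣ) : (1 + x + y + z : F) = 0 ↔ z = z₀ := by
      rw [Units.ext_iff, hz, eq_neg_iff_add_eq_zero, add_comm]
    have cubicForm_eq : cubicForm a b c t (y : F) 1 x
        = (x * y * (1 + x + y)) * (a / x + b / y + t / z₀ + c) := by
      rw [hz, cubicForm]
      field_simp
      ring
    simp only [solution_iff, ite_mul, one_mul, zero_mul, Finset.sum_ite_eq', Finset.mem_univ,
      if_true]
    simp [cubicForm_eq, h0]

lemma card_ellipticCurve (ht : t ≠ 0) (ha : a ≠ 0) (hb : b ≠ 0) (hc : c ≠ 0) :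
    (Nat.card (ellipticCurve a b c t) : ℤ) - 6 = ∑ x : Fˣ, ∑ y : Fˣ, ∑ z : Fˣ,
      (if (1 + x + y + z : F) = 0 then 1 else 0)
        * if (a / x + b / y + t / z + c : F) = 0 then 1 else 0 := by
  have hq : (Fintype.card F : ℤ) - 1 ≠ 0 :=
    sub_ne_zero.mpr (by exact_mod_cast (Fintype.one_lt_card (α := F)).ne')
  have projective_count := card_ellipticCurve_mul a b c t
  rw [sum_cubicForm ha hb hc, sum_units_cubicForm] at projective_count
  simp only [sum_units_ite_mul_ite ht]
  refine mul_left_cancel₀ hq ?_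
  linear_combination projective_count

end Cubic

section Torus

variable {F : Type*} [Field F] [Fintype F] [DecidableEq F]

/-- Replacing the coordinates `X₁ / X₂, X₂ / X₃, X₃ / X₄, X₄ / X₅` by `X₂ / X₅, X₃ / X₅, X₄ / X₅`
and `t = X₁ / X₅` makes the equation quadratic in the last variable. -/
lemma sum_torus_param (a : Fin 6 → F) :
    (∑ x : Fˣ, ∑ y : Fˣ, ∑ z : Fˣ, ∑ w : Fˣ, if eqVal a ![(x : F), y, z, w] = 0 then 1 else 0 : ℤ)
      = ∑ x : Fˣ, ∑ y : Fˣ, ∑ z : Fˣ, ∑ t : Fˣ,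
        if ((1 + x + y + z : F) + t) * (a 0 / t + (a 1 / x + a 2 / y + a 3 / z + a 4)) = a 5 then 1
          else 0 := by
  simp only [← Fintype.sum_prod_type']
  let toAffine : Fˣ × Fˣ × Fˣ × Fˣ ≃ Fˣ × Fˣ × Fˣ × Fˣ :=
    { toFun := fun u => (u.2.1 * u.2.2.1 * u.2.2.2, u.2.2.1 * u.2.2.2, u.2.2.2,
        u.1 * u.2.1 * u.2.2.1 * u.2.2.2)
      invFun := fun u => (u.2.2.2 / u.1, u.1 / u.2.1, u.2.1 / u.2.2.1, u.2.2.1)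
      left_inv := fun u => by ext <;> simp
      right_inv := fun u => by ext <;> simp }
  refine Fintype.sum_equiv toAffine _ _ fun u => if_congr ?_ rfl rfl
  obtain ⟨x, y, z, w⟩ := u
  have := x.ne_zero; have := y.ne_zero; have := z.ne_zero; have := w.ne_zero
  simp only [toAffine, Equiv.coe_fn_mk, Units.val_mul, eqVal, coordSum, Matrix.cons_val_zero,
    Matrix.cons_val_one, Matrix.cons_val]
  field_simp
  constructor <;> intro h <;> linear_combination h

lemma sum_units_ite_plane {s t r u : F} (hs : s ≠ 0) (ht : t ≠ 0) (hr : r ≠ 0) (hu : u ≠ 0) :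
    ∑ x : Fˣ, ∑ y : Fˣ, ∑ z : Fˣ, (if s + t * x + r * y + u * z = 0 then 1 else 0 : ℤ)
      = (Fintype.card F - 1) ^ 2 - (Fintype.card F - 2) := by
  rw [← sum_units_ite_three hs ht hr hu]
  refine Finset.sum_congr rfl fun x _ => ?_
  rw [← Equiv.sum_comp (Equiv.mulLeft x)]
  refine Finset.sum_congr rfl fun y _ => ?_
  rw [← Equiv.sum_comp (Equiv.mulLeft (x * y))]
  simp [mul_assoc]

lemma sum_units_ite_polar {s t r u : F} (hs : s ≠ 0) (ht : t ≠ 0) (hr : r ≠ 0) (hu : u ≠ 0) :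
    ∑ x : Fˣ, ∑ y : Fˣ, ∑ z : Fˣ, (if s / x + t / y + r / z + u = 0 then 1 else 0 : ℤ)
      = (Fintype.card F - 1) ^ 2 - (Fintype.card F - 2) := by
  rw [← sum_units_ite_plane hu hs ht hr, ← Equiv.sum_comp (Equiv.inv Fˣ)]
  refine Finset.sum_congr rfl fun x _ => ?_
  rw [← Equiv.sum_comp (Equiv.inv Fˣ)]
  refine Finset.sum_congr rfl fun y _ => ?_
  rw [← Equiv.sum_comp (Equiv.inv Fˣ)]
  refine Finset.sum_congr rfl fun z _ => if_congr ?_ rfl rfl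
  simp only [Equiv.inv_apply, Units.val_inv_eq_inv_val, div_inv_eq_mul]
  constructor <;> intro h <;> linear_combination h

lemma sum_torus (h2 : (2 : F) ≠ 0) {a : Fin 6 → F} (ha : ∀ i, a i ≠ 0) :
    (∑ x : Fˣ, ∑ y : Fˣ, ∑ z : Fˣ, ∑ w : Fˣ, if eqVal a ![(x : F), y, z, w] = 0 then 1 else 0 : ℤ)
      = (∑ x : Fˣ, ∑ y : Fˣ, ∑ z : Fˣ, (quadraticChar F (discr a x y z) + 1))
        - 2 * ((Fintype.card F - 1) ^ 2 - (Fintype.card F - 2))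
        + if a 0 = a 5 then
            (Fintype.card F : ℤ) * (Nat.card (ellipticCurve (a 1) (a 2) (a 4) (a 3)) - 6)
          else 0 := by
  have plane : ∑ x : Fˣ, ∑ y : Fˣ, ∑ z : Fˣ, (if (1 + x + y + z : F) = 0 then 1 else 0 : ℤ)
      = (Fintype.card F - 1) ^ 2 - (Fintype.card F - 2) := by
    simpa only [one_mul] using sum_units_ite_plane (one_ne_zero (α := F)) (one_ne_zero (α := F))
      (one_ne_zero (α := F)) (one_ne_zero (α := F))
  rw [sum_torus_param, card_ellipticCurve (ha 3) (ha 1) (ha 2) (ha 4)]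
  simp only [sum_units_ite_torus h2 (ha 0), Finset.sum_add_distrib, Finset.sum_sub_distrib, plane,
    sum_units_ite_polar (ha 1) (ha 2) (ha 3) (ha 4), discr]
  split_ifs
  · simp only [← Finset.mul_sum]
    ring
  · simp only [Finset.sum_const_zero]
    ring

end Torus

/-! ### Singular points in the torus -/

section Singular

variable {K : Type*} [Field K]

/-- The value at `b` of the logarithmic derivative `X_i ∂/∂X_i` of the function
`(∑ X_j) (∑ a_j / X_j)` on the torus. -/
def logGradient (a : Fin 6 → K) (b : Fin 5 → K) (i : Fin 5) : K :=
  b i * ∑ j, a j.castSucc / b j - a i.castSucc / b i * ∑ j, b j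

lemma sum_logGradient (a : Fin 6 → K) (b : Fin 5 → K) : ∑ i, logGradient a b i = 0 := by
  simp only [logGradient, Finset.sum_sub_distrib, ← Finset.sum_mul]
  ring

lemma eqVal_chartCoords_one (a : Fin 6 → K) {b : Fin 5 → K} (hb : ∀ i, b i ≠ 0) :
    eqVal a (chartCoords 1 b)
      = b 0 / b 4 * ((∑ i, b i) * ∑ i, a i.castSucc / b i - a 5) := by
  have := hb 0; have := hb 1; have := hb 2; have := hb 3; have := hb 4
  simp only [eqVal, coordSum, chartCoords, Fin.isValue, Fin.castSucc_zero, Fin.castSucc_one,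
    Fin.succ_zero_eq_one, Fin.succ_one_eq_two, Fin.reduceCastSucc, Fin.reduceSucc,
    Equiv.Perm.coe_one, id_eq, Fin.sum_univ_five]
  field_simp
  ring

/-- Scaling the `k`-th chart coordinate amounts to scaling the homogeneous coordinates up to the
`k`-th, so that its logarithmic derivative is a sum of those of the homogeneous coordinates. -/
lemma mul_eval_pderiv_localEq_one (a : Fin 6 → K) {b : Fin 5 → K} (hb : ∀ i, b i ≠ 0) (k : Fin 4) :
    chartCoords 1 b k * eval (chartCoords 1 b) (pderiv k (localEq a 1))
      = eqVal a (chartCoords 1 b) + b 0 / b 4 * ∑ i with i ≤ k.castSucc, logGradient a b i := by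
  have := hb 0; have := hb 1; have := hb 2; have := hb 3; have := hb 4
  rw [eqVal_chartCoords_one a hb]
  fin_cases k <;>
    simp [localEq, chartCoords, Derivation.leibniz, pderiv_X, logGradient, Finset.sum_filter,
      Fin.sum_univ_five] <;>
    field_simp <;> ring

lemma isSingularAt_chartCoords_one_iff {a : Fin 6 → K} {b : Fin 5 → K} (hb : ∀ i, b i ≠ 0) :
    IsSingularAt (localEq a 1) (chartCoords 1 b) ↔
      (∑ i, b i) * ∑ i, a i.castSucc / b i = a 5 ∧ ∀ i, logGradient a b i = 0 := by
  have ratio_ne_zero (i j : Fin 5) : b i / b j ≠ 0 := div_ne_zero (hb i) (hb j)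
  have eqVal_eq_zero_iff : eqVal a (chartCoords 1 b) = 0 ↔
      (∑ i, b i) * ∑ i, a i.castSucc / b i = a 5 := by
    rw [eqVal_chartCoords_one a hb, mul_eq_zero_iff_left (ratio_ne_zero 0 4), sub_eq_zero]
  rw [IsSingularAt, eval_localEq, chartParam_one, eqVal_eq_zero_iff]
  refine and_congr_right fun h => ?_
  have pderiv_eq_zero_iff (k : Fin 4) : eval (chartCoords 1 b) (pderiv k (localEq a 1)) = 0 ↔
      ∑ i with i ≤ k.castSucc, logGradient a b i = 0 := by
    have expansion := mul_eval_pderiv_localEq_one a hb k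
    rw [eqVal_eq_zero_iff.mpr h, zero_add] at expansion
    rw [← mul_eq_zero_iff_left (show chartCoords 1 b k ≠ 0 from ratio_ne_zero k.castSucc k.succ),
      expansion, mul_eq_zero_iff_left (ratio_ne_zero 0 4)]
  simp only [pderiv_eq_zero_iff]
  refine ⟨fun partial_sum_eq_zero i => ?_, fun h k => Finset.sum_eq_zero fun i _ => h i⟩
  have total := sum_logGradient a b
  rw [Fin.sum_univ_five] at total
  have partial_sums : logGradient a b 0 = 0 ∧ logGradient a b 0 + logGradient a b 1 = 0 ∧
      logGradient a b 0 + logGradient a b 1 + logGradient a b 2 = 0 ∧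
      logGradient a b 0 + logGradient a b 1 + logGradient a b 2 + logGradient a b 3 = 0 := by
    simpa [Fin.forall_fin_succ, Finset.sum_filter, Fin.sum_univ_five] using partial_sum_eq_zero
  fin_cases i <;> grind

lemma isNodeParam_of_isSingularAt {a : Fin 6 → K} (ha : a 5 ≠ 0) {b : Fin 5 → K}
    (hb : ∀ i, b i ≠ 0) (h : IsSingularAt (localEq a 1) (chartCoords 1 b)) : IsNodeParam a b := by
  obtain ⟨on_threefold, gradient_eq_zero⟩ := (isSingularAt_chartCoords_one_iff hb).mp h
  have product_ne_zero := on_threefold.trans_ne ha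
  have hm : ∑ i, b i ≠ 0 := left_ne_zero_of_mul product_ne_zero
  have hl : ∑ i, a i.castSucc / b i ≠ 0 := right_ne_zero_of_mul product_ne_zero
  refine ⟨hb, (∑ i, b i) / ∑ i, a i.castSucc / b i, div_ne_zero hm hl, fun i => ?_⟩
  rw [div_mul_eq_mul_div, eq_div_iff hl]
  refine Fin.lastCases ?_ (fun i => ?_) i
  · change phiVec b 5 * _ = _ * a 5
    rw [phiVec_five, ← on_threefold]
    ring
  · rw [phiVec_castSucc, pow_two, mul_assoc, sub_eq_zero.mp (gradient_eq_zero i), ← mul_assoc,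
      mul_div_cancel₀ _ (hb i), mul_comm]

lemma IsNodeParam.isSingularAt {a : Fin 6 → K} {b : Fin 5 → K} (h : IsNodeParam a b) :
    IsSingularAt (localEq a 1) (chartCoords 1 b) := by
  obtain ⟨hb, c, hc, hca⟩ := h
  have quotient_eq (i : Fin 5) : a i.castSucc / b i = b i / c := by
    rw [div_eq_div_iff (hb i) hc, mul_comm, ← hca, phiVec_castSucc, pow_two]
  rw [isSingularAt_chartCoords_one_iff hb]
  simp only [logGradient, quotient_eq, ← Finset.sum_div]
  refine ⟨?_, fun i => by ring⟩
  rw [← mul_div_assoc, div_eq_iff hc, mul_comm (a 5), ← hca, phiVec_five, pow_two]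

lemma isNodeParam_iff {a : Fin 6 → K} (ha : ∀ i, a i ≠ 0) (b : Fin 5 → K) :
    IsNodeParam a b ↔ b ≠ 0 ∧ ∀ i j, phiVec b i * a j = phiVec b j * a i := by
  constructor
  · rintro ⟨hb, c, -, hca⟩
    refine ⟨fun h => hb 0 (by rw [h]; rfl), fun i j => ?_⟩
    rw [hca, hca]
    ring
  · rintro ⟨h0, h⟩
    obtain ⟨j, hj⟩ := Function.ne_iff.mp h0
    have hj' : phiVec b j.castSucc ≠ 0 := by
      rw [phiVec_castSucc]
      exact pow_ne_zero 2 hj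
    have hb (i : Fin 5) : b i ≠ 0 := fun hi => by
      have proportional := h i.castSucc j.castSucc
      rw [phiVec_castSucc, hi, zero_pow two_ne_zero, zero_mul] at proportional
      exact mul_ne_zero hj' (ha _) proportional.symm
    refine ⟨hb, phiVec b j.castSucc / a j.castSucc, div_ne_zero hj' (ha _), fun i => ?_⟩
    rw [div_mul_eq_mul_div, eq_div_iff (ha _)]
    exact h i _

lemma phiVec_map {R : Type*} [CommRing R] (f : R →+* K) (b : Fin 5 → R) (i : Fin 6) :
    phiVec (fun i => f (b i)) i
      = f ((Fin.snoc (fun i => b i ^ 2) ((∑ i, b i) ^ 2) : Fin 6 → R) i) := by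
  refine Fin.lastCases ?_ (fun i => ?_) i
  · simp only [phiVec, Fin.snoc_last, map_pow, map_sum]
  · simp only [phiVec, Fin.snoc_castSucc, map_pow]

/-- The condition `φ(b) = a` consists of polynomial relations, which the injection `f` reflects to
`R` and `g` preserves. -/
lemma IsNodeParam.of_map {R : Type*} [CommRing R] {L : Type*} [Field L] {f : R →+* K}
    (hf : Function.Injective f) (g : R →+* L) {a : Fin 6 → R} (ha : ∀ i, g (a i) ≠ 0)
    {b : Fin 5 → R} (hb : (fun i => g (b i)) ≠ 0)
    (h : IsNodeParam (fun i => f (a i)) fun i => f (b i)) :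
    IsNodeParam (fun i => g (a i)) fun i => g (b i) := by
  have hfa (i) : f (a i) ≠ 0 := fun h0 => ha i <| by
    rw [(map_eq_zero_iff f hf).mp h0, map_zero]
  refine (isNodeParam_iff ha _).mpr ⟨hb, fun i j => ?_⟩
  have relation := ((isNodeParam_iff hfa _).mp h).2 i j
  rw [phiVec_map, phiVec_map, ← map_mul, ← map_mul] at relation
  rw [phiVec_map, phiVec_map, ← map_mul, ← map_mul, hf relation]

lemma IsNodeParam.smul {a : Fin 6 → K} {b : Fin 5 → K} (h : IsNodeParam a b) {u : K}
    (hu : u ≠ 0) : IsNodeParam a (u • b) := by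
  obtain ⟨hb, c, hc, hca⟩ := h
  refine ⟨fun i => mul_ne_zero hu (hb i), u ^ 2 * c, mul_ne_zero (pow_ne_zero 2 hu) hc,
    fun i => ?_⟩
  rw [mul_assoc, ← hca]
  refine Fin.lastCases ?_ (fun i => ?_) i
  · simp only [phiVec, Fin.snoc_last, Pi.smul_apply, smul_eq_mul, ← Finset.mul_sum, mul_pow]
  · simp only [phiVec, Fin.snoc_castSucc, Pi.smul_apply, smul_eq_mul, mul_pow]

lemma isNodeParam_rep_mk {a : Fin 6 → K} {b : Fin 5 → K} (h : IsNodeParam a b) (h0 : b ≠ 0) :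
    IsNodeParam a (Projectivization.mk K b h0).rep := by
  obtain ⟨u, hu⟩ := Projectivization.exists_smul_eq_mk_rep K b h0
  rw [← hu]
  exact h.smul u.ne_zero

lemma chartCoords_smul (ς : Equiv.Perm (Fin 5)) (b : Fin 5 → K) {u : K} (hu : u ≠ 0) :
    chartCoords ς (u • b) = chartCoords ς b :=
  funext fun _ => mul_div_mul_left _ _ hu

lemma finite_isNodeParam {a : Fin 6 → K} (ha : ∀ i, a i ≠ 0) :
    {b : ℙ K (Fin 5 → K) | IsNodeParam a b.rep}.Finite := by
  have finite_square_roots (c : K) : {x : K | x ^ 2 = c}.Finite := by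
    classical
    refine ((Polynomial.nthRoots 2 c).toFinset.finite_toSet).subset fun x hx => ?_
    simpa [Polynomial.mem_nthRoots] using hx
  refine Set.Finite.of_finite_image (f := fun b => chartCoords 1 b.rep)
    ((Set.Finite.pi fun k : Fin 4 =>
      finite_square_roots (a k.castSucc.castSucc / a k.succ.castSucc)).subset ?_)
    fun b hb b' hb' h => eq_of_chartCoords_eq hb.1 hb'.1 h
  rintro _ ⟨b, hb, rfl⟩ k -
  have proportional := ((isNodeParam_iff ha _).mp hb).2 k.castSucc.castSucc k.succ.castSucc
  rw [phiVec_castSucc, phiVec_castSucc] at proportional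
  change (b.rep k.castSucc / b.rep k.succ) ^ 2 = _
  rw [div_pow, div_eq_div_iff (pow_ne_zero 2 (hb.1 _)) (ha _), proportional, mul_comm]

end Singular

/-! ### Tangent vectors at a singular point outside the centres -/

section Tangent

variable {K : Type*} [Field K]

/-- The differential of the polynomial `q` at the point `v`, evaluated at the tangent vector `t`. -/
noncomputable def differential {n : ℕ} (v t : Fin n → K) (q : MvPolynomial (Fin n) K) : K :=
  ∑ k, t k * eval v (pderiv k q)

lemma aeval_dualNumber {n : ℕ} (v t : Fin n → K) (q : MvPolynomial (Fin n) K) :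
    aeval (fun k => (TrivSqZeroExt.inl (v k) + TrivSqZeroExt.inr (t k) : DualNumber K)) q
      = TrivSqZeroExt.inl (eval v q) + TrivSqZeroExt.inr (differential v t q) := by
  induction q using MvPolynomial.induction_on with
  | C r => simp [differential, TrivSqZeroExt.algebraMap_eq_inl]
  | add q r hq hr =>
    simp only [differential, map_add, hq, hr, mul_add, Finset.sum_add_distrib,
      TrivSqZeroExt.inl_add, TrivSqZeroExt.inr_add]
    abel
  | mul_X q i hq =>
    have leibniz : differential v t (q * X i)
        = eval v q * t i + v i * differential v t q := by
      simp only [differential, Derivation.leibniz, pderiv_X, Pi.single_apply, smul_eq_mul, map_add,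
        map_mul, eval_X, mul_add, Finset.sum_add_distrib, Finset.mul_sum]
      simp [mul_left_comm, mul_comm]
    rw [map_mul, hq, aeval_X, leibniz]
    ext
    · simp
    · simp [mul_comm, add_comm]

lemma isBlowUpPoint_dualNumber {n : ℕ} {ι : Type*} {F : MvPolynomial (Fin n) K}
    {f : ι → MvPolynomial (Fin n) K} {v : Fin n → K} (hF : IsSingularAt F v) {s : ι → K}
    (hs : s ≠ 0) {u : K} (hu : ∀ i, s i = u * eval v (f i)) (t : Fin n → K) (c : K) :
    IsBlowUpPoint F f (fun k => (TrivSqZeroExt.inl (v k) + TrivSqZeroExt.inr (t k) : DualNumber K))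
      (fun i => (TrivSqZeroExt.inl (s i)
        + TrivSqZeroExt.inr (u * differential v t (f i) + c * eval v (f i)) : DualNumber K)) := by
  obtain ⟨i, hi⟩ := Function.ne_iff.mp hs
  refine isBlowUpPoint_of_eq_mul ?_ (TrivSqZeroExt.inl u + TrivSqZeroExt.inr c) (fun i => ?_)
    ⟨i, ?_⟩
  · rw [aeval_dualNumber, hF.1, differential]
    simp [hF.2]
  · rw [aeval_dualNumber, hu]
    ext
    · simp
    · simp [mul_comm]
  · rw [TrivSqZeroExt.isUnit_iff_isUnit_fst]
    simpa using hi

variable {a : Fin 6 → K} {B : Set (ℙ K (Fin 5 → K))}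

/-- The tangent vectors of the blow-up at a point `P` over a singular point of the threefold outside
the centres: a tangent vector of the chart, which is arbitrary by singularity, lifts uniquely up to
rescaling the homogeneous coordinates in each fibre. The scalars `u` and `w` relate the generators
of the centres at `P` to the homogeneous coordinates of `P`. -/
noncomputable def tangentLift (P : ChartPoint K a B) (u : K) (w : B → K) :
    ((Fin 4 → K) × K × (B → K)) →ₗ[K] (Fin 4 → K) × (Fin 2 → K) × (B → Fin 5 × Fin 5 → K) where
  toFun x := (x.1,
    fun i => u * differential P.pt x.1 (surfaceGens a P.chart i)
      + x.2.1 * eval P.pt (surfaceGens a P.chart i),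
    fun b ij => w b * differential P.pt x.1 (pointGens b.1.rep P.chart ij)
      + x.2.2 b * eval P.pt (pointGens b.1.rep P.chart ij))
  map_add' x y := by
    ext <;> simp [differential, add_mul, Finset.sum_add_distrib, mul_add] <;> ring
  map_smul' r x := by
    ext <;> simp [differential, mul_add, Finset.mul_sum, mul_assoc, mul_left_comm]

lemma tangentLift_injective (P : ChartPoint K a B)
    (hdir : (fun i => eval P.pt (surfaceGens a P.chart i)) ≠ 0)
    (hexc : ∀ b : B, (fun ij => eval P.pt (pointGens b.1.rep P.chart ij)) ≠ 0) (u : K) (w : B → K) :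
    Function.Injective (tangentLift P u w) := by
  rw [← LinearMap.ker_eq_bot, LinearMap.ker_eq_bot']
  rintro ⟨t, c, γ⟩ h
  obtain ⟨rfl, dir_eq_zero, exc_eq_zero⟩ : t = 0 ∧ _ ∧ _ := by
    simpa only [tangentLift, LinearMap.coe_mk, AddHom.coe_mk, Prod.mk_eq_zero] using h
  have hc : c = 0 := by
    obtain ⟨i, hi⟩ := Function.ne_iff.mp hdir
    exact (mul_eq_zero.mp (by simpa [differential] using congrFun dir_eq_zero i)).resolve_right hi
  have hγ : γ = 0 := funext fun b => by
    obtain ⟨ij, hij⟩ := Function.ne_iff.mp (hexc b)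
    exact (mul_eq_zero.mp (by simpa [differential] using congrFun (congrFun exc_eq_zero b) ij))
      |>.resolve_right hij
  rw [hc, hγ]
  rfl

/-- The tangent vectors of the chart already contribute four dimensions. -/
lemma not_isNonsingularAt [Finite B] (P : ChartPoint K a B)
    (hP : IsSingularAt (localEq a P.chart) P.pt)
    (hdir : (fun i => eval P.pt (surfaceGens a P.chart i)) ≠ 0)
    (hexc : ∀ b : B, (fun ij => eval P.pt (pointGens b.1.rep P.chart ij)) ≠ 0)
    {u : K} (hu : ∀ i, P.dir.rep i = u * eval P.pt (surfaceGens a P.chart i))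
    {w : B → K} (hw : ∀ b ij, (P.exc b).rep ij = w b * eval P.pt (pointGens b.1.rep P.chart ij)) :
    ¬ IsNonsingularAt P := by
  have : Fintype B := Fintype.ofFinite B
  intro nonsingular
  have range_le : LinearMap.range (tangentLift P u w) ≤ Submodule.span K (tangentVectors P) := by
    rintro _ ⟨x, rfl⟩
    exact Submodule.subset_span ⟨isBlowUpPoint_dualNumber hP P.dir.rep_nonzero hu _ _,
      fun b => isBlowUpPoint_dualNumber hP (P.exc b).rep_nonzero (hw b) _ _⟩
  have dim_le := Submodule.finrank_mono range_le
  rw [LinearMap.finrank_range_of_inj (tangentLift_injective P hdir hexc u w),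
    nonsingular] at dim_le
  simp [Nat.card_eq_fintype_card] at dim_le

lemma exists_chartPoint_one {v : Fin 4 → K} (hv : eval v (localEq a 1) = 0)
    (hdir : (fun i => eval v (surfaceGens a 1 i)) ≠ 0)
    (hexc : ∀ b : B, (fun ij => eval v (pointGens b.1.rep 1 ij)) ≠ 0) :
    ∃ (P : ChartPoint K a B) (u : K) (w : B → K), P.chart = 1 ∧ P.pt = v ∧
      (∀ i, P.dir.rep i = u * eval v (surfaceGens a 1 i)) ∧
      ∀ b ij, (P.exc b).rep ij = w b * eval v (pointGens b.1.rep 1 ij) := by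
  obtain ⟨u, hu⟩ := Projectivization.exists_smul_eq_mk_rep K _ hdir
  choose w hw using fun b => Projectivization.exists_smul_eq_mk_rep K _ (hexc b)
  have dir_eq (i) : (Projectivization.mk K _ hdir).rep i = u * eval v (surfaceGens a 1 i) :=
    (congrFun hu i).symm
  have exc_eq (b ij) : (Projectivization.mk K _ (hexc b)).rep ij
      = w b * eval v (pointGens b.1.rep 1 ij) := (congrFun (hw b) ij).symm
  exact ⟨{
      chart := 1
      pt := v
      on_threefold := hv
      dir := Projectivization.mk K _ hdir
      dir_mem := isBlowUpPoint_of_eq_mul hv u dir_eq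
        ((Function.ne_iff.mp (Projectivization.rep_nonzero _)).imp fun _ hi => Ne.isUnit hi)
      exc := fun b => Projectivization.mk K _ (hexc b)
      exc_mem := fun b => isBlowUpPoint_of_eq_mul hv (w b) (exc_eq b)
        ((Function.ne_iff.mp (Projectivization.rep_nonzero _)).imp fun _ hi => Ne.isUnit hi) },
    u, fun b => w b, rfl, rfl, dir_eq, exc_eq⟩

lemma mem_of_forall_isNonsingularAt (ha : ∀ i, a i ≠ 0) (hB : ∀ b ∈ B, IsNodeParam a b.rep)
    (h : ∀ P : ChartPoint K a B, IsNonsingularAt P) {b : ℙ K (Fin 5 → K)}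
    (hb : IsNodeParam a b.rep) : b ∈ B := by
  by_contra hbB
  have : Finite B := (finite_isNodeParam ha).subset hB
  set v := chartCoords 1 b.rep
  have singular : IsSingularAt (localEq a 1) v := hb.isSingularAt
  have hdir : (fun i => eval v (surfaceGens a 1 i)) ≠ 0 := fun h0 => by
    have hy := congrFun h0 1
    simp only [surfaceGens, Matrix.cons_val_one, Matrix.cons_val_zero, eval_X, Pi.zero_apply] at hy
    exact div_ne_zero (hb.1 _) (hb.1 _) hy
  have hexc (b' : B) : (fun ij => eval v (pointGens b'.1.rep 1 ij)) ≠ 0 := fun h0 => by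
    rw [eval_pointGens] at h0
    have coords_eq := eq_chartCoords_of_wedge_eq_zero (hB b'.1 b'.2).1 h0
    exact hbB (eq_of_chartCoords_eq hb.1 (hB b'.1 b'.2).1 coords_eq ▸ b'.2)
  obtain ⟨P, u, w, hchart, hpt, hu, hw⟩ := exists_chartPoint_one singular.1 hdir hexc
  refine not_isNonsingularAt P ?_ ?_ ?_ (u := u) ?_ (w := w) ?_ (h P) <;> rwa [hchart, hpt]

end Tangent

/-! ### Reduction of the nodes -/

section CharTwo

variable {K : Type*} [Field K]

lemma isNodeParam_one (h2 : (2 : K) = 0) :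
    IsNodeParam (fun _ => (1 : K)) (fun _ => 1) := by
  refine ⟨fun _ => one_ne_zero, 1, one_ne_zero, Fin.lastCases ?_ fun i => ?_⟩
  · change phiVec (fun _ => (1 : K)) 5 = _
    rw [phiVec_five, Fin.sum_univ_five]
    linear_combination 12 * h2
  · rw [phiVec_castSucc, one_pow, one_mul]

/-- In characteristic `2`, the first column of the Hessian at the point `(1 : 1 : 1 : 1 : 1)`
vanishes. -/
lemma not_isNodeAt_one (h2 : (2 : K) = 0) :
    ¬ IsNodeAt (localEq (fun _ => (1 : K)) 1) (chartCoords 1 fun _ => 1) := by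
  have coords_eq : (chartCoords 1 fun _ => 1 : Fin 4 → K) = fun _ => 1 := funext fun _ => div_one 1
  rw [coords_eq]
  refine fun h => h.2 (Matrix.det_eq_zero_of_column_eq_zero 0 fun i => ?_)
  fin_cases i <;> simp [localEq, Derivation.leibniz, pderiv_X]
  · linear_combination 4 * h2
  · linear_combination 15 * h2
  · linear_combination 14 * h2
  · linear_combination 13 * h2

end CharTwo

section Reduction

variable {p : ℕ} [Fact p.Prime] {a : Fin 6 → ℤ}

lemma IsReductionOfNode.smul {v : Fin 5 → AlgebraicClosure (ZMod p)} (h : IsReductionOfNode p a v)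
    {u : AlgebraicClosure (ZMod p)} (hu : u ≠ 0) : IsReductionOfNode p a (u • v) := by
  obtain ⟨red, β, hβ, hs, c, hc, hv⟩ := h
  exact ⟨red, β, hβ, hs, u * c, mul_ne_zero hu hc, fun i => by
    rw [Pi.smul_apply, smul_eq_mul, hv, mul_assoc]⟩

section

variable {K : Type*} [Field K] [Algebra K (AlgebraicClosure (ZMod p))]

lemma intCast_ne_zero_of_zmod {n : ℤ} (hn : (n : ZMod p) ≠ 0) : (n : K) ≠ 0 := by
  rw [← map_ne_zero (algebraMap K (AlgebraicClosure (ZMod p))), map_intCast,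
    ← map_intCast (algebraMap (ZMod p) (AlgebraicClosure (ZMod p)))]
  exact (map_ne_zero _).mpr hn

end

lemma IsReductionOfNode.isNodeParam (ha : ∀ i, (a i : ZMod p) ≠ 0)
    {v : Fin 5 → AlgebraicClosure (ZMod p)} (h : IsReductionOfNode p a v) (hv0 : v ≠ 0) :
    IsNodeParam (fun i => (a i : AlgebraicClosure (ZMod p))) v := by
  obtain ⟨red, β, hβ, singular, c, hc, hv⟩ := h
  have ha5 : (a 5 : AlgebraicClosure ℚ) ≠ 0 := fun h0 => ha 5 <| by
    rw [Int.cast_eq_zero.mp h0, Int.cast_zero]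
  have hβ' (i) : (β i : AlgebraicClosure ℚ) ≠ 0 := fun h0 => hβ i (Subtype.ext h0)
  have nodeParam_alg := isNodeParam_of_isSingularAt ha5 hβ' singular
  have v_eq : v = c • fun i => red (β i) := funext hv
  have reduction_ne_zero : (fun i => red (β i)) ≠ 0 := fun h0 => hv0 (by rw [v_eq, h0, smul_zero])
  rw [v_eq]
  refine IsNodeParam.smul ?_ hc
  have reduced := IsNodeParam.of_map (f := algebraMap AlgInt (AlgebraicClosure ℚ))
    (a := fun i => (a i : AlgInt)) (b := β) Subtype.val_injective red
    (fun i => by rw [map_intCast]; exact intCast_ne_zero_of_zmod (ha i)) reduction_ne_zero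
    (by simp only [map_intCast]; exact nodeParam_alg)
  simpa only [map_intCast] using reduced

variable {K : Type} [Field K] [Algebra K (AlgebraicClosure (ZMod p))]

lemma isNodeParam_of_mem_reducedNodes (ha : ∀ i, (a i : ZMod p) ≠ 0) {b : ℙ K (Fin 5 → K)}
    (hb : b ∈ reducedNodes p a K) : IsNodeParam (fun i => (a i : K)) b.rep := by
  have image_ne_zero : (fun i => algebraMap K (AlgebraicClosure (ZMod p)) (b.rep i)) ≠ 0 :=
    fun h0 => b.rep_nonzero <| funext fun i => (map_eq_zero _).mp (congrFun h0 i)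
  exact IsNodeParam.of_map (algebraMap K (AlgebraicClosure (ZMod p))).injective (RingHom.id K)
    (a := fun i => (a i : K)) (b := b.rep) (fun i => intCast_ne_zero_of_zmod (ha i)) b.rep_nonzero
    (by simpa only [map_intCast] using IsReductionOfNode.isNodeParam ha hb image_ne_zero)

lemma HasSmoothReduction.mk_mem_reducedNodes (h : HasSmoothReduction p a)
    {v : Fin 5 → AlgebraicClosure (ZMod p)}
    (hv : IsNodeParam (fun i => (a i : AlgebraicClosure (ZMod p))) v) (hv0 : v ≠ 0) :
    Projectivization.mk _ v hv0 ∈ reducedNodes p a (AlgebraicClosure (ZMod p)) :=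
  mem_of_forall_isNonsingularAt (fun i => intCast_ne_zero_of_zmod (h.1 i))
    (fun _ hb => isNodeParam_of_mem_reducedNodes h.1 hb) h.2.2 (isNodeParam_rep_mk hv hv0)

lemma HasSmoothReduction.isReductionOfNode (h : HasSmoothReduction p a)
    {v : Fin 5 → AlgebraicClosure (ZMod p)}
    (hv : IsNodeParam (fun i => (a i : AlgebraicClosure (ZMod p))) v) :
    IsReductionOfNode p a v := by
  have hv0 : v ≠ 0 := fun h0 => hv.1 0 (congrFun h0 0)
  obtain ⟨u, hu⟩ := Projectivization.exists_smul_eq_mk_rep (AlgebraicClosure (ZMod p)) v hv0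
  have reduction : IsReductionOfNode p a (Projectivization.mk _ v hv0).rep :=
    h.mk_mem_reducedNodes hv hv0
  rw [← inv_smul_eq_iff.mpr hu.symm]
  exact reduction.smul (u⁻¹).ne_zero

lemma HasSmoothReduction.reducedNodes_eq (h : HasSmoothReduction p a) :
    reducedNodes p a K = phiFibre fun i => (a i : K) := by
  ext b
  refine ⟨isNodeParam_of_mem_reducedNodes h.1, fun hb => h.isReductionOfNode ?_⟩
  have hb : IsNodeParam (fun i => (a i : K)) b.rep := hb
  have image_ne_zero : (fun i => algebraMap K (AlgebraicClosure (ZMod p)) (b.rep i)) ≠ 0 :=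
    fun h0 => hb.1 0 ((map_eq_zero _).mp (congrFun h0 0))
  simpa only [map_intCast] using IsNodeParam.of_map (f := RingHom.id K) Function.injective_id
    (algebraMap K (AlgebraicClosure (ZMod p)))
    (fun i => (map_ne_zero _).mpr (intCast_ne_zero_of_zmod (h.1 i))) image_ne_zero hb

lemma HasSmoothReduction.isNodeAt (h : HasSmoothReduction p a)
    {v : Fin 5 → AlgebraicClosure (ZMod p)}
    (hv : IsNodeParam (fun i => (a i : AlgebraicClosure (ZMod p))) v) :
    IsNodeAt (localEq (fun i => (a i : AlgebraicClosure (ZMod p))) 1) (chartCoords 1 v) := by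
  have hv0 : v ≠ 0 := fun h0 => hv.1 0 (congrFun h0 0)
  obtain ⟨u, hu⟩ := Projectivization.exists_smul_eq_mk_rep (AlgebraicClosure (ZMod p)) v hv0
  have node := h.2.1 _ (h.mk_mem_reducedNodes hv hv0)
  rwa [← hu, Units.smul_def, chartCoords_smul _ _ u.ne_zero] at node

lemma HasSmoothReduction.ne_two (h : HasSmoothReduction p a) : p ≠ 2 := by
  rintro rfl
  have h2 : (2 : AlgebraicClosure (ZMod 2)) = 0 := CharTwo.two_eq_zero
  have param_eq_one : (fun i => (a i : AlgebraicClosure (ZMod 2))) = fun _ => 1 := by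
    ext i
    have ha : (a i : ZMod 2) = 1 := Fin.eq_one_of_ne_zero _ (h.1 i)
    rw [← map_intCast (algebraMap (ZMod 2) (AlgebraicClosure (ZMod 2))), ha, map_one]
  have node := h.isNodeAt (param_eq_one ▸ isNodeParam_one h2)
  rw [param_eq_one] at node
  exact not_isNodeAt_one h2 node

lemma HasSmoothReduction.two_ne_zero (h : HasSmoothReduction p a) : (2 : K) ≠ 0 := by
  have : CharP K p :=
    ((algebraMap K (AlgebraicClosure (ZMod p))).charP_iff (RingHom.injective _) p).mpr inferInstance
  exact Ring.two_ne_zero (ringChar.eq K p ▸ h.ne_two)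

end Reduction

end A4

theorem mainTheorem10_general (p : ℕ) [Fact p.Prime] (a : Fin 6 → ℤ)
    (hgood : A4.HasSmoothReduction p a) (K : Type) [Field K] [Fintype K] [DecidableEq K]
    [Algebra K (AlgebraicClosure (ZMod p))] :
    (Nat.card (A4.ReducedBigResolution p a K) : ℤ) =
      48 * (Fintype.card K : ℤ) ^ 2 + 46 * (Fintype.card K : ℤ) + 14
      + (∑ x : Kˣ, ∑ y : Kˣ, ∑ z : Kˣ,
          (quadraticChar K (A4.discr (fun i => (a i : K)) (x : K) (y : K) (z : K)) + 1))
      + (∑ᶠ b ∈ A4.phiFibre (fun i => (a i : K)),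
          (Fintype.card K : ℤ) * ((Fintype.card K : ℤ) + 1
            + quadraticChar K ((∏ i, b.rep i) * ∑ i, b.rep i)))
      + (if (a 0 : K) = (a 5 : K) then
          (Fintype.card K : ℤ)
            * ((Nat.card (A4.ellipticCurve (a 1 : K) (a 2 : K) (a 4 : K) (a 3 : K)) : ℤ) - 6)
        else 0) := by
  have h2 : (2 : K) ≠ 0 := hgood.two_ne_zero
  have ha (i : Fin 6) : (a i : K) ≠ 0 := A4.intCast_ne_zero_of_zmod (hgood.1 i)
  have nodeParam_of_mem (b) (hb : b ∈ A4.reducedNodes p a K) :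
      A4.IsNodeParam (fun i => (a i : K)) b.rep := A4.isNodeParam_of_mem_reducedNodes hgood.1 hb
  rw [A4.ReducedBigResolution, A4.card_bigResolution_eq h2 ha nodeParam_of_mem,
    A4.card_normalPoint ha, A4.card_isBoundaryNode ha, A4.sum_torus h2 ha, hgood.reducedNodes_eq]
  simp only [A4.nodeExcess]
  ring

theorem mainTheorem10 (p : ℕ) [Fact p.Prime] (a : Fin 6 → ℤ) (ha : ∃ i, ¬ (p : ℤ) ∣ a i)
    (hgood : A4.HasSmoothReduction p a) :
    (Nat.card (A4.ReducedBigResolution p a (ZMod p)) : ℤ) =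
      48 * (p : ℤ) ^ 2 + 46 * (p : ℤ) + 14
      + (∑ x : (ZMod p)ˣ, ∑ y : (ZMod p)ˣ, ∑ z : (ZMod p)ˣ,
          (quadraticChar (ZMod p)
            (A4.discr (fun i => (a i : ZMod p)) (x : ZMod p) (y : ZMod p) (z : ZMod p)) + 1))
      + (∑ᶠ b ∈ A4.phiFibre (fun i => (a i : ZMod p)),
          (p : ℤ) * ((p : ℤ) + 1
            + quadraticChar (ZMod p) ((∏ i, b.rep i) * ∑ i, b.rep i)))
      + (if (a 0 : ZMod p) = (a 5 : ZMod p) then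
          (p : ℤ) * ((Nat.card (A4.ellipticCurve (a 1 : ZMod p) (a 2 : ZMod p) (a 4 : ZMod p)
            (a 3 : ZMod p)) : ℤ) - 6)
        else 0) := by
  simpa only [ZMod.card] using mainTheorem10_general p a hgood (ZMod p)
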